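/- **Setting.** Let $\sigma\subseteq\mathbb C=\mathbb R^2$ be nonempty and compact and $f:\sigma\to\mathbb C$. For a finite list $S=[x_0,\dots,x_n]$ ($n\ge 0$) of points of $\sigma$ with $x_{i-1}\ne x_i$ for $1\le i\le n$, put $\operatorname{cvar}(f,S)=\sum_{i=1}^n|f(x_i)-f(x_{i-1})|$. For a line $\ell$ and $0\le i<n$, the segment from $x_i$ to $x_{i+1}$ is a *crossing segment* of $S$ on $\ell$ if (i) $x_i,x_{i+1}$ lie strictly on opposite sides of $\ell$, or (ii) $i=0$ and $x_0\in\ell$, or (iii) $x_i\notin\ell$ and $x_{i+1}\in\ell$. For $n\ge1$ let $\operatorname{vf}(S)$ be the maximum over all lines $\ell$ of the number of crossing segments of $S$ on $\ell$; for $n=0$ let $\operatorname{vf}(S)=1$. Put $$\operatorname{var}(f,\sigma)=\sup_S\frac{\operatorname{cvar}(f,S)}{\operatorname{vf}(S)},\qquad \|f\|_{BV(\sigma)}=\|f\|_\infty+\operatorname{var}(f,\sigma).$$ $BV(\sigma)$ is the Banach algebra of all $f$ with $\|f\|_{BV(\sigma)}<\infty$ under pointwise operations, and $AC(\sigma)$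 is the closure in $BV(\sigma)$ of the restrictions to $\sigma$ of the complex polynomials in the two real variables $x,y$. A *differentiable convex curve* is a simple arc of finite length with distinct endpoints which has a supporting line through each of its points and is differentiable (its arc-length parametrization is differentiable) except perhaps at its endpoints. Convex polygons are nondegenerate and include their interior. A *polygonal mosaic* is a finite collection $\mathcal M$ of convex polygons with connected union such that any two distinct members that intersect do so either in a single point which is a vertex of both, or in a segment which is a full side of both. A nonempty compact connected set $\sigma\subseteq\mathbb R^2$ is a *polygonally inscribed curve* if there is a polygonal mosaic $\mathcal M$ with $\sigma\subseteq\bigcup_{P\in\mathcal M}P$ such that for every $P\in\mathcal M$ the set $\sigma\cap P$ is a differentiable convex curve joining two vertices of $P$ and meeting the boundary of $P$ only at these two points. Let $\mathrm{PIC}$ be the family of all polygonally inscribed curves. **Theorem.** $\mathrm{PIC}$ is a Gelfand–Kolmogorov family: for all $\sigma,\tau\in\mathrm{PIC}$, the algebras $AC(\sigma)$ and $AC(\tau)$ are isomorphic as Banach algebras (that is, there is an algebra isomorphism between them which is continuous with continuous inverse) if and only if $\sigma$ and $\tau$ are homeomorphic. -/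

import Mathlib

open Set
open scoped ENNReal

noncomputable section

namespace ACSigma

/-! ### Curve variation and the variation factor -/

/-- A (straight) line in the plane: the set of `z` with `⟪normal, z⟫ = offset`, `normal ≠ 0`. -/
structure Line where
  normal : ℂ
  offset : ℝ
  normal_ne : normal ≠ 0

/-- Signed (unnormalised) height of a point over a line: it vanishes exactly on the line, and two
points lie strictly on opposite sides of the line iff their heights have opposite signs. -/
def Line.height (l : Line) (z : ℂ) : ℝ := inner ℝ l.normal z - l.offset

/-- The `i`-th segment, from `x i` to `x (i+1)`, of the list `[x 0, …, x n]` is a crossing segment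
of the list on the line `l`. -/
def IsCrossing {n : ℕ} (x : Fin (n + 1) → ℂ) (l : Line) (i : Fin n) : Prop :=
  l.height (x i.castSucc) * l.height (x i.succ) < 0 ∨
  ((i : ℕ) = 0 ∧ l.height (x i.castSucc) = 0) ∨
  (l.height (x i.castSucc) ≠ 0 ∧ l.height (x i.succ) = 0)

open Classical in
/-- `vf(S, l)`: the number of crossing segments of `S` on `l`; for a one-point list it is `1` if the
point lies on `l` and `0` otherwise. -/
def vfLine {n : ℕ} (x : Fin (n + 1) → ℂ) (l : Line) : ℕ :=
  if n = 0 then (if l.height (x 0) = 0 then 1 else 0)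
  else (Finset.univ.filter (fun i : Fin n => IsCrossing x l i)).card

/-- The variation factor `vf(S) = max_l vf(S, l)`. -/
def vf {n : ℕ} (x : Fin (n + 1) → ℂ) : ℕ := ⨆ l : Line, vfLine x l

theorem vfLine_le {n : ℕ} (x : Fin (n + 1) → ℂ) (l : Line) : vfLine x l ≤ n + 1 := by
  classical
  unfold vfLine
  split_ifs
  · omega
  · omega
  · refine (Finset.card_le_univ _).trans ?_
    simp

/-- The supremum defining `vf` is over a bounded set of natural numbers. -/
theorem vfLine_le_vf {n : ℕ} (x : Fin (n + 1) → ℂ) (l : Line) : vfLine x l ≤ vf x :=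
  le_ciSup (f := fun l : Line => vfLine x l)
    ⟨n + 1, by rintro _ ⟨l, rfl⟩; exact vfLine_le x l⟩ l

/-- The curve variation of `f` on the list `[x 0, …, x n]`. -/
def cvar {σ : Set ℂ} (f : σ → ℂ) {n : ℕ} (x : Fin (n + 1) → σ) : ℝ≥0∞ :=
  ∑ i : Fin n, ‖f (x i.succ) - f (x i.castSucc)‖ₑ

/-- The two-dimensional variation of `f` on `σ`: the supremum of `cvar(f, S) / vf(S)` over all
finite nonempty lists `S` in `σ` whose consecutive points are different. -/
def var {σ : Set ℂ} (f : σ → ℂ) : ℝ≥0∞ :=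
  ⨆ (n : ℕ) (x : Fin (n + 1) → σ) (_ : ∀ i : Fin n, x i.castSucc ≠ x i.succ),
    cvar f x / (vf (fun i => (x i : ℂ)) : ℝ≥0∞)

/-- The supremum norm, with value `∞` for unbounded functions. -/
def supNorm {σ : Set ℂ} (f : σ → ℂ) : ℝ≥0∞ := ⨆ z : σ, ‖f z‖ₑ

/-- The variation norm `‖f‖_∞ + var(f, σ)`, with value `∞` if `f` is not of bounded variation. -/
def bvNorm {σ : Set ℂ} (f : σ → ℂ) : ℝ≥0∞ := supNorm f + var f

section Basic

variable {σ : Set ℂ}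

theorem enorm_le_supNorm (f : σ → ℂ) (z : σ) : ‖f z‖ₑ ≤ supNorm f :=
  le_iSup (fun z : σ => ‖f z‖ₑ) z

theorem le_var (f : σ → ℂ) {n : ℕ} (x : Fin (n + 1) → σ)
    (hx : ∀ i : Fin n, x i.castSucc ≠ x i.succ) :
    cvar f x / (vf (fun i => (x i : ℂ)) : ℝ≥0∞) ≤ var f :=
  le_iSup_of_le n (le_iSup_of_le x (le_iSup_of_le hx le_rfl))

theorem supNorm_const (c : ℂ) : supNorm (fun _ : σ => c) ≤ ‖c‖ₑ := iSup_le fun _ => le_rfl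

theorem supNorm_add (f g : σ → ℂ) : supNorm (f + g) ≤ supNorm f + supNorm g :=
  iSup_le fun z => (enorm_add_le _ _).trans
    (add_le_add (enorm_le_supNorm f z) (enorm_le_supNorm g z))

theorem supNorm_mul (f g : σ → ℂ) : supNorm (f * g) ≤ supNorm f * supNorm g :=
  iSup_le fun z => by
    rw [Pi.mul_apply, enorm_mul]
    exact mul_le_mul' (enorm_le_supNorm f z) (enorm_le_supNorm g z)

theorem var_const (c : ℂ) : var (fun _ : σ => c) = 0 := by
  simp [var, cvar]

theorem var_add (f g : σ → ℂ) : var (f + g) ≤ var f + var g := by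
  refine iSup_le fun n => iSup_le fun x => iSup_le fun hx => ?_
  refine le_trans ?_ (add_le_add (le_var f x hx) (le_var g x hx))
  rw [← ENNReal.add_div]
  refine ENNReal.div_le_div_right ?_ _
  unfold cvar
  rw [← Finset.sum_add_distrib]
  refine Finset.sum_le_sum fun i _ => ?_
  refine le_trans (le_of_eq ?_) (enorm_add_le _ _)
  congr 1
  simp only [Pi.add_apply]
  ring

theorem var_mul (f g : σ → ℂ) : var (f * g) ≤ supNorm f * var g + supNorm g * var f := by
  refine iSup_le fun n => iSup_le fun x => iSup_le fun hx => ?_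
  refine le_trans ?_ (add_le_add (mul_le_mul_right (le_var g x hx) _)
    (mul_le_mul_right (le_var f x hx) _))
  rw [← mul_div_assoc, ← mul_div_assoc, ← ENNReal.add_div]
  refine ENNReal.div_le_div_right ?_ _
  unfold cvar
  rw [Finset.mul_sum, Finset.mul_sum, ← Finset.sum_add_distrib]
  refine Finset.sum_le_sum fun i _ => ?_
  have h : (f * g) (x i.succ) - (f * g) (x i.castSucc) =
      f (x i.succ) * (g (x i.succ) - g (x i.castSucc)) +
        g (x i.castSucc) * (f (x i.succ) - f (x i.castSucc)) := by
    simp only [Pi.mul_apply]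
    ring
  rw [h]
  refine (enorm_add_le _ _).trans ?_
  rw [enorm_mul, enorm_mul]
  exact add_le_add (mul_le_mul_left (enorm_le_supNorm f _) _)
    (mul_le_mul_left (enorm_le_supNorm g _) _)

theorem bvNorm_const (c : ℂ) : bvNorm (fun _ : σ => c) ≤ ‖c‖ₑ := by
  rw [bvNorm, var_const, add_zero]
  exact supNorm_const c

theorem bvNorm_add (f g : σ → ℂ) : bvNorm (f + g) ≤ bvNorm f + bvNorm g := by
  unfold bvNorm
  refine (add_le_add (supNorm_add f g) (var_add f g)).trans (le_of_eq ?_)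
  ring

theorem bvNorm_mul (f g : σ → ℂ) : bvNorm (f * g) ≤ bvNorm f * bvNorm g := by
  unfold bvNorm
  refine (add_le_add (supNorm_mul f g) (var_mul f g)).trans ?_
  have h : (supNorm f + var f) * (supNorm g + var g) =
      (supNorm f * supNorm g + (supNorm f * var g + supNorm g * var f)) + var f * var g := by
    ring
  rw [h]
  exact le_self_add

theorem bvNorm_smul_le (c : ℂ) (f : σ → ℂ) : bvNorm (c • f) ≤ ‖c‖ₑ * bvNorm f := by
  have h : c • f = (fun _ : σ => c) * f := by
    ext z
    simp
  rw [h]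
  exact (bvNorm_mul _ _).trans (mul_le_mul_left (bvNorm_const c) _)

theorem bvNorm_neg (f : σ → ℂ) : bvNorm (-f) = bvNorm f := by
  have key : ∀ g : σ → ℂ, bvNorm (-g) ≤ bvNorm g := fun g => by
    simpa using bvNorm_smul_le (-1) g
  exact le_antisymm (key f) (by simpa using key (-f))

end Basic

/-! ### The Banach algebra `BV(σ)` and its subalgebra `AC(σ)` -/

/-- The functions of bounded variation, as a subalgebra of all functions `σ → ℂ`. -/
def bvSubalgebra (σ : Set ℂ) : Subalgebra ℂ (σ → ℂ) where
  carrier := {f | bvNorm f < ∞}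
  mul_mem' {f g} hf hg := (bvNorm_mul f g).trans_lt (ENNReal.mul_lt_top hf hg)
  add_mem' {f g} hf hg := (bvNorm_add f g).trans_lt (ENNReal.add_lt_top.2 ⟨hf, hg⟩)
  algebraMap_mem' c := (bvNorm_const c).trans_lt enorm_lt_top

/-- The space `BV(σ)`. It is a type of its own, so that its topology is that of the variation norm
and not that of pointwise convergence. -/
def BV (σ : Set ℂ) : Type := bvSubalgebra σ

namespace BV

variable {σ : Set ℂ}

instance : CommRing (BV σ) := inferInstanceAs (CommRing (bvSubalgebra σ))

instance : Algebra ℂ (BV σ) := inferInstanceAs (Algebra ℂ (bvSubalgebra σ))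

/-- The inclusion of `BV(σ)` in the algebra of all functions `σ → ℂ`. -/
def toFun (σ : Set ℂ) : BV σ →ₐ[ℂ] (σ → ℂ) := (bvSubalgebra σ).val

theorem toFun_injective : Function.Injective (toFun σ) := Subtype.val_injective

theorem bvNorm_lt_top (f : BV σ) : bvNorm (toFun σ f) < ∞ := f.2

/-- `BV(σ)` with pointwise operations and the variation norm. -/
instance : NormedCommRing (BV σ) :=
  { (inferInstance : CommRing (BV σ)) with
    norm := fun f => (bvNorm (toFun σ f)).toReal
    dist := fun f g => (bvNorm (toFun σ (-f + g))).toReal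
    dist_self := fun f => by
      have h := bvNorm_const (σ := σ) 0
      rw [enorm_zero] at h
      have h0 : toFun σ (-f + f) = fun _ => 0 := by
        rw [neg_add_cancel, map_zero]
        rfl
      rw [h0, le_antisymm h zero_le]
      rfl
    dist_comm := fun f g => by
      have h : toFun σ (-f + g) = -toFun σ (-g + f) := by
        rw [← map_neg]
        congr 1
        abel
      rw [h, bvNorm_neg]
    dist_triangle := fun f g h => by
      have e : toFun σ (-f + h) = toFun σ (-f + g) + toFun σ (-g + h) := by
        rw [← map_add]
        congr 1
        abel
      rw [← ENNReal.toReal_add (bvNorm_lt_top _).ne (bvNorm_lt_top _).ne, e]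
      exact ENNReal.toReal_mono
        (ENNReal.add_ne_top.2 ⟨(bvNorm_lt_top _).ne, (bvNorm_lt_top _).ne⟩) (bvNorm_add _ _)
    eq_of_dist_eq_zero := fun {f g} h => by
      have h' : bvNorm (toFun σ (-f + g)) = 0 := by
        rcases (ENNReal.toReal_eq_zero_iff _).1 h with h | h
        · exact h
        · exact absurd h (bvNorm_lt_top _).ne
      have e : toFun σ (-f + g) = 0 := by
        ext z
        have hz := (enorm_le_supNorm (toFun σ (-f + g)) z).trans (le_self_add.trans h'.le)
        simpa using hz
      have e' : -f + g = 0 := toFun_injective (by rw [e, map_zero])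
      exact neg_add_eq_zero.1 e'
    dist_eq := fun _ _ => rfl
    norm_mul_le := fun f g => by
      rw [← ENNReal.toReal_mul, map_mul]
      exact ENNReal.toReal_mono
        (ENNReal.mul_ne_top (bvNorm_lt_top _).ne (bvNorm_lt_top _).ne) (bvNorm_mul _ _) }

theorem norm_def (f : BV σ) : ‖f‖ = (bvNorm (toFun σ f)).toReal := rfl

instance : NormedAlgebra ℂ (BV σ) :=
  { (inferInstance : Algebra ℂ (BV σ)) with
    norm_smul_le := fun c f => by
      rw [norm_def, norm_def, ← toReal_enorm c, ← ENNReal.toReal_mul, map_smul]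
      exact ENNReal.toReal_mono
        (ENNReal.mul_ne_top enorm_ne_top (bvNorm_lt_top _).ne) (bvNorm_smul_le c _) }

end BV

/-- The functions `σ → ℂ` given by complex polynomials in the two real variables `x = Re z` and
`y = Im z`. -/
def polyFunctions (σ : Set ℂ) : Subalgebra ℂ (σ → ℂ) :=
  (MvPolynomial.aeval ![fun z : σ => ((z : ℂ).re : ℂ), fun z : σ => ((z : ℂ).im : ℂ)] :
    MvPolynomial (Fin 2) ℂ →ₐ[ℂ] (σ → ℂ)).range

/-- `𝒫₂(σ)` as a subalgebra of `BV(σ)`. For bounded `σ` every polynomial function has bounded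
variation (`polyFunctions_le`), so no polynomial is lost. -/
def P2 (σ : Set ℂ) : Subalgebra ℂ (BV σ) := (polyFunctions σ).comap (BV.toFun σ)

/-- The algebra `AC(σ)` of absolutely continuous functions: the closure of `𝒫₂(σ)` in `BV(σ)`. -/
def AC (σ : Set ℂ) : Subalgebra ℂ (BV σ) := (P2 σ).topologicalClosure

theorem linear_mem_bv {σ : Set ℂ} (hσ : Bornology.IsBounded σ) (v : ℂ) (hv : v ≠ 0) :
    (fun z : σ => ((inner ℝ v (z : ℂ) : ℝ) : ℂ)) ∈ bvSubalgebra σ := by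
  classical
  obtain ⟨R, hR⟩ := hσ.exists_norm_le
  set B : ℝ := ‖v‖ * R with hB
  have hb : ∀ z ∈ σ, |(inner ℝ v z : ℝ)| ≤ B := fun z hz =>
    (abs_real_inner_le_norm v z).trans (mul_le_mul_of_nonneg_left (hR z hz) (norm_nonneg _))
  have hsup : supNorm (fun z : σ => ((inner ℝ v (z : ℂ) : ℝ) : ℂ)) ≤ ENNReal.ofReal B := by
    refine iSup_le fun z => ?_
    rw [← ofReal_norm, Complex.norm_real]
    exact ENNReal.ofReal_le_ofReal (hb z z.2)
  have hvar : var (fun z : σ => ((inner ℝ v (z : ℂ) : ℝ) : ℂ)) ≤ ENNReal.ofReal (B - -B) := by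
    refine iSup_le fun n => iSup_le fun x => iSup_le fun hx => ?_
    refine ENNReal.div_le_of_le_mul ?_
    let a : Fin (n + 1) → ℝ := fun i => inner ℝ v (x i : ℂ)
    let I : Fin n → Set ℝ := fun i => Set.Ioo (min (a i.castSucc) (a i.succ))
      (max (a i.castSucc) (a i.succ))
    have hI : ∀ i, MeasurableSet (I i) := fun i => measurableSet_Ioo
    have h1 : ∀ i, ‖((a i.succ : ℝ) : ℂ) - ((a i.castSucc : ℝ) : ℂ)‖ₑ
        = ∫⁻ t, (I i).indicator 1 t := fun i => by
      rw [MeasureTheory.lintegral_indicator_one (hI i), Real.volume_Ioo, max_sub_min_eq_abs,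
        ← Complex.ofReal_sub, ← ofReal_norm, Complex.norm_real, Real.norm_eq_abs]
    have h2 : ∀ t : ℝ, ∑ i : Fin n, (I i).indicator (1 : ℝ → ℝ≥0∞) t ≤
        (Set.Icc (-B) B).indicator (fun _ => (vf (fun i => (x i : ℂ)) : ℝ≥0∞)) t := by
      intro t
      by_cases ht : t ∈ Set.Icc (-B) B
      · rw [Set.indicator_of_mem ht]
        have : ∑ i : Fin n, (I i).indicator (1 : ℝ → ℝ≥0∞) t
            = ((Finset.univ.filter (fun i => t ∈ I i)).card : ℝ≥0∞) := by
          rw [Finset.card_filter, Nat.cast_sum]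
          refine Finset.sum_congr rfl fun i _ => ?_
          by_cases h : t ∈ I i <;> simp [h]
        rw [this]
        norm_cast
        refine le_trans ?_ (vfLine_le_vf _ ⟨v, t, hv⟩)
        unfold vfLine
        rcases Nat.eq_zero_or_pos n with rfl | hn
        · simp
        rw [if_neg hn.ne']
        refine Finset.card_le_card fun i hi => ?_
        simp only [Finset.mem_filter, Finset.mem_univ, true_and] at hi ⊢
        refine Or.inl ?_
        change (a i.castSucc - t) * (a i.succ - t) < 0
        obtain ⟨hl, hr⟩ := hi
        rcases min_lt_iff.1 hl with h | h <;> rcases lt_max_iff.1 hr with h' | h' <;> nlinarith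
      · rw [Set.indicator_of_notMem ht]
        refine le_of_eq (Finset.sum_eq_zero fun i _ => Set.indicator_of_notMem (fun hi => ht ?_) _)
        have e1 := abs_le.1 (hb _ (x i.castSucc).2)
        have e2 := abs_le.1 (hb _ (x i.succ).2)
        exact ⟨(le_min e1.1 e2.1).trans hi.1.le, hi.2.le.trans (max_le e1.2 e2.2)⟩
    calc cvar (fun z : σ => ((inner ℝ v (z : ℂ) : ℝ) : ℂ)) x
        = ∑ i : Fin n, ∫⁻ t, (I i).indicator 1 t := Finset.sum_congr rfl fun i _ => h1 i
      _ = ∫⁻ t, ∑ i : Fin n, (I i).indicator 1 t :=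
          (MeasureTheory.lintegral_finsetSum _
            fun i _ => measurable_one.indicator (hI i)).symm
      _ ≤ ∫⁻ t, (Set.Icc (-B) B).indicator (fun _ => (vf (fun i => (x i : ℂ)) : ℝ≥0∞)) t :=
          MeasureTheory.lintegral_mono h2
      _ = ENNReal.ofReal (B - -B) * vf (fun i => (x i : ℂ)) := by
          rw [MeasureTheory.lintegral_indicator_const measurableSet_Icc, Real.volume_Icc, mul_comm]
  exact ENNReal.add_lt_top.2
    ⟨hsup.trans_lt ENNReal.ofReal_lt_top, hvar.trans_lt ENNReal.ofReal_lt_top⟩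

/-- On a bounded set every polynomial function has bounded variation. -/
theorem polyFunctions_le {σ : Set ℂ} (hσ : Bornology.IsBounded σ) :
    polyFunctions σ ≤ bvSubalgebra σ := by
  unfold polyFunctions
  rw [← Algebra.adjoin_range_eq_range_aeval, Algebra.adjoin_le_iff]
  rintro _ ⟨i, rfl⟩
  fin_cases i
  · simpa [Complex.inner] using linear_mem_bv hσ 1 one_ne_zero
  · simpa [Complex.inner] using linear_mem_bv hσ Complex.I Complex.I_ne_zero

/-! ### Gelfand–Kolmogorov families -/

/-- A family of nonempty compact plane sets is a Gelfand–Kolmogorov family if, for its members,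
`AC(σ)` and `AC(τ)` are isomorphic as Banach algebras (by an algebra isomorphism continuous in both
directions) if and only if `σ` and `τ` are homeomorphic. -/
def IsGelfandKolmogorovFamily (F : Set (Set ℂ)) : Prop :=
  (∀ σ ∈ F, σ.Nonempty ∧ IsCompact σ) ∧
  ∀ σ ∈ F, ∀ τ ∈ F, Nonempty (AC σ ≃A[ℂ] AC τ) ↔ Nonempty (σ ≃ₜ τ)

/-! ### Convex curves, polygonal mosaics, polygonally inscribed curves -/

/-- `C` is a differentiable convex curve with endpoints `p ≠ q`: a simple arc of finite length, with
a supporting line through each of its points, whose arc-length parametrization is differentiable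
with unit speed except perhaps at the endpoints. -/
def IsDiffConvexCurve (C : Set ℂ) (p q : ℂ) : Prop :=
  (∃ (L : ℝ) (γ : ℝ → ℂ), 0 < L ∧ ContinuousOn γ (Icc 0 L) ∧ InjOn γ (Icc 0 L) ∧
    γ '' Icc 0 L = C ∧ γ 0 = p ∧ γ L = q ∧
    ∀ t ∈ Ioo 0 L, ∃ d : ℂ, ‖d‖ = 1 ∧ HasDerivAt γ d t) ∧
  ∀ z ∈ C, ∃ v : ℂ, v ≠ 0 ∧ ∀ w ∈ C, 0 ≤ (inner ℝ v (w - z) : ℝ)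

/-- A convex polygon (with its interior, and not degenerate). -/
def IsConvexPolygon (P : Set ℂ) : Prop :=
  (∃ V : Finset ℂ, P = convexHull ℝ (V : Set ℂ)) ∧ (interior P).Nonempty

/-- The vertices (corners) of a convex polygon. -/
def vertices (P : Set ℂ) : Set ℂ := P.extremePoints ℝ

/-- `s` is a (full) side of the convex polygon `P`: a segment in the boundary of `P` joining two
different vertices of `P`. -/
def IsSide (P s : Set ℂ) : Prop :=
  ∃ a ∈ vertices P, ∃ b ∈ vertices P, a ≠ b ∧ s = segment ℝ a b ∧ s ⊆ frontier P

/-- A polygonal mosaic. -/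
structure IsPolygonalMosaic (M : Set (Set ℂ)) : Prop where
  finite : M.Finite
  polygon : ∀ P ∈ M, IsConvexPolygon P
  connected : IsConnected (⋃₀ M)
  inter : ∀ P ∈ M, ∀ Q ∈ M, P ≠ Q → (P ∩ Q).Nonempty →
    (∃ v, v ∈ vertices P ∧ v ∈ vertices Q ∧ P ∩ Q = {v}) ∨
    (IsSide P (P ∩ Q) ∧ IsSide Q (P ∩ Q))

/-- The family of polygonally inscribed curves. -/
def PIC : Set (Set ℂ) :=
  {σ | σ.Nonempty ∧ IsCompact σ ∧ IsConnected σ ∧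
    ∃ M : Set (Set ℂ), IsPolygonalMosaic M ∧ σ ⊆ ⋃₀ M ∧
      ∀ P ∈ M, ∃ p ∈ vertices P, ∃ q ∈ vertices P,
        IsDiffConvexCurve (σ ∩ P) p q ∧ (σ ∩ P) ∩ frontier P = {p, q}}

end ACSigma

end

/-!
A polygonally inscribed curve `σ` is a finite union of convex arcs which meet only at their
endpoints (`ArcSystem`, `exists_arcSystem_of_mem_PIC`), and the algebra `AC(σ)` sees only the
one-dimensional structure of these arcs.

*The norm.* A list of points in order along a convex arc has variation factor at most three, as a
supporting line shows, so the variation along each arc is at most three times the two-dimensional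
one. Conversely, finitely many lines separate any two points which are not on a common arc, and for
each interior point of an arc some four lines separate the pairs of points of this arc with that
point strictly between them (`IsConvexArc.exists_separating_lines`). Since a line separates the ends
of at most `2 * vf S` segments of a list `S` (`card_sep_le`), `bvNorm` is equivalent to the sum of
the supremum norm and of the variations along the arcs (`ArcSystem.arcNorm_le`,
`ArcSystem.exists_bvNorm_le`).

*The algebra.* Polynomials are Lipschitz in the parameters of the arcs. Conversely, each function
which is Lipschitz along the arcs lies in `AC(σ)` (`ArcSystem.IsLip.mem_acFunctions`): it can be
approximated by one which is constant near the endpoints; near an interior point of an arc it is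
then a Lipschitz function of one real coordinate, because the tangent of a differentiable convex
arc is continuous (`IsConvexArc.exists_inner_ge`); Lipschitz functions of one coordinate are limits
of polynomials (`exists_polynomial_eVariationOn_le`); and membership in `AC(σ)` is a local property
(`mem_acFunctions_of_local`). So `AC(σ)` is the closure of the functions which are Lipschitz along
the arcs.

*From homeomorphisms to isomorphisms.* A homeomorphism `σ → τ` need not be absolutely continuous.
But once both curves are cut at all points which are, or correspond to, endpoints of arcs of either
curve, it maps edges onto edges, and can be replaced on each edge by the affine change of parameter
with the same values at the ends (`ArcSystem.exists_piecewiseAffine_equiv`). Composition with such a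
map preserves the functions which are Lipschitz along the arcs, and is bounded in the variation
norm, whence an isomorphism (`nonempty_algEquiv_of_piecewiseAffine`).

*From isomorphisms to homeomorphisms.* For every nonempty compact `σ` the continuous characters of
`AC(σ)` are the point evaluations (`exists_eq_evalAC`), because the powers of a function of supremum
norm less than one tend to zero in the variation norm. An isomorphism therefore induces a bijection
of the curves, which is continuous since the coordinates belong to the algebras
(`nonempty_homeomorph_of_algEquiv`).
-/

namespace ACSigma

/-! ### Variation of functions of one real variable -/

/-- If no `t` lies strictly inside more than `N` of the intervals spanned by the pairs
`(a i, b i)`, then the increments of `g` over these pairs add up to at most `N` times its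
variation. -/
theorem sum_enorm_sub_le_mul_eVariationOn {ι : Type*} (I : Finset ι) {p q : ℝ} (g : ℝ → ℂ)
    (a b : ι → ℝ) (ha : ∀ i ∈ I, a i ∈ Icc p q) (hb : ∀ i ∈ I, b i ∈ Icc p q) {N : ℕ} (hN : N ≠ 0)
    (h : ∀ t ∈ Ioo p q,
      (I.filter fun i => min (a i) (b i) < t ∧ t < max (a i) (b i)).card ≤ N) :
    ∑ i ∈ I, ‖g (b i) - g (a i)‖ₑ ≤ N * eVariationOn g (Icc p q) := by
  classical
  rcases I.eq_empty_or_nonempty with rfl | ⟨i₀, hi₀⟩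
  · simp
  have hpq : p ≤ q := (ha i₀ hi₀).1.trans (ha i₀ hi₀).2
  by_cases htop : eVariationOn g (Icc p q) = ∞
  · rw [htop, ENNReal.mul_top (by exact_mod_cast hN)]
    exact le_top
  have hloc : LocallyBoundedVariationOn g (Icc p q) :=
    BoundedVariationOn.locallyBoundedVariationOn htop
  set V : ℝ → ℝ := variationOnFromTo g (Icc p q) p with hV
  have hp : p ∈ Icc p q := left_mem_Icc.2 hpq
  have hmono : MonotoneOn V (Icc p q) := variationOnFromTo.monotoneOn hloc hp
  have hV0 : V p = 0 := variationOnFromTo.self _ _ _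
  have hVq : ENNReal.ofReal (V q) = eVariationOn g (Icc p q) := by
    rw [hV, variationOnFromTo.eq_of_le _ _ hpq, inter_self, ENNReal.ofReal_toReal htop]
  let J : ι → Set ℝ := fun i => Ioo (V (min (a i) (b i))) (V (max (a i) (b i)))
  have hmin : ∀ i ∈ I, min (a i) (b i) ∈ Icc p q := fun i hi =>
    ⟨le_min (ha i hi).1 (hb i hi).1, (min_le_left _ _).trans (ha i hi).2⟩
  have hmax : ∀ i ∈ I, max (a i) (b i) ∈ Icc p q := fun i hi =>
    ⟨(ha i hi).1.trans (le_max_left _ _), max_le (ha i hi).2 (hb i hi).2⟩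
  have key : ∀ {s u : ℝ}, s ∈ Icc p q → u ∈ Icc p q → s ≤ u →
      ‖g u - g s‖ₑ ≤ ENNReal.ofReal (V u - V s) := by
    intro s u hs hu hsu
    have hfin : eVariationOn g (Icc p q ∩ Icc s u) ≠ ∞ := hloc s u hs hu
    rw [hV, variationOnFromTo.sub_right hloc hp hu hs,
      variationOnFromTo.eq_of_le _ _ hsu, ENNReal.ofReal_toReal hfin, ← edist_eq_enorm_sub]
    exact eVariationOn.edist_le _ ⟨hu, hsu, le_rfl⟩ ⟨hs, le_rfl, hsu⟩
  have h1 : ∀ i ∈ I, ‖g (b i) - g (a i)‖ₑ ≤ ∫⁻ t, (J i).indicator 1 t := by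
    intro i hi
    rw [MeasureTheory.lintegral_indicator_one measurableSet_Ioo, Real.volume_Ioo]
    refine le_trans ?_ (key (hmin i hi) (hmax i hi) min_le_max)
    rcases le_total (a i) (b i) with hab | hab
    · rw [min_eq_left hab, max_eq_right hab]
    · rw [min_eq_right hab, max_eq_left hab, ← edist_eq_enorm_sub, edist_comm, edist_eq_enorm_sub]
  have h2 : ∀ t : ℝ, ∑ i ∈ I, (J i).indicator (1 : ℝ → ℝ≥0∞) t ≤
      (Icc 0 (V q)).indicator (fun _ => (N : ℝ≥0∞)) t := by
    intro t
    have hJ : ∀ i ∈ I, t ∈ J i → t ∈ Icc 0 (V q) := fun i hi ht => by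
      refine ⟨?_, ?_⟩
      · rw [← hV0]
        exact (hmono hp (hmin i hi) (hmin i hi).1).trans ht.1.le
      · exact ht.2.le.trans (hmono (hmax i hi) (right_mem_Icc.2 hpq) (hmax i hi).2)
    have hsum : ∑ i ∈ I, (J i).indicator (1 : ℝ → ℝ≥0∞) t
        = ((I.filter (fun i => t ∈ J i)).card : ℝ≥0∞) := by
      rw [Finset.card_filter, Nat.cast_sum]
      refine Finset.sum_congr rfl fun i _ => ?_
      by_cases h : t ∈ J i <;> simp [h]
    rw [hsum]
    rcases (I.filter (fun i => t ∈ J i)).eq_empty_or_nonempty with hF | hF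
    · simp [hF]
    have htI : t ∈ Icc 0 (V q) := by
      obtain ⟨i, hi⟩ := hF
      rw [Finset.mem_filter] at hi
      exact hJ i hi.1 hi.2
    rw [indicator_of_mem htI]
    norm_cast
    -- the intervals whose `V`-images contain `t` have a common interior point
    obtain ⟨i₁, hi₁, hmx⟩ := Finset.exists_max_image _ (fun i => min (a i) (b i)) hF
    obtain ⟨i₂, hi₂, hmn⟩ := Finset.exists_min_image _ (fun i => max (a i) (b i)) hF
    have hi₁' := Finset.mem_filter.1 hi₁
    have hi₂' := Finset.mem_filter.1 hi₂
    have hlt : min (a i₁) (b i₁) < max (a i₂) (b i₂) := by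
      by_contra! hcon
      have := hmono (hmax i₂ hi₂'.1) (hmin i₁ hi₁'.1) hcon
      have e1 : V (min (a i₁) (b i₁)) < t := hi₁'.2.1
      have e2 : t < V (max (a i₂) (b i₂)) := hi₂'.2.2
      linarith
    obtain ⟨s, hs1, hs2⟩ := exists_between hlt
    refine le_trans (Finset.card_le_card fun i hi => ?_)
      (h s ⟨(hmin i₁ hi₁'.1).1.trans_lt hs1, hs2.trans_le (hmax i₂ hi₂'.1).2⟩)
    exact Finset.mem_filter.2 ⟨(Finset.mem_filter.1 hi).1, (hmx i hi).trans_lt hs1,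
      hs2.trans_le (hmn i hi)⟩
  calc ∑ i ∈ I, ‖g (b i) - g (a i)‖ₑ
      ≤ ∑ i ∈ I, ∫⁻ t, (J i).indicator 1 t := Finset.sum_le_sum h1
    _ = ∫⁻ t, ∑ i ∈ I, (J i).indicator 1 t :=
        (MeasureTheory.lintegral_finsetSum _
          fun i _ => measurable_one.indicator measurableSet_Ioo).symm
    _ ≤ ∫⁻ t, (Icc 0 (V q)).indicator (fun _ => (N : ℝ≥0∞)) t := MeasureTheory.lintegral_mono h2
    _ = N * eVariationOn g (Icc p q) := by
        rw [MeasureTheory.lintegral_indicator_const measurableSet_Icc, Real.volume_Icc, sub_zero,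
          hVq]

/-- A relation on the reals which can be concatenated and holds between consecutive points of a
finite set holds between any two points of that set. -/
theorem rel_of_finite_partition {R : ℝ → ℝ → Prop} (F : Finset ℝ)
    (htrans : ∀ a b c, a < b → b < c → R a b → R b c → R a c)
    (hcons : ∀ a ∈ F, ∀ b ∈ F, a < b → (∀ c ∈ F, c ∉ Ioo a b) → R a b)
    {a b : ℝ} (ha : a ∈ F) (hb : b ∈ F) (hab : a < b) : R a b := by
  classical
  induction hn : (F.filter (fun c => c ∈ Ioo a b)).card using Nat.strong_induction_on
    generalizing a b with
  | _ n ih =>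
    by_cases hne : ∀ c ∈ F, c ∉ Ioo a b
    · exact hcons a ha b hb hab hne
    · push Not at hne
      obtain ⟨c, hc, hac, hcb⟩ := hne
      refine htrans a c b hac hcb (ih _ ?_ ha hc hac rfl) (ih _ ?_ hc hb hcb rfl)
      · rw [← hn]
        refine Finset.card_lt_card (Finset.ssubset_iff_of_subset (fun x hx => ?_) |>.2 ⟨c, ?_, ?_⟩)
        · simp only [Finset.mem_filter, mem_Ioo] at hx ⊢
          exact ⟨hx.1, hx.2.1, hx.2.2.trans hcb⟩
        · simp [hc, hac, hcb]
        · simp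
      · rw [← hn]
        refine Finset.card_lt_card (Finset.ssubset_iff_of_subset (fun x hx => ?_) |>.2 ⟨c, ?_, ?_⟩)
        · simp only [Finset.mem_filter, mem_Ioo] at hx ⊢
          exact ⟨hx.1, hac.trans hx.2.1, hx.2.2⟩
        · simp [hc, hac, hcb]
        · simp

/-! ### Lines separating the points of a list -/

/-- The line `l` separates `z` from `w` if these points do not lie strictly on the same side of
`l` and are not both on `l`. -/
def Line.Sep (l : Line) (z w : ℂ) : Prop :=
  l.height z * l.height w ≤ 0 ∧ (l.height z ≠ 0 ∨ l.height w ≠ 0)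

theorem Line.Sep.symm {l : Line} {z w : ℂ} (h : l.Sep z w) : l.Sep w z :=
  ⟨by rw [mul_comm]; exact h.1, h.2.symm⟩

open Classical in
/-- The number of times a sequence of heights leaves zero is at most the number of crossings: every
departure comes after an arrival or at the start. -/
theorem card_departures_le (h : ℕ → ℝ) (n : ℕ) :
    ((Finset.range n).filter fun i => h i = 0 ∧ h (i + 1) ≠ 0).card ≤
      ((Finset.range n).filter fun i => h i * h (i + 1) < 0 ∨ (i = 0 ∧ h i = 0) ∨
        (h i ≠ 0 ∧ h (i + 1) = 0)).card := by
  have key : ∀ n, ((Finset.range (n + 1)).filter fun i => h i = 0 ∧ h (i + 1) ≠ 0).card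
      + (if h (n + 1) = 0 then 1 else 0) ≤
      ((Finset.range (n + 1)).filter fun i => h i * h (i + 1) < 0 ∨ (i = 0 ∧ h i = 0) ∨
        (h i ≠ 0 ∧ h (i + 1) = 0)).card := by
    intro n
    simp only [Finset.card_filter]
    induction n with
    | zero =>
      simp only [zero_add, Finset.sum_range_one]
      by_cases h0 : h 0 = 0 <;> by_cases h1 : h 1 = 0 <;> simp [h0, h1]
    | succ n ih =>
      rw [Finset.sum_range_succ _ (n + 1), Finset.sum_range_succ _ (n + 1)]
      by_cases h0 : h (n + 1) = 0 <;> by_cases h1 : h (n + 1 + 1) = 0 <;>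
        simp [h0, h1] at ih ⊢ <;> omega
  cases n with
  | zero => simp
  | succ n => exact le_trans (Nat.le_add_right _ _) (key n)

open Classical in
/-- A line separates consecutive points of a list at most twice as often as it is crossed. -/
theorem card_sep_le {n : ℕ} (hn : n ≠ 0) (x : Fin (n + 1) → ℂ) (l : Line) :
    (Finset.univ.filter fun i : Fin n => l.Sep (x i.castSucc) (x i.succ)).card ≤
      2 * vf x := by
  refine le_trans ?_ (Nat.mul_le_mul_left 2 (vfLine_le_vf x l))
  let h : ℕ → ℝ := fun i => if hi : i < n + 1 then l.height (x ⟨i, hi⟩) else 0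
  have hc : ∀ i : Fin n, h i = l.height (x i.castSucc) := fun i => by
    have : (i : ℕ) < n + 1 := by omega
    simp only [h, dif_pos this]
    rfl
  have hs : ∀ i : Fin n, h (i + 1) = l.height (x i.succ) := fun i => by
    have : (i : ℕ) + 1 < n + 1 := by omega
    simp only [h, dif_pos this]
    rfl
  have conv : ∀ (p : ℕ → Prop) [DecidablePred p], (Finset.univ.filter fun i : Fin n => p i).card =
      ((Finset.range n).filter p).card := fun p _ => by
    rw [Finset.card_filter, Finset.card_filter, Finset.sum_range]
  have hdep := card_departures_le h n
  rw [← conv, ← conv] at hdep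
  have hv : vfLine x l = (Finset.univ.filter fun i : Fin n => IsCrossing x l i).card := by
    unfold vfLine
    rw [if_neg hn]
  have hcr : (Finset.univ.filter fun i : Fin n => h i * h (i + 1) < 0 ∨ ((i : ℕ) = 0 ∧ h i = 0) ∨
      (h i ≠ 0 ∧ h (i + 1) = 0)).card = vfLine x l := by
    rw [hv]
    congr 1
    ext i
    rw [Finset.mem_filter, Finset.mem_filter, hc, hs]
    rfl
  rw [hcr] at hdep
  rw [two_mul]
  refine le_trans ?_ (add_le_add_right hdep _)
  rw [hv]
  refine le_trans (Finset.card_le_card fun i hi => ?_) (Finset.card_union_le _ _)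
  rw [Finset.mem_union, Finset.mem_filter, Finset.mem_filter, hc, hs]
  obtain ⟨h1, h2⟩ := (Finset.mem_filter.1 hi).2
  simp only [Finset.mem_univ, true_and]
  -- A separated segment crosses the line, arrives on it, or departs from it; the first two kinds
  -- are crossing segments, and `hdep` bounds the number of the third kind by that of those.
  rcases h1.lt_or_eq with h1 | h1
  · exact Or.inl (Or.inl h1)
  · rcases mul_eq_zero.1 h1 with h1 | h1
    · exact Or.inr ⟨h1, h2.resolve_left (not_not.2 h1)⟩
    · exact Or.inl (Or.inr (Or.inr ⟨h2.resolve_right (not_not.2 h1), h1⟩))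

end ACSigma

namespace ACSigma

/-! ### Lines and convex arcs -/

theorem inner_eq_re_mul_add (v w : ℂ) : (inner ℝ v w : ℝ) = v.re * w.re + v.im * w.im := by
  rw [Complex.inner, Complex.mul_re, Complex.conj_re, Complex.conj_im]
  ring

theorem Line.height_eq (l : Line) (z : ℂ) :
    l.height z = l.normal.re * z.re + l.normal.im * z.im - l.offset := by
  rw [Line.height, inner_eq_re_mul_add]

theorem Line.continuous_height (l : Line) : Continuous l.height := by
  unfold Line.height
  fun_prop

theorem Line.normal_sq_pos (l : Line) : 0 < l.normal.re ^ 2 + l.normal.im ^ 2 := by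
  have := Complex.normSq_pos.2 l.normal_ne
  rw [Complex.normSq_apply] at this
  nlinarith

/-- The line through two different points. -/
noncomputable def lineThrough (z w : ℂ) (h : z ≠ w) : Line where
  normal := Complex.I * (w - z)
  offset := inner ℝ (Complex.I * (w - z)) z
  normal_ne := mul_ne_zero Complex.I_ne_zero (sub_ne_zero.2 h.symm)

@[simp]
theorem lineThrough_left (z w : ℂ) (h : z ≠ w) : (lineThrough z w h).height z = 0 := by
  simp [Line.height, lineThrough]

@[simp]
theorem lineThrough_right (z w : ℂ) (h : z ≠ w) : (lineThrough z w h).height w = 0 := by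
  simp [Line.height_eq, lineThrough, Complex.inner]
  ring

/-- The same line with the two sides exchanged. -/
def Line.flip (l : Line) : Line := ⟨-l.normal, -l.offset, neg_ne_zero.2 l.normal_ne⟩

@[simp]
theorem Line.height_flip (l : Line) (z : ℂ) : l.flip.height z = -l.height z := by
  simp [Line.height, Line.flip]
  ring

/-- Two lines of which one has a point off the other meet in at most one point. -/
theorem Line.eq_of_height_eq_zero {l m : Line} {p q z : ℂ} (hlp : l.height p = 0)
    (hmp : m.height p = 0) (hmq : m.height q = 0) (hlq : l.height q ≠ 0) (hlz : l.height z = 0)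
    (hmz : m.height z = 0) : z = p := by
  have hm := m.normal_sq_pos
  rw [Line.height_eq] at *
  have e1 : m.normal.re * (z.re - p.re) + m.normal.im * (z.im - p.im) = 0 := by linarith
  have e2 : m.normal.re * (q.re - p.re) + m.normal.im * (q.im - p.im) = 0 := by linarith
  have e3 : l.normal.re * (z.re - p.re) + l.normal.im * (z.im - p.im) = 0 := by linarith
  have e4 : l.normal.re * (q.re - p.re) + l.normal.im * (q.im - p.im) ≠ 0 := by
    intro h
    exact hlq (by linarith)
  have e5 : (z.re - p.re) * (q.im - p.im) = (z.im - p.im) * (q.re - p.re) := by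
    have : (m.normal.re ^ 2 + m.normal.im ^ 2) *
        ((z.re - p.re) * (q.im - p.im) - (z.im - p.im) * (q.re - p.re)) = 0 := by
      linear_combination (m.normal.re * (q.im - p.im) - m.normal.im * (q.re - p.re)) * e1 -
        (m.normal.re * (z.im - p.im) - m.normal.im * (z.re - p.re)) * e2
    have := (mul_eq_zero.1 this).resolve_left hm.ne'
    linarith
  apply Complex.ext
  · have : (z.re - p.re) * (l.normal.re * (q.re - p.re) + l.normal.im * (q.im - p.im)) = 0 := by
      linear_combination (q.re - p.re) * e3 + l.normal.im * e5
    have := (mul_eq_zero.1 this).resolve_right e4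
    linarith
  · have : (z.im - p.im) * (l.normal.re * (q.re - p.re) + l.normal.im * (q.im - p.im)) = 0 := by
      linear_combination (q.im - p.im) * e3 - l.normal.re * e5
    have := (mul_eq_zero.1 this).resolve_right e4
    linarith

/-- A simple arc, parametrised by the unit interval, with a supporting line through each of its
points. The values of the parametrisation outside the unit interval play no role. -/
structure IsConvexArc (c : ℝ → ℂ) : Prop where
  cont : Continuous c
  inj : InjOn c (Icc 0 1)
  support : ∀ t ∈ Icc (0 : ℝ) 1, ∃ v : ℂ, v ≠ 0 ∧ ∀ s ∈ Icc (0 : ℝ) 1,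
    0 ≤ (inner ℝ v (c s - c t) : ℝ)

namespace IsConvexArc

variable {c : ℝ → ℂ}

/-- If three points of a convex arc lie on a line, then a supporting line through the middle one is
that line, so that the arc does not have points strictly on both sides of it. -/
theorem false_of_three_ordered (hc : IsConvexArc c) (l : Line) {e p q r a b : ℝ}
    (hp : p ∈ Icc (0 : ℝ) 1) (hq : q ∈ Icc (0 : ℝ) 1) (hr : r ∈ Icc (0 : ℝ) 1)
    (ha : a ∈ Icc (0 : ℝ) 1) (hb : b ∈ Icc (0 : ℝ) 1)
    (ep : l.height (c p) = e) (eq : l.height (c q) = e) (er : l.height (c r) = e)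
    (ea : l.height (c a) < e) (eb : e < l.height (c b))
    (hpq : (inner ℝ (Complex.I * l.normal) (c p) : ℝ) < inner ℝ (Complex.I * l.normal) (c q))
    (hqr : (inner ℝ (Complex.I * l.normal) (c q) : ℝ) < inner ℝ (Complex.I * l.normal) (c r)) :
    False := by
  obtain ⟨v, hv, hs⟩ := hc.support q hq
  have sp := hs p hp
  have sr := hs r hr
  have sa := hs a ha
  have sb := hs b hb
  have hn := l.normal_sq_pos
  rw [Line.height_eq] at *
  simp only [inner_eq_re_mul_add, Complex.sub_re, Complex.sub_im, Complex.mul_re, Complex.mul_im,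
    Complex.I_re, Complex.I_im, zero_mul, one_mul, zero_sub, zero_add] at *
  set n1 := l.normal.re
  set n2 := l.normal.im
  -- the components of `v` along the line and across it
  set X := v.im * n1 - v.re * n2 with hX
  set Y := v.re * n1 + v.im * n2 with hY
  have id : ∀ w : ℂ, (v.re * (w.re - (c q).re) + v.im * (w.im - (c q).im)) * (n1 ^ 2 + n2 ^ 2) =
      Y * ((n1 * w.re + n2 * w.im) - (n1 * (c q).re + n2 * (c q).im)) +
      X * ((-n2 * w.re + n1 * w.im) - (-n2 * (c q).re + n1 * (c q).im)) := fun w => by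
    rw [hX, hY]
    ring
  have ip := id (c p)
  have ir := id (c r)
  have ia := id (c a)
  have ib := id (c b)
  have zp : (n1 * (c p).re + n2 * (c p).im) - (n1 * (c q).re + n2 * (c q).im) = 0 := by linarith
  have zr : (n1 * (c r).re + n2 * (c r).im) - (n1 * (c q).re + n2 * (c q).im) = 0 := by linarith
  rw [zp] at ip
  rw [zr] at ir
  have nonpos : ∀ {x d : ℝ}, 0 ≤ x * d → d < 0 → x ≤ 0 := fun h hd =>
    not_lt.1 fun hx => (mul_neg_of_pos_of_neg hx hd).not_ge h
  have nonneg : ∀ {x d : ℝ}, 0 ≤ x * d → 0 < d → 0 ≤ x := fun h hd =>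
    not_lt.1 fun hx => (mul_neg_of_neg_of_pos hx hd).not_ge h
  have X0 : X = 0 := by
    have h1 := mul_nonneg sp hn.le
    have h2 := mul_nonneg sr hn.le
    rw [ip, mul_zero, zero_add] at h1
    rw [ir, mul_zero, zero_add] at h2
    exact le_antisymm (nonpos h1 (by linarith)) (nonneg h2 (by linarith))
  rw [X0, zero_mul, add_zero] at ia ib
  have Y0 : Y = 0 := by
    have h1 := mul_nonneg sa hn.le
    have h2 := mul_nonneg sb hn.le
    rw [ia] at h1
    rw [ib] at h2
    exact le_antisymm (nonpos h1 (by linarith)) (nonneg h2 (by linarith))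
  have : Complex.normSq v * (n1 ^ 2 + n2 ^ 2) = 0 := by
    rw [Complex.normSq_apply]
    have : X ^ 2 + Y ^ 2 = 0 := by rw [X0, Y0]; ring
    rw [← this, hX, hY]
    ring
  rcases mul_eq_zero.1 this with h | h
  · exact hv (Complex.normSq_eq_zero.1 h)
  · exact hn.ne' h

/-- A line with points of a convex arc strictly on both sides meets the arc at most twice. -/
theorem false_of_three (hc : IsConvexArc c) (l : Line) {e p q r a b : ℝ}
    (hp : p ∈ Icc (0 : ℝ) 1) (hq : q ∈ Icc (0 : ℝ) 1) (hr : r ∈ Icc (0 : ℝ) 1)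
    (ha : a ∈ Icc (0 : ℝ) 1) (hb : b ∈ Icc (0 : ℝ) 1) (hpq : p < q) (hqr : q < r)
    (ep : l.height (c p) = e) (eq : l.height (c q) = e) (er : l.height (c r) = e)
    (ea : l.height (c a) < e) (eb : e < l.height (c b)) : False := by
  have hne : ∀ {s t : ℝ}, s ∈ Icc (0 : ℝ) 1 → t ∈ Icc (0 : ℝ) 1 → s < t →
      l.height (c s) = e → l.height (c t) = e →
      (inner ℝ (Complex.I * l.normal) (c s) : ℝ) ≠ inner ℝ (Complex.I * l.normal) (c t) := by
    intro s t hs ht hst es et h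
    refine hst.ne (hc.inj hs ht ?_)
    have hn := l.normal_sq_pos
    rw [Line.height_eq] at es et
    simp only [inner_eq_re_mul_add, Complex.mul_re, Complex.mul_im,
      Complex.I_re, Complex.I_im, zero_mul, one_mul, zero_sub, zero_add] at h
    apply Complex.ext
    · have : (l.normal.re ^ 2 + l.normal.im ^ 2) * ((c s).re - (c t).re) = 0 := by
        linear_combination l.normal.re * (es - et) - l.normal.im * h
      linarith [(mul_eq_zero.1 this).resolve_left hn.ne']
    · have : (l.normal.re ^ 2 + l.normal.im ^ 2) * ((c s).im - (c t).im) = 0 := by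
        linear_combination l.normal.im * (es - et) + l.normal.re * h
      linarith [(mul_eq_zero.1 this).resolve_left hn.ne']
  have h1 := hne hp hq hpq ep eq
  have h2 := hne hq hr hqr eq er
  have h3 := hne hp hr (hpq.trans hqr) ep er
  rcases h1.lt_or_gt with h1 | h1 <;> rcases h2.lt_or_gt with h2 | h2 <;>
    rcases h3.lt_or_gt with h3 | h3
  · exact hc.false_of_three_ordered l hp hq hr ha hb ep eq er ea eb h1 h2
  · linarith
  · exact hc.false_of_three_ordered l hp hr hq ha hb ep er eq ea eb h3 h2
  · exact hc.false_of_three_ordered l hr hp hq ha hb er ep eq ea eb h3 h1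
  · exact hc.false_of_three_ordered l hq hp hr ha hb eq ep er ea eb h1 h3
  · exact hc.false_of_three_ordered l hq hr hp ha hb eq er ep ea eb h2 h3
  · linarith
  · exact hc.false_of_three_ordered l hr hq hp ha hb er eq ep ea eb h2 h1

theorem exists_height_eq (hc : IsConvexArc c) (l : Line) {e a b : ℝ} (hab : a < b)
    (h : (l.height (c a) - e) * (l.height (c b) - e) < 0) :
    ∃ p ∈ Ioo a b, l.height (c p) = e := by
  have hcont : ContinuousOn (fun t => l.height (c t)) (Icc a b) :=
    (l.continuous_height.comp hc.cont).continuousOn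
  rcases mul_neg_iff.1 h with ⟨h1, h2⟩ | ⟨h1, h2⟩
  · exact intermediate_value_Ioo' hab.le hcont ⟨by linarith, by linarith⟩
  · exact intermediate_value_Ioo hab.le hcont ⟨by linarith, by linarith⟩

/-- Along a convex arc, the height over a line passes through any level at most twice. -/
theorem false_of_three_sign_changes (hc : IsConvexArc c) (l : Line) {e x y z w : ℝ}
    (hx : 0 ≤ x) (hxy : x < y) (hyz : y < z) (hzw : z < w) (hw : w ≤ 1)
    (h1 : (l.height (c x) - e) * (l.height (c y) - e) < 0)
    (h2 : (l.height (c y) - e) * (l.height (c z) - e) < 0)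
    (h3 : (l.height (c z) - e) * (l.height (c w) - e) < 0) : False := by
  obtain ⟨p, hp, ep⟩ := hc.exists_height_eq l hxy h1
  obtain ⟨q, hq, eq⟩ := hc.exists_height_eq l hyz h2
  obtain ⟨r, hr, er⟩ := hc.exists_height_eq l hzw h3
  have hp' : p ∈ Icc (0 : ℝ) 1 := ⟨by linarith [hp.1], by linarith [hp.2]⟩
  have hq' : q ∈ Icc (0 : ℝ) 1 := ⟨by linarith [hq.1], by linarith [hq.2]⟩
  have hr' : r ∈ Icc (0 : ℝ) 1 := ⟨by linarith [hr.1], by linarith [hr.2]⟩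
  have hx' : x ∈ Icc (0 : ℝ) 1 := ⟨by linarith, by linarith⟩
  have hy' : y ∈ Icc (0 : ℝ) 1 := ⟨by linarith, by linarith⟩
  rcases mul_neg_iff.1 h1 with ⟨h1, h2⟩ | ⟨h1, h2⟩
  · exact hc.false_of_three l hp' hq' hr' hy' hx' (hp.2.trans hq.1) (hq.2.trans hr.1) ep eq er
      (by linarith) (by linarith)
  · exact hc.false_of_three l hp' hq' hr' hx' hy' (hp.2.trans hq.1) (hq.2.trans hr.1) ep eq er
      (by linarith) (by linarith)

theorem false_of_nonpos_pos_nonpos_pos (hc : IsConvexArc c) (l : Line) {x y z w : ℝ}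
    (hx : 0 ≤ x) (hxy : x < y) (hyz : y < z) (hzw : z < w) (hw : w ≤ 1)
    (h1 : l.height (c x) ≤ 0) (h2 : 0 < l.height (c y)) (h3 : l.height (c z) ≤ 0)
    (h4 : 0 < l.height (c w)) : False := by
  obtain ⟨e, he, hem⟩ := exists_between (lt_min h2 h4)
  obtain ⟨he1, he2⟩ := lt_min_iff.1 hem
  exact hc.false_of_three_sign_changes l (e := e) hx hxy hyz hzw hw
    (mul_neg_of_neg_of_pos (by linarith) (by linarith))
    (mul_neg_of_pos_of_neg (by linarith) (by linarith))
    (mul_neg_of_neg_of_pos (by linarith) (by linarith))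

theorem false_of_pos_nonpos_pos_nonpos (hc : IsConvexArc c) (l : Line) {x y z w : ℝ}
    (hx : 0 ≤ x) (hxy : x < y) (hyz : y < z) (hzw : z < w) (hw : w ≤ 1)
    (h1 : 0 < l.height (c x)) (h2 : l.height (c y) ≤ 0) (h3 : 0 < l.height (c z))
    (h4 : l.height (c w) ≤ 0) : False := by
  obtain ⟨e, he, hem⟩ := exists_between (lt_min h1 h3)
  obtain ⟨he1, he2⟩ := lt_min_iff.1 hem
  exact hc.false_of_three_sign_changes l (e := e) hx hxy hyz hzw hw
    (mul_neg_of_pos_of_neg (by linarith) (by linarith))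
    (mul_neg_of_neg_of_pos (by linarith) (by linarith))
    (mul_neg_of_pos_of_neg (by linarith) (by linarith))

/-! ### The variation factor along a convex arc -/

theorem card_descents_le_one (hc : IsConvexArc c) (l : Line) {n : ℕ} {t : Fin (n + 1) → ℝ}
    (ht : StrictMono t) (hmem : ∀ i, t i ∈ Icc (0 : ℝ) 1) (F : Finset (Fin n))
    (hF : ∀ i ∈ F, 0 < l.height (c (t i.castSucc)) ∧ l.height (c (t i.succ)) ≤ 0) :
    F.card ≤ 1 := by
  have key : ∀ i ∈ F, ∀ j ∈ F, ¬ i < j := by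
    intro i hi j hj hij
    have h1 := hF i hi
    have h2 := hF j hj
    have hle : i.succ ≤ j.castSucc := by
      rw [Fin.le_def, Fin.val_succ, Fin.val_castSucc]
      exact hij
    rcases hle.lt_or_eq with hlt | heq
    · exact hc.false_of_pos_nonpos_pos_nonpos l (hmem _).1 (ht Fin.castSucc_lt_succ)
        (ht hlt) (ht Fin.castSucc_lt_succ) (hmem _).2 h1.1 h1.2 h2.1 h2.2
    · rw [← heq] at h2
      linarith [h1.2, h2.1]
  rw [Finset.card_le_one]
  intro i hi j hj
  exact le_antisymm (not_lt.1 (key j hj i hi)) (not_lt.1 (key i hi j hj))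

theorem vfLine_le_three (hc : IsConvexArc c) (l : Line) {n : ℕ} {t : Fin (n + 1) → ℝ}
    (ht : StrictMono t) (hmem : ∀ i, t i ∈ Icc (0 : ℝ) 1) :
    vfLine (fun i => c (t i)) l ≤ 3 := by
  classical
  unfold vfLine
  split_ifs
  · omega
  · omega
  let A : Finset (Fin n) := Finset.univ.filter fun i =>
    0 < l.height (c (t i.castSucc)) ∧ l.height (c (t i.succ)) ≤ 0
  let B : Finset (Fin n) := Finset.univ.filter fun i =>
    0 < l.flip.height (c (t i.castSucc)) ∧ l.flip.height (c (t i.succ)) ≤ 0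
  let Z : Finset (Fin n) := Finset.univ.filter fun i => (i : ℕ) = 0
  have hA : A.card ≤ 1 := hc.card_descents_le_one l ht hmem A fun i hi => (Finset.mem_filter.1 hi).2
  have hB : B.card ≤ 1 :=
    hc.card_descents_le_one l.flip ht hmem B fun i hi => (Finset.mem_filter.1 hi).2
  have hZ : Z.card ≤ 1 := by
    rw [Finset.card_le_one]
    intro i hi j hj
    exact Fin.ext ((Finset.mem_filter.1 hi).2.trans (Finset.mem_filter.1 hj).2.symm)
  have hsub : (Finset.univ.filter fun i : Fin n => IsCrossing (fun i => c (t i)) l i) ⊆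
      Z ∪ (A ∪ B) := by
    intro i hi
    have hi := (Finset.mem_filter.1 hi).2
    simp only [Finset.mem_union, A, B, Z, Finset.mem_filter, Finset.mem_univ, true_and,
      Line.height_flip]
    rcases hi with h | h | ⟨h, h'⟩
    · rcases mul_neg_iff.1 h with ⟨h1, h2⟩ | ⟨h1, h2⟩
      · exact Or.inr (Or.inl ⟨h1, h2.le⟩)
      · exact Or.inr (Or.inr ⟨by linarith, by linarith⟩)
    · exact Or.inl h.1
    · simp only at h h'
      rcases h.lt_or_gt with h | h
      · exact Or.inr (Or.inr ⟨by linarith, by linarith⟩)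
      · exact Or.inr (Or.inl ⟨h, h'.le⟩)
  refine (Finset.card_le_card hsub).trans ((Finset.card_union_le _ _).trans ?_)
  have := Finset.card_union_le A B
  omega

/-- A list which runs along a convex arc has variation factor at most three. -/
theorem vf_le_three (hc : IsConvexArc c) {n : ℕ} {t : Fin (n + 1) → ℝ}
    (ht : StrictMono t) (hmem : ∀ i, t i ∈ Icc (0 : ℝ) 1) : vf (fun i => c (t i)) ≤ 3 := by
  have : Nonempty Line := ⟨⟨1, 0, one_ne_zero⟩⟩
  exact ciSup_le fun l => hc.vfLine_le_three l ht hmem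

/-! ### Separating two pieces of a convex arc -/

/-- A line through two points of a convex arc weakly separates the piece between these points from
the rest of the arc. -/
theorem height_mul_height_nonpos (hc : IsConvexArc c) (l : Line) {a b s u : ℝ}
    (ha : 0 ≤ a) (hb : b ≤ 1) (hla : l.height (c a) = 0) (hlb : l.height (c b) = 0)
    (hs : s ∈ Icc a b) (hu : u ∈ Icc (0 : ℝ) 1) (hu' : u ∉ Icc a b) :
    l.height (c s) * l.height (c u) ≤ 0 := by
  have key : ∀ l : Line, l.height (c a) = 0 → l.height (c b) = 0 → 0 < l.height (c s) →
      0 < l.height (c u) → False := by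
    intro l hla hlb h1 h2
    have has : a < s := lt_of_le_of_ne hs.1 fun h => by rw [← h, hla] at h1; exact lt_irrefl _ h1
    have hsb : s < b := lt_of_le_of_ne hs.2 fun h => by rw [h, hlb] at h1; exact lt_irrefl _ h1
    by_cases hua : u < a
    · exact hc.false_of_pos_nonpos_pos_nonpos l hu.1 hua has hsb hb h2 hla.le h1 hlb.le
    · have hub : b < u := by
        by_contra! h
        exact hu' ⟨not_lt.1 hua, h⟩
      exact hc.false_of_nonpos_pos_nonpos_pos l ha has hsb hub hu.2 hla.le h1 hlb.le h2
  by_contra! h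
  rcases mul_pos_iff.1 h with ⟨h1, h2⟩ | ⟨h1, h2⟩
  · exact key l hla hlb h1 h2
  · exact key l.flip (by simp [hla]) (by simp [hlb]) (by simpa using h1) (by simpa using h2)

theorem sep_or (hc : IsConvexArc c) (l : Line) {a b s u : ℝ}
    (ha : 0 ≤ a) (hb : b ≤ 1) (hla : l.height (c a) = 0) (hlb : l.height (c b) = 0)
    (hs : s ∈ Icc a b) (hu : u ∈ Icc (0 : ℝ) 1) (hu' : u ∉ Icc a b) :
    l.Sep (c s) (c u) ∨ (l.height (c s) = 0 ∧ l.height (c u) = 0) := by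
  by_cases h : l.height (c s) = 0 ∧ l.height (c u) = 0
  · exact Or.inr h
  · exact Or.inl ⟨hc.height_mul_height_nonpos l ha hb hla hlb hs hu hu', by tauto⟩

/-- For each interior parameter `t` of a convex arc there are four lines such that any point before
`t` is separated from any point after `t` by one of them. -/
theorem exists_separating_lines (hc : IsConvexArc c) {t : ℝ} (ht : t ∈ Ioo (0 : ℝ) 1) :
    ∃ l : Fin 4 → Line, ∀ s ∈ Icc (0 : ℝ) 1, ∀ u ∈ Icc (0 : ℝ) 1, s < t → t < u →
      ∃ k, (l k).Sep (c s) (c u) := by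
  have h0 : (0 : ℝ) ∈ Icc (0 : ℝ) 1 := by simp
  have h1 : (1 : ℝ) ∈ Icc (0 : ℝ) 1 := by simp
  have ht' : t ∈ Icc (0 : ℝ) 1 := ⟨ht.1.le, ht.2.le⟩
  have hne : ∀ {a b : ℝ}, a ∈ Icc (0 : ℝ) 1 → b ∈ Icc (0 : ℝ) 1 → a < b → c a ≠ c b :=
    fun ha hb hab h => hab.ne (hc.inj ha hb h)
  set l := lineThrough (c 0) (c t) (hne h0 ht' ht.1)
  have hl0 : l.height (c 0) = 0 := lineThrough_left _ _ _
  have hlt : l.height (c t) = 0 := lineThrough_right _ _ _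
  have hlsep : ∀ s ∈ Icc (0 : ℝ) 1, ∀ u ∈ Icc (0 : ℝ) 1, s < t → t < u →
      l.Sep (c s) (c u) ∨ (l.height (c s) = 0 ∧ l.height (c u) = 0) := fun s hs u hu hst htu =>
    hc.sep_or l le_rfl ht'.2 hl0 hlt ⟨hs.1, hst.le⟩ hu fun h => htu.not_ge h.2
  by_cases hl1 : l.height (c 1) = 0
  swap
  · -- the points with parameters `0`, `t`, `1` are not collinear
    set m := lineThrough (c t) (c 1) (hne ht' h1 ht.2)
    refine ⟨![l, m, l, l], fun s hs u hu hst htu => ?_⟩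
    rcases hlsep s hs u hu hst htu with h | h
    · exact ⟨0, h⟩
    rcases hc.sep_or m ht'.1 le_rfl (lineThrough_left _ _ _) (lineThrough_right _ _ _)
      (s := u) (u := s) ⟨htu.le, hu.2⟩ hs (fun h => hst.not_ge h.1) with h' | h'
    · exact ⟨1, h'.symm⟩
    · exact absurd (Line.eq_of_height_eq_zero hlt (lineThrough_left _ _ _)
        (lineThrough_right _ _ _) hl1 h.1 h'.2) (hne hs ht' hst)
  -- If they are collinear, but the arc is not straight, the line through them is supplemented by
  -- two lines through a point `c r` off it.
  by_cases hr : ∃ r ∈ Icc (0 : ℝ) 1, l.height (c r) ≠ 0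
  · obtain ⟨r, hr, hlr⟩ := hr
    have hr0 : 0 < r := lt_of_le_of_ne hr.1 fun h => hlr (h ▸ hl0)
    have hr1 : r < 1 := lt_of_le_of_ne hr.2 fun h => hlr (h ▸ hl1)
    have hrt : r ≠ t := fun h => hlr (h ▸ hlt)
    rcases hrt.lt_or_gt with hrt | hrt
    · set m := lineThrough (c 0) (c r) (hne h0 hr hr0)
      set k := lineThrough (c r) (c t) (hne hr ht' hrt)
      refine ⟨![l, m, k, l], fun s hs u hu hst htu => ?_⟩
      rcases hlsep s hs u hu hst htu with h | h
      · exact ⟨0, h⟩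
      rcases lt_or_ge s r with hsr | hsr
      · rcases hc.sep_or m le_rfl hr.2 (lineThrough_left _ _ _) (lineThrough_right _ _ _)
          (s := s) (u := u) ⟨hs.1, hsr.le⟩ hu (fun h => (hrt.trans htu).not_ge h.2) with h' | h'
        · exact ⟨1, h'⟩
        · exact absurd (Line.eq_of_height_eq_zero hl0 (lineThrough_left _ _ _)
            (lineThrough_right _ _ _) hlr h.2 h'.2).symm (hne h0 hu (ht.1.trans htu))
      · rcases hc.sep_or k hr.1 ht'.2 (lineThrough_left _ _ _) (lineThrough_right _ _ _)
          (s := s) (u := u) ⟨hsr, hst.le⟩ hu (fun h => htu.not_ge h.2) with h' | h'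
        · exact ⟨2, h'⟩
        · exact absurd (Line.eq_of_height_eq_zero hlt (lineThrough_right _ _ _)
            (lineThrough_left _ _ _) hlr h.1 h'.1) (hne hs ht' hst)
    · set m := lineThrough (c t) (c r) (hne ht' hr hrt)
      set k := lineThrough (c r) (c 1) (hne hr h1 hr1)
      refine ⟨![l, m, k, l], fun s hs u hu hst htu => ?_⟩
      rcases hlsep s hs u hu hst htu with h | h
      · exact ⟨0, h⟩
      rcases le_or_gt u r with hur | hur
      · rcases hc.sep_or m ht'.1 hr.2 (lineThrough_left _ _ _) (lineThrough_right _ _ _)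
          (s := u) (u := s) ⟨htu.le, hur⟩ hs (fun h => hst.not_ge h.1) with h' | h'
        · exact ⟨1, h'.symm⟩
        · exact absurd (Line.eq_of_height_eq_zero hlt (lineThrough_left _ _ _)
            (lineThrough_right _ _ _) hlr h.2 h'.1).symm (hne ht' hu htu)
      · rcases hc.sep_or k hr.1 le_rfl (lineThrough_left _ _ _) (lineThrough_right _ _ _)
          (s := u) (u := s) ⟨hur.le, hu.2⟩ hs (fun h => (hst.trans hrt).not_ge h.1) with h' | h'
        · exact ⟨2, h'.symm⟩
        · exact absurd (Line.eq_of_height_eq_zero hl1 (lineThrough_right _ _ _)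
            (lineThrough_left _ _ _) hlr h.1 h'.2) (hne hs h1 (hst.trans ht.2))
  · -- the arc is a straight segment: use the perpendicular through the point of parameter `t`
    push Not at hr
    let m : Line := ⟨c t - c 0, inner ℝ (c t - c 0) (c t),
      sub_ne_zero.2 (hne h0 ht' ht.1).symm⟩
    have hmt : m.height (c t) = 0 := sub_self _
    have hinj : InjOn (fun s => m.height (c s)) (Icc 0 1) := by
      intro a ha b hb hab
      refine hc.inj ha hb ?_
      have ea := hr a ha
      have eb := hr b hb
      have hn := m.normal_sq_pos
      simp only [Line.height_eq] at ea eb hab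
      simp only [l, m, lineThrough, Complex.mul_re, Complex.mul_im, Complex.I_re, Complex.I_im,
        zero_mul, one_mul, zero_sub, zero_add, Complex.sub_re, Complex.sub_im] at ea eb hab hn
      apply Complex.ext
      · have : (((c t).re - (c 0).re) ^ 2 + ((c t).im - (c 0).im) ^ 2) *
            ((c a).re - (c b).re) = 0 := by
          linear_combination ((c t).re - (c 0).re) * hab -
            ((c t).im - (c 0).im) * (ea - eb)
        linarith [(mul_eq_zero.1 this).resolve_left hn.ne']
      · have : (((c t).re - (c 0).re) ^ 2 + ((c t).im - (c 0).im) ^ 2) *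
            ((c a).im - (c b).im) = 0 := by
          linear_combination ((c t).im - (c 0).im) * hab +
            ((c t).re - (c 0).re) * (ea - eb)
        linarith [(mul_eq_zero.1 this).resolve_left hn.ne']
    have hcont : ContinuousOn (fun s => m.height (c s)) (Icc 0 1) :=
      (m.continuous_height.comp hc.cont).continuousOn
    refine ⟨fun _ => m, fun s hs u hu hst htu => ⟨0, ?_⟩⟩
    rcases hcont.strictMonoOn_of_injOn_Icc' zero_le_one hinj with hm | hm
    · have e1 := hm hs ht' hst
      have e2 := hm ht' hu htu
      simp only [hmt] at e1 e2
      exact ⟨(mul_neg_of_neg_of_pos e1 e2).le, Or.inl e1.ne⟩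
    · have e1 := hm hs ht' hst
      have e2 := hm ht' hu htu
      simp only [hmt] at e1 e2
      exact ⟨(mul_neg_of_pos_of_neg e1 e2).le, Or.inl e1.ne'⟩

end IsConvexArc

end ACSigma

namespace ACSigma

/-! ### Arc systems and the variation norm -/

theorem one_le_vf {n : ℕ} (hn : n ≠ 0) (x : Fin (n + 1) → ℂ) : 1 ≤ vf x := by
  classical
  refine le_trans ?_ (vfLine_le_vf x ⟨1, inner ℝ 1 (x 0), one_ne_zero⟩)
  unfold vfLine
  rw [if_neg hn, Nat.one_le_iff_ne_zero, ← Nat.pos_iff_ne_zero, Finset.card_pos]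
  refine ⟨⟨0, Nat.pos_of_ne_zero hn⟩, Finset.mem_filter.2 ⟨Finset.mem_univ _, Or.inr (Or.inl ?_)⟩⟩
  exact ⟨rfl, sub_self _⟩

/-- A presentation of a plane set as a finite union of convex arcs `c j`, each parametrised
proportionally to arc length by the unit interval, which meet only at their endpoints. The field
`jump` says that finitely many lines suffice to separate any two points which do not lie on a
common arc. -/
structure ArcSystem (σ : Set ℂ) (ι : Type*) where
  c : ι → ℝ → σ
  convex : ∀ j, IsConvexArc fun t => (c j t : ℂ)
  cover : ∀ z : σ, ∃ j, ∃ t ∈ Icc (0 : ℝ) 1, c j t = z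
  inter : ∀ {j k : ι} {s t : ℝ}, j ≠ k → s ∈ Icc (0 : ℝ) 1 → t ∈ Icc (0 : ℝ) 1 → c j s = c k t →
    (s = 0 ∨ s = 1) ∧ (t = 0 ∨ t = 1)
  jump : ∃ F : Finset Line, ∀ z w : σ,
    (∀ j, ¬ (z ∈ c j '' Icc (0 : ℝ) 1 ∧ w ∈ c j '' Icc (0 : ℝ) 1)) → ∃ l ∈ F, l.Sep z w
  lip : ∀ j, ∃ K, LipschitzOnWith K (fun t => (c j t : ℂ)) (Icc 0 1)
  deriv : ∀ j, ∃ L > 0, ∀ t ∈ Ioo (0 : ℝ) 1, ∃ d : ℂ, ‖d‖ = L ∧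
    HasDerivAt (fun t => (c j t : ℂ)) d t

namespace ArcSystem

variable {σ : Set ℂ} {ι : Type*} (S : ArcSystem σ ι)

theorem continuous (j : ι) : Continuous (S.c j) :=
  continuous_induced_rng.2 (S.convex j).cont

theorem injOn (j : ι) : InjOn (S.c j) (Icc 0 1) := fun _ ha _ hb h =>
  (S.convex j).inj ha hb (congrArg Subtype.val h)

/-- The variation along each arc is controlled by the two-dimensional variation. -/
theorem eVariationOn_le_var (f : σ → ℂ) (j : ι) :
    eVariationOn (f ∘ S.c j) (Icc 0 1) ≤ 3 * var f := by
  rw [eVariationOn.eVariationOn_eq_strictMonoOn]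
  refine iSup_le ?_
  rintro ⟨n, u, hu, hmem⟩
  have hlt : ∀ i : Fin (n + 1), (i : ℕ) ≤ n := fun i => Nat.lt_succ_iff.1 i.2
  let t : Fin (n + 1) → ℝ := fun i => u i
  have ht : StrictMono t := fun a b hab => hu (hlt a) (hlt b) hab
  have htm : ∀ i, t i ∈ Icc (0 : ℝ) 1 := fun i => hmem _ (hlt i)
  let x : Fin (n + 1) → σ := fun i => S.c j (t i)
  have hx : ∀ i : Fin n, x i.castSucc ≠ x i.succ := fun i h =>
    (ht Fin.castSucc_lt_succ).ne (S.injOn j (htm _) (htm _) h)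
  have h1 : cvar f x / 3 ≤ var f :=
    le_trans (ENNReal.div_le_div_left (by exact_mod_cast (S.convex j).vf_le_three ht htm) _)
      (le_var f x hx)
  have h2 : ∑ i ∈ Finset.range n, edist ((f ∘ S.c j) (u (i + 1))) ((f ∘ S.c j) (u i)) = cvar f x := by
    rw [Finset.sum_range]
    exact Finset.sum_congr rfl fun i _ => edist_eq_enorm_sub _ _
  simp only
  rw [h2]
  rw [ENNReal.div_le_iff_le_mul (Or.inl (by norm_num)) (Or.inl (by norm_num))] at h1
  rwa [mul_comm]

/-- The sum of the supremum norm and of the variations along the arcs. -/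
noncomputable def arcNorm [Fintype ι] (f : σ → ℂ) : ℝ≥0∞ :=
  supNorm f + ∑ j, eVariationOn (f ∘ S.c j) (Icc 0 1)

theorem arcNorm_le [Fintype ι] (f : σ → ℂ) :
    S.arcNorm f ≤ (1 + 3 * Fintype.card ι) * bvNorm f := by
  unfold arcNorm
  rw [add_mul, one_mul]
  refine add_le_add le_self_add ?_
  have hle : var f ≤ bvNorm f := le_add_self
  refine (Finset.sum_le_sum fun j _ => (S.eVariationOn_le_var f j).trans
    (mul_le_mul_right hle 3)).trans (le_of_eq ?_)
  rw [Finset.sum_const, Finset.card_univ, nsmul_eq_mul]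
  ring

open Classical in
/-- The increments of `f` over the segments of a list with both ends on a given arc are controlled
by the variation along that arc: the segments jumping over a given point of the arc are separated
by one of four lines. -/
theorem sum_enorm_sub_arc_le (f : σ → ℂ) (j : ι) {n : ℕ} (hn : n ≠ 0) (x : Fin (n + 1) → σ)
    (T : Finset (Fin n)) (hT : ∀ i ∈ T, x i.castSucc ∈ S.c j '' Icc (0 : ℝ) 1 ∧
      x i.succ ∈ S.c j '' Icc (0 : ℝ) 1) :
    ∑ i ∈ T, ‖f (x i.succ) - f (x i.castSucc)‖ₑ ≤
      8 * eVariationOn (f ∘ S.c j) (Icc 0 1) * (vf (fun i => (x i : ℂ)) : ℝ≥0∞) := by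
  have hex : ∀ i, ∃ a b : ℝ, i ∈ T → (a ∈ Icc (0 : ℝ) 1 ∧ S.c j a = x i.castSucc) ∧
      b ∈ Icc (0 : ℝ) 1 ∧ S.c j b = x i.succ := by
    intro i
    by_cases hi : i ∈ T
    · obtain ⟨⟨a, ha⟩, ⟨b, hb⟩⟩ := hT i hi
      exact ⟨a, b, fun _ => ⟨ha, hb⟩⟩
    · exact ⟨0, 0, fun h => absurd h hi⟩
  choose a b hab using hex
  have hv := one_le_vf hn (fun i => (x i : ℂ))
  have hcongr : ∑ i ∈ T, ‖f (x i.succ) - f (x i.castSucc)‖ₑ =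
      ∑ i ∈ T, ‖(f ∘ S.c j) (b i) - (f ∘ S.c j) (a i)‖ₑ := by
    refine Finset.sum_congr rfl fun i hi => ?_
    rw [Function.comp_apply, Function.comp_apply, (hab i hi).1.2, (hab i hi).2.2]
  rw [hcongr]
  refine (sum_enorm_sub_le_mul_eVariationOn T (f ∘ S.c j) a b (p := 0) (q := 1)
    (fun i hi => (hab i hi).1.1) (fun i hi => (hab i hi).2.1)
    (N := 4 * (2 * vf (fun i => (x i : ℂ)))) (by omega) ?_).trans (le_of_eq ?_)
  · intro t ht
    obtain ⟨l, hl⟩ := (S.convex j).exists_separating_lines ht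
    let G : Fin 4 → Finset (Fin n) := fun k =>
      Finset.univ.filter fun i => (l k).Sep (x i.castSucc) (x i.succ)
    have hsub : (T.filter fun i => min (a i) (b i) < t ∧ t < max (a i) (b i)) ⊆
        Finset.univ.biUnion G := by
      intro i hi
      obtain ⟨hi, h1, h2⟩ := Finset.mem_filter.1 hi
      obtain ⟨⟨ha, hxa⟩, hb, hxb⟩ := hab i hi
      simp only [Finset.mem_biUnion, Finset.mem_univ, true_and, G, Finset.mem_filter]
      rw [← hxa, ← hxb]
      rcases min_lt_iff.1 h1 with h1 | h1 <;> rcases lt_max_iff.1 h2 with h2 | h2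
      · exact absurd h1 h2.not_gt
      · exact hl _ ha _ hb h1 h2
      · obtain ⟨k, hk⟩ := hl _ hb _ ha h1 h2
        exact ⟨k, hk.symm⟩
      · exact absurd h1 h2.not_gt
    refine (Finset.card_le_card hsub).trans ((Finset.card_biUnion_le_card_mul _ _ _
      fun k _ => card_sep_le hn (fun i => (x i : ℂ)) (l k)).trans ?_)
    simp
  · push_cast
    ring

open Classical in
/-- The variation norm is controlled by the supremum norm and the variations along the arcs. -/
theorem exists_bvNorm_le [Fintype ι] : ∃ C : ℝ≥0∞, C ≠ ∞ ∧ ∀ f : σ → ℂ,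
    bvNorm f ≤ C * S.arcNorm f := by
  obtain ⟨F, hF⟩ := S.jump
  refine ⟨9 + 4 * F.card, by finiteness, fun f => ?_⟩
  have hvar : var f ≤ 4 * F.card * supNorm f +
      ∑ j, 8 * eVariationOn (f ∘ S.c j) (Icc 0 1) := by
    refine iSup_le fun n => iSup_le fun x => iSup_le fun hx => ?_
    refine ENNReal.div_le_of_le_mul ?_
    rcases eq_or_ne n 0 with rfl | hn
    · simp [cvar]
    -- The segments within the `j`-th arc, and the jumping segments, which lie within no arc.
    let T : ι → Finset (Fin n) := fun j => Finset.univ.filter fun i =>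
      x i.castSucc ∈ S.c j '' Icc (0 : ℝ) 1 ∧ x i.succ ∈ S.c j '' Icc (0 : ℝ) 1
    let J : Finset (Fin n) := Finset.univ.filter fun i => ∀ j, i ∉ T j
    have hJ : J.card ≤ F.card * (2 * vf (fun i => (x i : ℂ))) := by
      let G : Line → Finset (Fin n) := fun l =>
        Finset.univ.filter fun i => l.Sep (x i.castSucc) (x i.succ)
      have hsub : J ⊆ F.biUnion G := by
        intro i hi
        have hi := (Finset.mem_filter.1 hi).2
        obtain ⟨l, hl, hsep⟩ := hF (x i.castSucc) (x i.succ) fun j hj =>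
          hi j (Finset.mem_filter.2 ⟨Finset.mem_univ _, hj⟩)
        exact Finset.mem_biUnion.2 ⟨l, hl, Finset.mem_filter.2 ⟨Finset.mem_univ _, hsep⟩⟩
      exact (Finset.card_le_card hsub).trans (Finset.card_biUnion_le_card_mul _ _ _
        fun l _ => card_sep_le hn (fun i => (x i : ℂ)) l)
    have hterm : ∀ i : Fin n, ‖f (x i.succ) - f (x i.castSucc)‖ₑ ≤
        (if i ∈ J then 2 * supNorm f else 0) +
        ∑ j, if i ∈ T j then ‖f (x i.succ) - f (x i.castSucc)‖ₑ else 0 := by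
      intro i
      by_cases hi : i ∈ J
      · rw [if_pos hi, two_mul]
        exact (enorm_sub_le.trans (add_le_add (enorm_le_supNorm f _)
          (enorm_le_supNorm f _))).trans le_self_add
      · have hi' : ∃ j, i ∈ T j := by
          by_contra! h
          exact hi (Finset.mem_filter.2 ⟨Finset.mem_univ _, h⟩)
        obtain ⟨j, hj⟩ := hi'
        refine le_trans ?_ le_add_self
        refine le_trans (le_of_eq ?_) (Finset.single_le_sum
          (f := fun j => if i ∈ T j then ‖f (x i.succ) - f (x i.castSucc)‖ₑ else 0)
          (fun _ _ => zero_le) (Finset.mem_univ j))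
        rw [if_pos hj]
    calc cvar f x ≤ ∑ i : Fin n, ((if i ∈ J then 2 * supNorm f else 0) +
          ∑ j, if i ∈ T j then ‖f (x i.succ) - f (x i.castSucc)‖ₑ else 0) :=
          Finset.sum_le_sum fun i _ => hterm i
      _ = J.card * (2 * supNorm f) + ∑ j, ∑ i ∈ T j, ‖f (x i.succ) - f (x i.castSucc)‖ₑ := by
          rw [Finset.sum_add_distrib, Finset.sum_comm]
          simp only [Finset.sum_ite_mem, Finset.univ_inter, Finset.sum_const, nsmul_eq_mul]
      _ ≤ (F.card * (2 * vf (fun i => (x i : ℂ))) : ℕ) * (2 * supNorm f) +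
          ∑ j, 8 * eVariationOn (f ∘ S.c j) (Icc 0 1) * (vf (fun i => (x i : ℂ)) : ℝ≥0∞) := by
          refine add_le_add (mul_le_mul_left (by exact_mod_cast hJ) _)
            (Finset.sum_le_sum fun j _ => ?_)
          exact S.sum_enorm_sub_arc_le f j hn x (T j) fun i hi => (Finset.mem_filter.1 hi).2
      _ = _ := by
          rw [add_mul, Finset.sum_mul]
          push_cast
          ring
  unfold bvNorm arcNorm
  rw [mul_add, Finset.mul_sum]
  calc supNorm f + var f ≤ supNorm f + (4 * F.card * supNorm f +
        ∑ j, 8 * eVariationOn (f ∘ S.c j) (Icc 0 1)) := add_le_add_right hvar _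
    _ = (1 + 4 * F.card) * supNorm f + ∑ j, 8 * eVariationOn (f ∘ S.c j) (Icc 0 1) := by ring
    _ ≤ _ := by
      refine add_le_add ?_ (Finset.sum_le_sum fun j _ => ?_)
      · gcongr
        norm_num
      · gcongr
        exact le_trans (by norm_num : (8 : ℝ≥0∞) ≤ 9) le_self_add

end ArcSystem

end ACSigma

namespace ACSigma

/-! ### Absolutely continuous functions of one real coordinate -/

/-- The algebra `AC(σ)`, seen as an algebra of functions. -/
noncomputable def acFunctions (σ : Set ℂ) : Subalgebra ℂ (σ → ℂ) := (AC σ).map (BV.toFun σ)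

variable {σ : Set ℂ}

theorem bvNorm_lt_top_of_mem {f : σ → ℂ} (hf : f ∈ acFunctions σ) : bvNorm f < ∞ := by
  obtain ⟨F, -, rfl⟩ := hf
  exact F.2

theorem mem_acFunctions_iff {f : σ → ℂ} (hf : bvNorm f < ∞) :
    f ∈ acFunctions σ ↔ (⟨f, hf⟩ : bvSubalgebra σ) ∈ {F : BV σ | F ∈ AC σ} := by
  constructor
  · rintro ⟨F, hF, rfl⟩
    exact hF
  · intro h
    exact ⟨_, h, rfl⟩

theorem polyFunctions_le_acFunctions (hσ : Bornology.IsBounded σ) :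
    polyFunctions σ ≤ acFunctions σ := by
  intro f hf
  exact (mem_acFunctions_iff (polyFunctions_le hσ hf)).2
    (Subalgebra.le_topologicalClosure (P2 σ) hf)

theorem BV.norm_sub_lt_iff (F G : BV σ) {ε : ℝ} :
    ‖F - G‖ < ε ↔ bvNorm (BV.toFun σ F - BV.toFun σ G) < ENNReal.ofReal ε := by
  rw [BV.norm_def, map_sub]
  have h : bvNorm (BV.toFun σ F - BV.toFun σ G) < ∞ := by
    rw [← map_sub]
    exact BV.bvNorm_lt_top _
  exact (ENNReal.lt_ofReal_iff_toReal_lt h.ne).symm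

/-- `AC(σ)` is closed in the variation norm. -/
theorem mem_acFunctions_of_approx {f : σ → ℂ}
    (h : ∀ ε : ℝ, 0 < ε → ∃ g ∈ acFunctions σ, bvNorm (f - g) < ENNReal.ofReal ε) :
    f ∈ acFunctions σ := by
  have hf : bvNorm f < ∞ := by
    obtain ⟨g, hg, hfg⟩ := h 1 one_pos
    have := bvNorm_add (f - g) g
    rw [sub_add_cancel] at this
    exact this.trans_lt
      (ENNReal.add_lt_top.2 ⟨hfg.trans ENNReal.ofReal_lt_top, bvNorm_lt_top_of_mem hg⟩)
  rw [mem_acFunctions_iff hf]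
  have hcl : IsClosed (AC σ : Set (BV σ)) := Subalgebra.isClosed_topologicalClosure _
  let F : BV σ := (⟨f, hf⟩ : bvSubalgebra σ)
  change F ∈ (AC σ : Set (BV σ))
  rw [← hcl.closure_eq, Metric.mem_closure_iff]
  intro ε hε
  obtain ⟨_, ⟨G, hG, rfl⟩, hfg⟩ := h ε hε
  refine ⟨G, hG, ?_⟩
  rw [dist_eq_norm, BV.norm_sub_lt_iff]
  exact hfg

theorem const_mem_acFunctions (c : ℂ) : (fun _ : σ => c) ∈ acFunctions σ :=
  (acFunctions σ).algebraMap_mem c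

theorem exists_poly_of_mem {f : σ → ℂ} (hf : f ∈ acFunctions σ) {ε : ℝ} (hε : 0 < ε) :
    ∃ g ∈ polyFunctions σ, bvNorm (f - g) < ENNReal.ofReal ε := by
  obtain ⟨F, hF, rfl⟩ := hf
  have hF : F ∈ closure (P2 σ : Set (BV σ)) := hF
  rw [Metric.mem_closure_iff] at hF
  obtain ⟨G, hG, hFG⟩ := hF ε hε
  rw [dist_eq_norm, BV.norm_sub_lt_iff] at hFG
  exact ⟨_, hG, hFG⟩

/-- The variation of a function of one real coordinate is at most the variation of that function on
an interval containing the range of the coordinate. -/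
theorem var_comp_inner_le (w : ℝ → ℂ) {v : ℂ} (hv : v ≠ 0) {p q : ℝ}
    (hb : ∀ z ∈ σ, (inner ℝ v z : ℝ) ∈ Icc p q) :
    var (fun z : σ => w (inner ℝ v (z : ℂ))) ≤ eVariationOn w (Icc p q) := by
  classical
  refine iSup_le fun n => iSup_le fun x => iSup_le fun hx => ?_
  refine ENNReal.div_le_of_le_mul ?_
  rcases eq_or_ne n 0 with rfl | hn
  · simp [cvar]
  have hvf := one_le_vf hn (fun i => (x i : ℂ))
  rw [mul_comm]
  refine sum_enorm_sub_le_mul_eVariationOn Finset.univ w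
    (fun i : Fin n => inner ℝ v (x i.castSucc : ℂ)) (fun i => inner ℝ v (x i.succ : ℂ))
    (fun i _ => hb _ (x _).2) (fun i _ => hb _ (x _).2) (by omega) fun t _ => ?_
  refine le_trans ?_ (vfLine_le_vf _ ⟨v, t, hv⟩)
  unfold vfLine
  rw [if_neg hn]
  refine Finset.card_le_card fun i hi => ?_
  simp only [Finset.mem_filter, Finset.mem_univ, true_and] at hi ⊢
  refine Or.inl ?_
  change ((inner ℝ v (x i.castSucc : ℂ) : ℝ) - t) * ((inner ℝ v (x i.succ : ℂ) : ℝ) - t) < 0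
  obtain ⟨hl, hr⟩ := hi
  rcases min_lt_iff.1 hl with h | h <;> rcases lt_max_iff.1 hr with h' | h' <;> nlinarith

theorem eVariationOn_le_of_edist_le {E F : Type*} [PseudoEMetricSpace E] [PseudoEMetricSpace F]
    {f : ℝ → E} {g : ℝ → F} {s : Set ℝ}
    (h : ∀ x ∈ s, ∀ y ∈ s, edist (f x) (f y) ≤ edist (g x) (g y)) :
    eVariationOn f s ≤ eVariationOn g s :=
  iSup_le fun p => (Finset.sum_le_sum fun _ _ => h _ (p.2.2.2 _) _ (p.2.2.2 _)).trans
    (eVariationOn.sum_le p.2.2.1 p.2.2.2)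

theorem eVariationOn_add_le (f g : ℝ → ℂ) (s : Set ℝ) :
    eVariationOn (fun t => f t + g t) s ≤ eVariationOn f s + eVariationOn g s := by
  refine iSup_le fun p => ?_
  refine (Finset.sum_le_sum fun i _ => edist_add_add_le _ _ _ _).trans ?_
  rw [Finset.sum_add_distrib]
  exact add_le_add (eVariationOn.sum_le p.2.2.1 p.2.2.2) (eVariationOn.sum_le p.2.2.1 p.2.2.2)

theorem exists_derivative_eq (Q : Polynomial ℝ) : ∃ P : Polynomial ℝ, P.derivative = Q := by
  induction Q using Polynomial.induction_on' with
  | add p q hp hq =>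
    obtain ⟨P, rfl⟩ := hp
    obtain ⟨R, rfl⟩ := hq
    exact ⟨P + R, Polynomial.derivative_add⟩
  | monomial n a =>
    refine ⟨Polynomial.monomial (n + 1) (a / (n + 1)), ?_⟩
    rw [Polynomial.derivative_monomial]
    congr 1
    push_cast
    field_simp

/-- Polynomials are dense, in the variation norm of an interval, in the Lipschitz functions: the
derivative is approximated in `L¹`. -/
theorem exists_polynomial_eVariationOn_le {u : ℝ → ℝ} {K : NNReal} (hu : LipschitzWith K u)
    {p q : ℝ} (hpq : p ≤ q) {ε : ℝ} (hε : 0 < ε) : ∃ P : Polynomial ℝ, P.eval p = u p ∧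
      eVariationOn (fun t => u t - P.eval t) (Icc p q) ≤ ENNReal.ofReal ε := by
  have hac : ∀ a b, AbsolutelyContinuousOnInterval u a b := fun a b =>
    (hu.lipschitzOnWith).absolutelyContinuousOnInterval
  have hint : ∀ a b, IntervalIntegrable (deriv u) MeasureTheory.volume a b := fun a b =>
    (hac a b).intervalIntegrable_deriv
  have hi := (intervalIntegrable_iff_integrableOn_Ioc_of_le hpq).1 (hint p q)
  obtain ⟨g, -, hg, hgc, hgi⟩ :=
    MeasureTheory.Integrable.exists_hasCompactSupport_integral_sub_le hi (half_pos hε)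
  obtain ⟨Q, hQ⟩ := exists_polynomial_near_of_continuousOn p q g hgc.continuousOn
    (ε / (2 * (q - p + 1))) (by have : 0 < q - p + 1 := by linarith
                                positivity)
  obtain ⟨P₀, hP₀⟩ := exists_derivative_eq Q
  let P : Polynomial ℝ := P₀ + Polynomial.C (u p - P₀.eval p)
  have hPd : P.derivative = Q := by simp [P, hP₀]
  refine ⟨P, by simp [P], ?_⟩
  have hQi : ∀ a b, IntervalIntegrable (fun t => Q.eval t) MeasureTheory.volume a b := fun a b =>
    Q.continuous.intervalIntegrable a b
  have hdiff : ∀ a b, IntervalIntegrable (fun t => |deriv u t - Q.eval t|)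
      MeasureTheory.volume a b := fun a b => ((hint a b).sub (hQi a b)).abs
  -- the indefinite integral of `|u' - Q|` dominates `u - P`
  let V : ℝ → ℝ := fun x => ∫ t in p..x, |deriv u t - Q.eval t|
  have hVsub : ∀ x y, V y - V x = ∫ t in x..y, |deriv u t - Q.eval t| := fun x y =>
    intervalIntegral.integral_interval_sub_left (hdiff _ _) (hdiff _ _)
  have hVmono : Monotone V := fun x y hxy => by
    rw [← sub_nonneg, hVsub]
    exact intervalIntegral.integral_nonneg hxy fun _ _ => abs_nonneg _
  have hftc : ∀ x y, (u y - P.eval y) - (u x - P.eval x) = ∫ t in x..y, (deriv u t - Q.eval t) := by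
    intro x y
    rw [intervalIntegral.integral_sub (hint x y) (hQi x y), (hac x y).integral_deriv_eq_sub,
      intervalIntegral.integral_eq_sub_of_hasDerivAt (f := fun t => P.eval t)
        (fun t _ => by rw [← hPd]; exact P.hasDerivAt t) (hQi x y)]
    ring
  have hdom : ∀ x y, |(u x - P.eval x) - (u y - P.eval y)| ≤ |V x - V y| := by
    intro x y
    wlog hxy : x ≤ y generalizing x y
    · rw [abs_sub_comm, abs_sub_comm (V x)]
      exact this y x (le_of_not_ge hxy)
    rw [abs_sub_comm, abs_sub_comm (V x), hftc, hVsub]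
    exact (intervalIntegral.abs_integral_le_integral_abs hxy).trans (le_abs_self _)
  have hVq : V q ≤ ε := by
    have e1 : V q ≤ ∫ t in p..q, (|deriv u t - g t| + ε / (2 * (q - p + 1))) := by
      refine intervalIntegral.integral_mono_on hpq (hdiff _ _)
        ((((hint p q).sub (hgc.intervalIntegrable _ _)).abs).add (by simp)) fun t ht => ?_
      have := (hQ t ht).le
      rw [abs_sub_comm] at this
      exact (abs_sub_le _ (g t) _).trans (add_le_add le_rfl this)
    rw [intervalIntegral.integral_add (((hint p q).sub (hgc.intervalIntegrable _ _)).abs)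
      (by simp), intervalIntegral.integral_const, smul_eq_mul] at e1
    have e2 : (∫ t in p..q, |deriv u t - g t|) ≤ ε / 2 := by
      rw [intervalIntegral.integral_of_le hpq]
      exact hg
    have e3 : (q - p) * (ε / (2 * (q - p + 1))) ≤ ε / 2 := by
      have h1 : 0 < q - p + 1 := by linarith
      rw [mul_div_assoc', div_le_div_iff₀ (by positivity) two_pos]
      nlinarith
    linarith
  refine (eVariationOn_le_of_edist_le (g := V) fun x _ y _ => ?_).trans
    (le_trans (le_of_eq ?_) (ENNReal.ofReal_le_ofReal hVq))
  · rw [edist_dist, edist_dist, Real.dist_eq, Real.dist_eq]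
    exact ENNReal.ofReal_le_ofReal (hdom x y)
  · have h0 : V p = 0 := intervalIntegral.integral_same
    have := (hVmono.monotoneOn (Icc p q)).eVariationOn_eq (left_mem_Icc.2 hpq)
      (right_mem_Icc.2 hpq)
    rwa [inter_self, h0, sub_zero] at this

theorem inner_mem_polyFunctions (v : ℂ) :
    (fun z : σ => ((inner ℝ v (z : ℂ) : ℝ) : ℂ)) ∈ polyFunctions σ := by
  refine ⟨MvPolynomial.C (v.re : ℂ) * MvPolynomial.X 0 + MvPolynomial.C (v.im : ℂ) *
    MvPolynomial.X 1, ?_⟩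
  ext z
  rw [inner_eq_re_mul_add]
  simp

theorem polynomial_comp_mem {A : Subalgebra ℂ (σ → ℂ)} {f : σ → ℝ}
    (hf : (fun z => (f z : ℂ)) ∈ A) (P : Polynomial ℝ) :
    (fun z => ((P.eval (f z) : ℝ) : ℂ)) ∈ A := by
  induction P using Polynomial.induction_on' with
  | add p q hp hq =>
    convert A.add_mem hp hq using 1
    ext z
    simp
  | monomial n a =>
    convert A.mul_mem (A.algebraMap_mem (a : ℂ)) (A.pow_mem hf n) using 1
    ext z
    simp

theorem real_comp_inner_mem_acFunctions (hσ : Bornology.IsBounded σ) {u : ℝ → ℝ} {K : NNReal}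
    (hu : LipschitzWith K u) {v : ℂ} (hv : v ≠ 0) :
    (fun z : σ => ((u (inner ℝ v (z : ℂ)) : ℝ) : ℂ)) ∈ acFunctions σ := by
  obtain ⟨R, hR⟩ := hσ.exists_norm_le
  set B : ℝ := ‖v‖ * |R| with hB
  have hB0 : 0 ≤ B := by positivity
  have hb : ∀ z ∈ σ, (inner ℝ v z : ℝ) ∈ Icc (-B) B := fun z hz =>
    abs_le.1 ((abs_real_inner_le_norm v z).trans
      (mul_le_mul_of_nonneg_left ((hR z hz).trans (le_abs_self R)) (norm_nonneg _)))
  refine mem_acFunctions_of_approx fun ε hε => ?_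
  obtain ⟨P, hP, hvar⟩ := exists_polynomial_eVariationOn_le hu (p := -B) (q := B) (by linarith)
    (ε := ε / 3) (by linarith)
  refine ⟨fun z => ((P.eval (inner ℝ v (z : ℂ)) : ℝ) : ℂ), polyFunctions_le_acFunctions hσ
    (polynomial_comp_mem (inner_mem_polyFunctions v) P), ?_⟩
  let w : ℝ → ℂ := fun t => ((u t - P.eval t : ℝ) : ℂ)
  have hw : eVariationOn w (Icc (-B) B) ≤ ENNReal.ofReal (ε / 3) := by
    refine (eVariationOn_le_of_edist_le fun x _ y _ => le_of_eq ?_).trans hvar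
    exact Complex.isometry_ofReal.edist_eq _ _
  have heq : ((fun z : σ => ((u (inner ℝ v (z : ℂ)) : ℝ) : ℂ)) -
      fun z : σ => ((P.eval (inner ℝ v (z : ℂ)) : ℝ) : ℂ)) =
      fun z : σ => w (inner ℝ v (z : ℂ)) := by
    ext z
    simp [w]
  rw [heq]
  have h1 : supNorm (fun z : σ => w (inner ℝ v (z : ℂ))) ≤ ENNReal.ofReal (ε / 3) := by
    refine iSup_le fun z => le_trans ?_ hw
    have h0 : w (-B) = 0 := by simp [w, hP]
    have := eVariationOn.edist_le w (hb z z.2) (left_mem_Icc.2 (by linarith : -B ≤ B))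
    rwa [h0, edist_zero_right] at this
  have h2 := (var_comp_inner_le w hv hb).trans hw
  refine (add_le_add h1 h2).trans_lt ?_
  rw [← ENNReal.ofReal_add (by linarith) (by linarith)]
  exact (ENNReal.ofReal_lt_ofReal_iff hε).2 (by linarith)

/-- A Lipschitz function of one real coordinate is absolutely continuous. -/
theorem comp_inner_mem_acFunctions (hσ : Bornology.IsBounded σ) {u : ℝ → ℂ} {K : NNReal}
    (hu : LipschitzWith K u) {v : ℂ} (hv : v ≠ 0) :
    (fun z : σ => u (inner ℝ v (z : ℂ))) ∈ acFunctions σ := by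
  have hre : LipschitzWith K fun t => (u t).re := LipschitzWith.of_dist_le_mul fun x y =>
    (by rw [Real.dist_eq, ← Complex.sub_re, Complex.dist_eq]; exact Complex.abs_re_le_norm _ :
      _ ≤ dist (u x) (u y)).trans (hu.dist_le_mul x y)
  have him : LipschitzWith K fun t => (u t).im := LipschitzWith.of_dist_le_mul fun x y =>
    (by rw [Real.dist_eq, ← Complex.sub_im, Complex.dist_eq]; exact Complex.abs_im_le_norm _ :
      _ ≤ dist (u x) (u y)).trans (hu.dist_le_mul x y)
  have h := (acFunctions σ).add_mem (real_comp_inner_mem_acFunctions hσ hre hv)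
    ((acFunctions σ).smul_mem (real_comp_inner_mem_acFunctions hσ him hv) Complex.I)
  convert h using 1
  ext z
  simp [mul_comm Complex.I, Complex.re_add_im]

end ACSigma

namespace ACSigma

open Filter Topology

/-! ### Absolute continuity is a local property -/

variable {σ : Set ℂ}

/-- A piecewise linear function vanishing on `(-∞, 0]` and equal to `1` on `[1, ∞)`. -/
noncomputable def ramp (y : ℝ) : ℝ := max (min y 1) 0

theorem ramp_of_nonpos {y : ℝ} (h : y ≤ 0) : ramp y = 0 := by
  rw [ramp, min_eq_left (by linarith), max_eq_right h]

theorem ramp_of_one_le {y : ℝ} (h : 1 ≤ y) : ramp y = 1 := by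
  rw [ramp, min_eq_right h, max_eq_left zero_le_one]

theorem lipschitzWith_ramp : LipschitzWith 1 ramp :=
  (LipschitzWith.id.min_const 1).max_const 0

theorem exists_lipschitzWith_ramp_affine (r b : ℝ) : ∃ K, LipschitzWith K fun y => ramp (y / r + b) := by
  refine ⟨1 * ‖r⁻¹‖₊, lipschitzWith_ramp.comp (LipschitzWith.of_dist_le_mul fun x y => ?_)⟩
  rw [Real.dist_eq, Real.dist_eq, coe_nnnorm, Real.norm_eq_abs, ← abs_mul]
  apply le_of_eq
  congr 1
  ring

/-- The `k`-th member of the partition of unity on the line into tents of width `2 * r`, starting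
near `-N * r`. -/
noncomputable def tent (r : ℝ) (N k : ℕ) (y : ℝ) : ℝ :=
  ramp (y / r + (N - k)) - ramp (y / r + (N - (k + 1 : ℕ)))

theorem sum_tent {r y : ℝ} {N : ℕ} (h1 : -(N - 1) ≤ y / r) (h2 : y / r ≤ N) :
    ∑ k ∈ Finset.range (2 * N), tent r N k y = 1 := by
  unfold tent
  rw [Finset.sum_range_sub' (fun k : ℕ => ramp (y / r + (N - k)))]
  rw [ramp_of_one_le (by push_cast; linarith), ramp_of_nonpos (by push_cast; linarith), sub_zero]

theorem tent_ne_zero {r y : ℝ} {N k : ℕ} (h : tent r N k y ≠ 0) :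
    0 < y / r + (N - k) ∧ y / r + (N - k) < 2 := by
  constructor
  · by_contra! hcon
    exact h (by rw [tent, ramp_of_nonpos hcon, ramp_of_nonpos (by push_cast; linarith), sub_zero])
  · by_contra! hcon
    exact h (by rw [tent, ramp_of_one_le (by linarith), ramp_of_one_le (by push_cast; linarith),
      sub_self])

theorem tent_comp_mem_acFunctions (hσ : Bornology.IsBounded σ) (r : ℝ) (N k : ℕ) {v : ℂ}
    (hv : v ≠ 0) : (fun z : σ => ((tent r N k (inner ℝ v (z : ℂ)) : ℝ) : ℂ)) ∈ acFunctions σ := by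
  obtain ⟨K₁, h₁⟩ := exists_lipschitzWith_ramp_affine r (N - k)
  obtain ⟨K₂, h₂⟩ := exists_lipschitzWith_ramp_affine r (N - (k + 1 : ℕ))
  convert (acFunctions σ).sub_mem (real_comp_inner_mem_acFunctions hσ h₁ hv)
    (real_comp_inner_mem_acFunctions hσ h₂ hv) using 1
  ext z
  simp [tent]

theorem abs_sub_lt_of_tent_ne_zero {r x y : ℝ} (hr : 0 < r) {N k : ℕ} (hx : tent r N k x ≠ 0)
    (hy : tent r N k y ≠ 0) : |x - y| < 2 * r := by
  obtain ⟨h1, h2⟩ := tent_ne_zero hx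
  obtain ⟨h3, h4⟩ := tent_ne_zero hy
  have : |x / r - y / r| < 2 := by
    rw [abs_lt]
    constructor <;> linarith
  rwa [← sub_div, abs_div, abs_of_pos hr, div_lt_iff₀ hr] at this

/-- A function which agrees near each point with an absolutely continuous function is absolutely
continuous: multiply by a fine partition of unity made of products of tents in the two
coordinates. -/
theorem mem_acFunctions_of_local (hσ : IsCompact σ) {f : σ → ℂ}
    (h : ∀ z : σ, ∃ g ∈ acFunctions σ, ∀ᶠ w in 𝓝 z, f w = g w) : f ∈ acFunctions σ := by
  classical
  have hbdd := hσ.isBounded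
  choose g hg hfg using h
  have : CompactSpace σ := isCompact_iff_compactSpace.1 hσ
  choose U hUsub hUo hzU using fun z : σ => eventually_nhds_iff.1 (hfg z)
  obtain ⟨δ, hδ, hleb⟩ := lebesgue_number_lemma_of_metric (s := (univ : Set σ)) (c := U)
    isCompact_univ hUo fun z _ => mem_iUnion.2 ⟨z, hzU z⟩
  obtain ⟨R, hR⟩ := hbdd.exists_norm_le
  -- The support of a product of tents has diameter less than `4 * r`, hence lies in some `U i`.
  set r : ℝ := δ / 4 with hr
  have hr0 : 0 < r := by positivity
  obtain ⟨N, hN⟩ := exists_nat_ge (|R| / r + 1)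
  let T : ℕ → ℕ → σ → ℂ := fun a b z =>
    ((tent r N a (inner ℝ 1 (z : ℂ)) : ℝ) : ℂ) * ((tent r N b (inner ℝ Complex.I (z : ℂ)) : ℝ) : ℂ)
  have hT : ∀ a b, T a b ∈ acFunctions σ := fun a b =>
    (acFunctions σ).mul_mem (tent_comp_mem_acFunctions hbdd r N a one_ne_zero)
      (tent_comp_mem_acFunctions hbdd r N b Complex.I_ne_zero)
  have hone : ∀ (v : ℂ) (_ : ‖v‖ = 1) (z : σ),
      ∑ k ∈ Finset.range (2 * N), tent r N k (inner ℝ v (z : ℂ)) = 1 := by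
    intro v hv z
    have h1 : |(inner ℝ v (z : ℂ) : ℝ)| ≤ |R| := by
      have := abs_real_inner_le_norm v (z : ℂ)
      rw [hv, one_mul] at this
      exact this.trans ((hR z z.2).trans (le_abs_self R))
    have h2 : |(inner ℝ v (z : ℂ) : ℝ) / r| ≤ N - 1 := by
      rw [abs_div, abs_of_pos hr0]
      have := div_le_div_of_nonneg_right h1 hr0.le
      linarith
    obtain ⟨h3, h4⟩ := abs_le.1 h2
    exact sum_tent h3 (by linarith)
  have hsum : f = ∑ a ∈ Finset.range (2 * N), ∑ b ∈ Finset.range (2 * N), f * T a b := by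
    ext z
    have : ∑ a ∈ Finset.range (2 * N), ∑ b ∈ Finset.range (2 * N), T a b z = 1 := by
      simp only [T]
      rw [← Finset.sum_mul_sum, ← Complex.ofReal_sum, ← Complex.ofReal_sum,
        hone 1 (by simp) z, hone Complex.I (by simp) z]
      simp
    simp only [Finset.sum_apply, Pi.mul_apply]
    simp only [← Finset.mul_sum]
    rw [this, mul_one]
  rw [hsum]
  refine Subalgebra.sum_mem _ fun a _ => Subalgebra.sum_mem _ fun b _ => ?_
  by_cases hne : ∃ z₀ : σ, T a b z₀ ≠ 0
  · obtain ⟨z₀, hz₀⟩ := hne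
    obtain ⟨i, hi⟩ := hleb z₀ (mem_univ _)
    have heq : f * T a b = g i * T a b := by
      ext z
      rw [Pi.mul_apply, Pi.mul_apply]
      by_cases hz : T a b z = 0
      · rw [hz, mul_zero, mul_zero]
      congr 1
      refine hUsub i z (hi ?_)
      obtain ⟨n1, n2⟩ := mul_ne_zero_iff.1 hz
      obtain ⟨m1, m2⟩ := mul_ne_zero_iff.1 hz₀
      have e1 := abs_sub_lt_of_tent_ne_zero hr0 (Complex.ofReal_ne_zero.1 n1)
        (Complex.ofReal_ne_zero.1 m1)
      have e2 := abs_sub_lt_of_tent_ne_zero hr0 (Complex.ofReal_ne_zero.1 n2)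
        (Complex.ofReal_ne_zero.1 m2)
      simp only [inner_eq_re_mul_add, Complex.one_re, Complex.one_im, Complex.I_re, Complex.I_im,
        one_mul, zero_mul, add_zero, zero_add, ← Complex.sub_re, ← Complex.sub_im] at e1 e2
      rw [Metric.mem_ball, Subtype.dist_eq, Complex.dist_eq]
      have := Complex.norm_le_abs_re_add_abs_im ((z : ℂ) - z₀)
      rw [hr] at e1 e2
      linarith
    rw [heq]
    exact (acFunctions σ).mul_mem (hg i) (hT a b)
  · push Not at hne
    have : f * T a b = 0 := by
      ext z
      rw [Pi.mul_apply, hne z, mul_zero, Pi.zero_apply]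
    rw [this]
    exact (acFunctions σ).zero_mem

/-! ### Regularity of differentiable convex arcs -/

/-- If `D` has length `L` and is orthogonal to the unit vector `v`, then it is `± L` times the unit
vector obtained from `v` by a right-angle rotation. -/
theorem inner_sq_of_inner_eq_zero {v D E : ℂ} {L : ℝ} (hv : ‖v‖ = 1) (hD : ‖D‖ = L)
    (h : (inner ℝ v D : ℝ) = 0) :
    (inner ℝ D E : ℝ) ^ 2 = L ^ 2 * (inner ℝ (Complex.I * v) E : ℝ) ^ 2 := by
  have h1 : v.re ^ 2 + v.im ^ 2 = 1 := by
    have := Complex.sq_norm v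
    rw [hv, Complex.normSq_apply] at this
    linarith
  have h2 : D.re ^ 2 + D.im ^ 2 = L ^ 2 := by
    have := Complex.sq_norm D
    rw [hD, Complex.normSq_apply] at this
    linarith
  simp only [inner_eq_re_mul_add, Complex.mul_re, Complex.mul_im, Complex.I_re, Complex.I_im,
    zero_mul, one_mul, zero_sub, zero_add] at h ⊢
  set lam := -v.im * D.re + v.re * D.im with hl
  have e1 : D.re = -v.im * lam := by
    rw [hl]
    linear_combination (-D.re) * h1 + v.re * h
  have e2 : D.im = v.re * lam := by
    rw [hl]
    linear_combination (-D.im) * h1 + v.im * h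
  have e3 : lam ^ 2 = L ^ 2 := by
    rw [← h2]
    have : D.re ^ 2 + D.im ^ 2 = (v.re ^ 2 + v.im ^ 2) * lam ^ 2 := by
      rw [e1, e2]
      ring
    rw [this, h1, one_mul]
  rw [← e3]
  conv_lhs => rw [e1, e2]
  ring

/-- The supporting direction at a point of differentiability is orthogonal to the tangent. -/
theorem inner_deriv_eq_zero {γ : ℝ → ℂ} {v D : ℂ} {t : ℝ} (ht : t ∈ Ioo (0 : ℝ) 1)
    (hD : HasDerivAt γ D t) (hs : ∀ s ∈ Icc (0 : ℝ) 1, 0 ≤ (inner ℝ v (γ s - γ t) : ℝ)) :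
    (inner ℝ v D : ℝ) = 0 := by
  have h1 : HasDerivAt (fun s => (inner ℝ v (γ s) : ℝ)) (inner ℝ v D) t := by
    simpa only [inner_zero_left, add_zero] using (hasDerivAt_const t v).inner ℝ hD
  refine IsLocalMin.hasDerivAt_eq_zero ?_ h1
  filter_upwards [Icc_mem_nhds ht.1 ht.2] with s hs'
  have := hs s hs'
  rw [inner_sub_right] at this
  linarith

/-- Near an interior parameter, a differentiable convex arc is bi-Lipschitz over a line: by
compactness the supporting directions, hence the tangents up to sign, are continuous, and by
Darboux's theorem the sign does not jump. -/
theorem IsConvexArc.exists_inner_ge {γ : ℝ → ℂ} (hγ : IsConvexArc γ) {L : ℝ} (hL : 0 < L)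
    (hd : ∀ t ∈ Ioo (0 : ℝ) 1, ∃ d : ℂ, ‖d‖ = L ∧ HasDerivAt γ d t) {t₀ : ℝ}
    (ht₀ : t₀ ∈ Ioo (0 : ℝ) 1) :
    ∃ v : ℂ, v ≠ 0 ∧ ∃ m > 0, ∃ η > 0, Ioo (t₀ - η) (t₀ + η) ⊆ Ioo 0 1 ∧
      ∀ s ∈ Ioo (t₀ - η) (t₀ + η), ∀ s' ∈ Ioo (t₀ - η) (t₀ + η), s ≤ s' →
        m * (s' - s) ≤ (inner ℝ v (γ s') : ℝ) - inner ℝ v (γ s) := by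
  have hd' : ∀ t, ∃ d : ℂ, t ∈ Ioo (0 : ℝ) 1 → ‖d‖ = L ∧ HasDerivAt γ d t := fun t => by
    by_cases ht : t ∈ Ioo (0 : ℝ) 1
    · obtain ⟨d, h⟩ := hd t ht
      exact ⟨d, fun _ => h⟩
    · exact ⟨0, fun h => absurd h ht⟩
  choose D hD using hd'
  have hsup : ∀ t, ∃ v : ℂ, t ∈ Icc (0 : ℝ) 1 → ‖v‖ = 1 ∧ ∀ s ∈ Icc (0 : ℝ) 1,
      0 ≤ (inner ℝ v (γ s - γ t) : ℝ) := fun t => by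
    by_cases ht : t ∈ Icc (0 : ℝ) 1
    · obtain ⟨v, hv, h⟩ := hγ.support t ht
      refine ⟨(‖v‖⁻¹ : ℝ) • v, fun _ => ⟨?_, fun s hs => ?_⟩⟩
      · rw [norm_smul, norm_inv, norm_norm, inv_mul_cancel₀ (norm_ne_zero_iff.2 hv)]
      · rw [inner_smul_left]
        exact mul_nonneg (inv_nonneg.2 (norm_nonneg _)) (h s hs)
    · exact ⟨0, fun h => absurd h ht⟩
  choose V hV using hsup
  have hsubI : Ioo (0 : ℝ) 1 ⊆ Icc 0 1 := Ioo_subset_Icc_self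
  -- Otherwise the supporting directions at a sequence of parameters violating this accumulate at a
  -- supporting direction `v` at `t₀`, which is orthogonal to `D t₀`; but then the rotation of `v`
  -- is parallel to `D t₀`, against the limit of the violated inequalities.
  have hev : ∀ᶠ t in 𝓝 t₀, L ^ 4 / 4 ≤ (inner ℝ (D t) (D t₀) : ℝ) ^ 2 := by
    by_contra hcon
    rw [not_eventually] at hcon
    obtain ⟨x, hx, hxP⟩ := exists_seq_forall_of_frequently
      (hcon.and_eventually (Ioo_mem_nhds ht₀.1 ht₀.2))
    have hsph : ∀ n, V (x n) ∈ Metric.sphere (0 : ℂ) 1 := fun n => by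
      rw [mem_sphere_zero_iff_norm]
      exact (hV _ (hsubI (hxP n).2)).1
    obtain ⟨v, hv, φ, hφ, hlim⟩ := (isCompact_sphere (0 : ℂ) 1).tendsto_subseq hsph
    rw [mem_sphere_zero_iff_norm] at hv
    have hxφ : Tendsto (x ∘ φ) atTop (𝓝 t₀) := hx.comp hφ.tendsto_atTop
    have hγx : Tendsto (fun n => γ (x (φ n))) atTop (𝓝 (γ t₀)) :=
      (hγ.cont.tendsto t₀).comp hxφ
    have hv0 : (inner ℝ v (D t₀) : ℝ) = 0 := by
      refine inner_deriv_eq_zero ht₀ (hD t₀ ht₀).2 fun s hs => ?_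
      refine ge_of_tendsto (hlim.inner (tendsto_const_nhds.sub hγx)) (Eventually.of_forall ?_)
      exact fun n => (hV _ (hsubI (hxP (φ n)).2)).2 s hs
    have h1 : ∀ n, L ^ 2 * (inner ℝ (Complex.I * V (x (φ n))) (D t₀) : ℝ) ^ 2 ≤ L ^ 4 / 4 := by
      intro n
      have hmem := (hxP (φ n)).2
      rw [← inner_sq_of_inner_eq_zero (hV _ (hsubI hmem)).1 (hD _ hmem).1
        (inner_deriv_eq_zero hmem (hD _ hmem).2 (hV _ (hsubI hmem)).2)]
      exact (not_le.1 (hxP (φ n)).1).le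
    have h2 : Tendsto (fun n => L ^ 2 * (inner ℝ (Complex.I * V (x (φ n))) (D t₀) : ℝ) ^ 2) atTop
        (𝓝 (L ^ 2 * (inner ℝ (Complex.I * v) (D t₀) : ℝ) ^ 2)) :=
      (((tendsto_const_nhds.mul hlim).inner tendsto_const_nhds).pow 2).const_mul _
    have h3 := le_of_tendsto h2 (Eventually.of_forall h1)
    rw [← inner_sq_of_inner_eq_zero hv (hD t₀ ht₀).1 hv0, real_inner_self_eq_norm_sq,
      (hD t₀ ht₀).1] at h3
    have : 0 < L ^ 4 := by positivity
    nlinarith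
  obtain ⟨η, hη, hball⟩ := Metric.eventually_nhds_iff_ball.1
    (hev.and (Ioo_mem_nhds ht₀.1 ht₀.2))
  rw [Real.ball_eq_Ioo] at hball
  have hsub : Ioo (t₀ - η) (t₀ + η) ⊆ Ioo 0 1 := fun s hs => (hball s hs).2
  have hmem₀ : t₀ ∈ Ioo (t₀ - η) (t₀ + η) := ⟨by linarith, by linarith⟩
  have hder : ∀ s ∈ Ioo (0 : ℝ) 1,
      HasDerivAt (fun s => (inner ℝ (D t₀) (γ s) : ℝ)) (inner ℝ (D t₀) (D s)) s := fun s hs => by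
    simpa only [inner_zero_left, add_zero] using (hasDerivAt_const s (D t₀)).inner ℝ (hD s hs).2
  have hself : (inner ℝ (D t₀) (D t₀) : ℝ) = L ^ 2 := by
    rw [real_inner_self_eq_norm_sq, (hD t₀ ht₀).1]
  have hL4 : 0 < L ^ 2 := by positivity
  -- The derivative `⟪D t₀, D s⟫` omits the value `L ^ 2 / 4` and exceeds it at `t₀`.
  have hgt : ∀ s ∈ Ioo (t₀ - η) (t₀ + η), L ^ 2 / 4 < (inner ℝ (D t₀) (D s) : ℝ) := by
    have hne : ∀ s ∈ Ioo (t₀ - η) (t₀ + η), (inner ℝ (D t₀) (D s) : ℝ) ≠ L ^ 2 / 4 := by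
      intro s hs h
      have := (hball s hs).1
      rw [real_inner_comm, h] at this
      nlinarith
    rcases hasDerivWithinAt_forall_lt_or_forall_gt_of_forall_ne
      (f' := fun s => (inner ℝ (D t₀) (D s) : ℝ)) (m := L ^ 2 / 4) (convex_Ioo (t₀ - η) (t₀ + η))
      (fun s hs => (hder s (hsub hs)).hasDerivWithinAt) hne with h | h
    · have := h t₀ hmem₀
      rw [hself] at this
      linarith
    · exact h
  refine ⟨D t₀, fun h => ?_, L ^ 2 / 4, by positivity, η, hη, hsub, fun s hs s' hs' hss => ?_⟩
  · rw [h, inner_zero_left] at hself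
    linarith
  · refine (convex_Ioo (t₀ - η) (t₀ + η)).mul_sub_le_image_sub_of_le_deriv
      (f := fun s => (inner ℝ (D t₀) (γ s) : ℝ)) (fun s hs => ?_) (fun s hs => ?_) (fun s hs => ?_)
      s hs s' hs' hss
    · exact (hder s (hsub hs)).continuousAt.continuousWithinAt
    · rw [interior_Ioo] at hs
      exact (hder s (hsub hs)).differentiableAt.differentiableWithinAt
    · rw [interior_Ioo] at hs
      rw [(hder s (hsub hs)).deriv]
      exact (hgt s hs).le

end ACSigma

namespace ACSigma

open Filter Topology

/-! ### Functions which are Lipschitz along the arcs are absolutely continuous -/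

theorem LipschitzWith.eVariationOn_Icc_le {G : ℝ → ℂ} {K : NNReal} (hG : LipschitzWith K G)
    (a b : ℝ) : eVariationOn G (Icc a b) ≤ K * ENNReal.ofReal (b - a) := by
  have := (hG.lipschitzOnWith (s := Icc a b)).comp_eVariationOn_le (g := id) (s := Icc a b)
    (mapsTo_id _)
  rwa [eVariationOn_id_Icc] at this

/-- A Lipschitz function on the unit interval can be made locally constant at both ends, without
changing its values there, by subtracting a function of small variation. -/
theorem exists_small_correction {G : ℝ → ℂ} {K : NNReal} (hG : LipschitzWith K G) {ε : ℝ}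
    (hε : 0 < ε) : ∃ E : ℝ → ℂ, (∃ K', LipschitzWith K' E) ∧ E 0 = 0 ∧ E 1 = 0 ∧
      eVariationOn E (Icc 0 1) ≤ ENNReal.ofReal ε ∧
      ∃ δ > 0, (∀ t ∈ Icc 0 δ, E t = G t - G 0) ∧ ∀ t ∈ Icc (1 - δ) 1, E t = G t - G 1 := by
  set δ : ℝ := min (1 / 4) (ε / (4 * (K + 1))) with hδ
  have hδ0 : 0 < δ := lt_min (by norm_num) (by positivity)
  have hδ1 : δ ≤ 1 / 4 := min_le_left _ _
  have hδ2 : 4 * (K * δ) ≤ ε := by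
    have h1 : δ ≤ ε / (4 * (K + 1)) := min_le_right _ _
    rw [le_div_iff₀ (by positivity)] at h1
    nlinarith
  set a := G δ - G 0 with ha
  set b := G (1 - δ) - G 1 with hb
  have hna : ‖a‖ ≤ K * δ := by
    have := hG.dist_le_mul δ 0
    rwa [dist_eq_norm, Real.dist_eq, sub_zero, abs_of_pos hδ0] at this
  have hnb : ‖b‖ ≤ K * δ := by
    have := hG.dist_le_mul (1 - δ) 1
    rwa [dist_eq_norm, Real.dist_eq, show (1 - δ - 1 : ℝ) = -δ by ring, abs_neg,
      abs_of_pos hδ0] at this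
  -- On `[0, δ]` and on `[1 - δ, 1]` the terms `A` and `B` are the required ones up to constants,
  -- which the piecewise linear term `R` cancels.
  let A : ℝ → ℂ := fun t => G (min t δ) - G 0
  let B : ℝ → ℂ := fun t => G (max t (1 - δ)) - G 1
  let ρ : ℝ → ℝ := fun t => ramp (t / (1 - 2 * δ) + -(δ / (1 - 2 * δ)))
  let R : ℝ → ℂ := fun t => -b + (b - a) * (ρ t : ℂ)
  have hd : 0 < 1 - 2 * δ := by linarith
  have hρ0 : ∀ t ≤ δ, ρ t = 0 := fun t ht => by
    refine ramp_of_nonpos ?_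
    rw [← sub_eq_add_neg, ← sub_div]
    exact div_nonpos_of_nonpos_of_nonneg (by linarith) hd.le
  have hρ1 : ∀ t, 1 - δ ≤ t → ρ t = 1 := fun t ht => by
    refine ramp_of_one_le ?_
    rw [← sub_eq_add_neg, ← sub_div, le_div_iff₀ hd]
    linarith
  have hE0 : ∀ t ∈ Icc 0 δ, A t + B t + R t = G t - G 0 := fun t ht => by
    simp only [A, B, R, hρ0 t ht.2, min_eq_left ht.2,
      max_eq_right (by linarith [ht.2] : t ≤ 1 - δ), hb]
    push_cast
    ring
  have hE1 : ∀ t ∈ Icc (1 - δ) 1, A t + B t + R t = G t - G 1 := fun t ht => by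
    simp only [A, B, R, hρ1 t ht.1, max_eq_left ht.1,
      min_eq_right (by linarith [ht.1] : δ ≤ t), ha, hb]
    push_cast
    ring
  have hlin : LipschitzWith (‖b - a‖₊) fun y : ℝ => -b + (b - a) * (y : ℂ) :=
    LipschitzWith.of_dist_le_mul fun x y => by
      rw [dist_add_left, dist_eq_norm, ← mul_sub, norm_mul, ← Complex.ofReal_sub,
        Complex.norm_real, coe_nnnorm, Real.dist_eq, Real.norm_eq_abs]
  obtain ⟨Kρ, hKρ⟩ := exists_lipschitzWith_ramp_affine (1 - 2 * δ) (-(δ / (1 - 2 * δ)))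
  have hLA : LipschitzWith (K * 1) fun t => G (min t δ) :=
    hG.comp (LipschitzWith.id.min_const δ)
  have hLB : LipschitzWith (K * 1) fun t => G (max t (1 - δ)) :=
    hG.comp (LipschitzWith.id.max_const (1 - δ))
  have hLE : LipschitzWith _ fun t => A t + B t + R t :=
    ((hLA.sub (LipschitzWith.const (G 0))).add (hLB.sub (LipschitzWith.const (G 1)))).add
      (hlin.comp hKρ)
  have hvA : eVariationOn A (Icc 0 1) ≤ K * ENNReal.ofReal δ := by
    have h1 : eVariationOn (G ∘ fun t => min t δ) (Icc 0 1) ≤ eVariationOn G (Icc 0 δ) :=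
      eVariationOn.comp_le_of_monotoneOn G _ (fun x _ y _ h => min_le_min_right δ h)
        fun t ht => ⟨le_min ht.1 hδ0.le, min_le_right _ _⟩
    have h2 := LipschitzWith.eVariationOn_Icc_le hG 0 δ
    rw [sub_zero] at h2
    refine le_trans (eVariationOn_le_of_edist_le fun x _ y _ => ?_) (h1.trans h2)
    exact (edist_sub_right _ _ _).le
  have hvB : eVariationOn B (Icc 0 1) ≤ K * ENNReal.ofReal δ := by
    have h1 : eVariationOn (G ∘ fun t => max t (1 - δ)) (Icc 0 1) ≤
        eVariationOn G (Icc (1 - δ) 1) :=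
      eVariationOn.comp_le_of_monotoneOn G _ (fun x _ y _ h => max_le_max_right (1 - δ) h)
        fun t ht => ⟨le_max_right _ _, max_le ht.2 (by linarith)⟩
    have h2 := LipschitzWith.eVariationOn_Icc_le hG (1 - δ) 1
    rw [sub_sub_cancel] at h2
    refine le_trans (eVariationOn_le_of_edist_le fun x _ y _ => ?_) (h1.trans h2)
    exact (edist_sub_right _ _ _).le
  have hvR : eVariationOn R (Icc 0 1) ≤ (2 * K : NNReal) * ENNReal.ofReal δ := by
    have hmono : MonotoneOn ρ (Icc 0 1) := fun x _ y _ h => by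
      refine max_le_max_right _ (min_le_min_right _ (add_le_add_left ?_ _))
      exact div_le_div_of_nonneg_right h hd.le
    have h1 : eVariationOn ρ (Icc 0 1) ≤ 1 := by
      have := hmono.eVariationOn_eq (left_mem_Icc.2 zero_le_one) (right_mem_Icc.2 zero_le_one)
      rw [inter_self, hρ0 0 hδ0.le, hρ1 1 (by linarith)] at this
      simp [this]
    have h2 : eVariationOn R (Icc 0 1) ≤ ‖b - a‖₊ * eVariationOn ρ (Icc 0 1) :=
      hlin.lipschitzOnWith.comp_eVariationOn_le (mapsTo_univ _ _)
    refine h2.trans ((mul_le_mul_right h1 _).trans ?_)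
    rw [mul_one, ← ENNReal.ofReal_coe_nnreal, ← ENNReal.ofReal_coe_nnreal,
      ← ENNReal.ofReal_mul (by positivity)]
    refine ENNReal.ofReal_le_ofReal ?_
    push_cast
    have := norm_sub_le b a
    linarith
  refine ⟨fun t => A t + B t + R t, ⟨_, hLE⟩, ?_, ?_, ?_, δ, hδ0, hE0, hE1⟩
  · simpa using hE0 0 ⟨le_rfl, hδ0.le⟩
  · simpa using hE1 1 ⟨by linarith, le_rfl⟩
  · refine (eVariationOn_add_le _ _ _).trans ((add_le_add ((eVariationOn_add_le _ _ _).trans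
      (add_le_add hvA hvB)) hvR).trans ?_)
    have : (K : ℝ≥0∞) * ENNReal.ofReal δ + K * ENNReal.ofReal δ +
        (2 * K : NNReal) * ENNReal.ofReal δ = ENNReal.ofReal (4 * (K * δ)) := by
      rw [ENNReal.ofReal_mul (by norm_num), ENNReal.ofReal_mul (by positivity),
        ENNReal.ofReal_coe_nnreal]
      push_cast
      rw [show ENNReal.ofReal 4 = 4 by norm_num]
      ring
    rw [this]
    exact ENNReal.ofReal_le_ofReal hδ2

namespace ArcSystem

variable {σ : Set ℂ} {ι : Type*} (S : ArcSystem σ ι)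

/-- The function is Lipschitz in the parameter of each arc. -/
def IsLip (f : σ → ℂ) : Prop := ∀ j, ∃ K, LipschitzOnWith K (f ∘ S.c j) (Icc 0 1)

/-- A property holds near a point of `σ` if it holds near each parameter of this point: the arcs
are compact. -/
theorem eventually_nhds [Finite ι] {P : σ → Prop} {z : σ}
    (h : ∀ k, ∀ s ∈ Icc (0 : ℝ) 1, S.c k s = z → ∀ᶠ s' in 𝓝[Icc 0 1] s, P (S.c k s')) :
    ∀ᶠ w in 𝓝 z, P w := by
  have key : ∀ k, ∀ᶠ w in 𝓝 z, ∀ s ∈ Icc (0 : ℝ) 1, S.c k s = w → P w := by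
    intro k
    refine isCompact_Icc.induction_on (p := fun T => ∀ᶠ w in 𝓝 z, ∀ s ∈ T, S.c k s = w → P w)
      ?_ ?_ ?_ ?_
    · simp
    · intro T T' hTT' hT'
      filter_upwards [hT'] with w hw s hs using hw s (hTT' hs)
    · intro T T' hT hT'
      filter_upwards [hT, hT'] with w hw hw' s hs
      exact hs.elim (hw s) (hw' s)
    · intro s hs
      by_cases hsz : S.c k s = z
      · refine ⟨{s' | P (S.c k s')}, h k s hs hsz, Eventually.of_forall ?_⟩
        rintro w s' hs' rfl
        exact hs'
      · obtain ⟨U, V, hU, hV, hsU, hzV, hUV⟩ := t2_separation hsz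
        refine ⟨S.c k ⁻¹' U, mem_nhdsWithin_of_mem_nhds
          ((S.continuous k).continuousAt.preimage_mem_nhds (hU.mem_nhds hsU)), ?_⟩
        filter_upwards [hV.mem_nhds hzV] with w hw s' hs' hs'w
        exact absurd hw (disjoint_left.1 hUV (hs'w ▸ hs'))
  filter_upwards [eventually_all.2 key] with w hw
  obtain ⟨k, s, hs, rfl⟩ := S.cover w
  exact hw k s hs rfl

theorem eq_endpoint {j k : ι} {s t : ℝ} (hs : s ∈ Icc (0 : ℝ) 1) (ht : t ∈ Icc (0 : ℝ) 1)
    (h : S.c k s = S.c j t) (h01 : t = 0 ∨ t = 1) : s = 0 ∨ s = 1 := by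
  by_cases hkj : k = j
  · subst hkj
    rw [S.injOn k hs ht h]
    exact h01
  · exact (S.inter hkj hs ht h).1

/-- Functions on the arcs with the same values as a given function at the endpoints fit together. -/
theorem exists_glue (f : σ → ℂ) (G : ι → ℝ → ℂ) (h0 : ∀ j, G j 0 = f (S.c j 0))
    (h1 : ∀ j, G j 1 = f (S.c j 1)) :
    ∃ g : σ → ℂ, ∀ j, ∀ t ∈ Icc (0 : ℝ) 1, g (S.c j t) = G j t := by
  choose J T hT hJT using S.cover
  refine ⟨fun z => G (J z) (T z), fun j t ht => ?_⟩
  have hz := hJT (S.c j t)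
  have hend : ∀ k, ∀ s : ℝ, s = 0 ∨ s = 1 → G k s = f (S.c k s) := by
    rintro k s (rfl | rfl)
    · exact h0 k
    · exact h1 k
  by_cases hj : J (S.c j t) = j
  · have : T (S.c j t) = t := by
      refine S.injOn j (hT _) ht ?_
      rw [hj] at hz
      exact hz
    simp only [this, hj]
  · obtain ⟨e1, e2⟩ := S.inter hj (hT _) ht hz
    change G (J (S.c j t)) (T (S.c j t)) = G j t
    rw [hend _ _ e1, hend _ _ e2, hz]

/-- A function which is Lipschitz along the arcs is close to one which is moreover constant near
the endpoints of the arcs. -/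
theorem exists_isLip_approx [Fintype ι] {f : σ → ℂ} (hf : S.IsLip f) {ε : ℝ} (hε : 0 < ε) :
    ∃ g : σ → ℂ, S.IsLip g ∧ bvNorm (f - g) < ENNReal.ofReal ε ∧
      ∀ j, ∀ t : ℝ, t = 0 ∨ t = 1 →
        ∀ᶠ s in 𝓝[Icc 0 1] t, g (S.c j s) = g (S.c j t) := by
  obtain ⟨C, hC, hbv⟩ := S.exists_bvNorm_le
  set M : ℝ := 2 * Fintype.card ι * C.toReal + 1 with hM
  have hM0 : 0 < M := by positivity
  have hstep : ∀ j, ∃ G E : ℝ → ℂ, (∀ t ∈ Icc (0 : ℝ) 1, f (S.c j t) = G t) ∧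
      (∃ K', LipschitzWith K' E) ∧ E 0 = 0 ∧ E 1 = 0 ∧
      eVariationOn E (Icc 0 1) ≤ ENNReal.ofReal (ε / M) ∧
      ∃ δ > 0, (∀ t ∈ Icc 0 δ, E t = G t - G 0) ∧ ∀ t ∈ Icc (1 - δ) 1, E t = G t - G 1 := by
    intro j
    obtain ⟨K, hK⟩ := hf j
    obtain ⟨G, hG, hfG⟩ := hK.extend_finite_dimension
    obtain ⟨E, hE⟩ := exists_small_correction hG (div_pos hε hM0)
    exact ⟨G, E, fun t ht => hfG ht, hE⟩
  choose G E hfG hELip hE0 hE1 hEvar δ hδ hEδ hEδ' using hstep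
  obtain ⟨e, he⟩ := S.exists_glue (fun _ => 0) E hE0 hE1
  have h0 : (0 : ℝ) ∈ Icc (0 : ℝ) 1 := by simp
  have h1 : (1 : ℝ) ∈ Icc (0 : ℝ) 1 := by simp
  have heqOn : ∀ j, EqOn (e ∘ S.c j) (E j) (Icc 0 1) := fun j t ht => he j t ht
  -- The corrections vanish at the endpoints, so they fit together to a function `e` on `σ`, of
  -- small norm.
  refine ⟨f - e, fun j => ?_, ?_, ?_⟩
  · obtain ⟨K, hK⟩ := hf j
    obtain ⟨K', hK'⟩ := hELip j
    refine ⟨K + K', LipschitzOnWith.of_dist_le_mul fun x hx y hy => ?_⟩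
    simp only [Function.comp_apply, Pi.sub_apply, he j x hx, he j y hy]
    have h2 := hK.dist_le_mul x hx y hy
    have h3 := hK'.dist_le_mul x y
    refine (dist_sub_sub_le _ _ _ _).trans ?_
    push_cast
    simp only [Function.comp_apply] at h2
    linarith
  · rw [sub_sub_cancel]
    have hvar : ∑ j, eVariationOn (e ∘ S.c j) (Icc 0 1) ≤
        Fintype.card ι * ENNReal.ofReal (ε / M) := by
      refine (Finset.sum_le_sum fun j _ => (le_of_eq (eVariationOn.congr (heqOn j))).trans
        (hEvar j)).trans (le_of_eq ?_)
      rw [Finset.sum_const, Finset.card_univ, nsmul_eq_mul]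
    have hsup : supNorm e ≤ ∑ j, eVariationOn (e ∘ S.c j) (Icc 0 1) := by
      refine iSup_le fun z => ?_
      obtain ⟨j, t, ht, rfl⟩ := S.cover z
      refine le_trans ?_ (Finset.single_le_sum
        (f := fun j => eVariationOn (e ∘ S.c j) (Icc 0 1)) (fun _ _ => zero_le)
        (Finset.mem_univ j))
      have := eVariationOn.edist_le (e ∘ S.c j) ht h0
      rwa [Function.comp_apply, Function.comp_apply, he j 0 h0, hE0, edist_zero_right] at this
    refine (hbv e).trans_lt ?_
    have h2 : S.arcNorm e ≤ 2 * (Fintype.card ι * ENNReal.ofReal (ε / M)) := by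
      rw [two_mul]
      exact add_le_add (hsup.trans hvar) hvar
    refine (mul_le_mul_right h2 C).trans_lt ?_
    have h3 : C * (2 * (Fintype.card ι * ENNReal.ofReal (ε / M))) =
        ENNReal.ofReal (C.toReal * (2 * (Fintype.card ι * (ε / M)))) := by
      rw [ENNReal.ofReal_mul ENNReal.toReal_nonneg, ENNReal.ofReal_toReal hC,
        ENNReal.ofReal_mul two_pos.le, ENNReal.ofReal_mul (Nat.cast_nonneg _),
        ENNReal.ofReal_natCast]
      norm_num
    rw [h3, ENNReal.ofReal_lt_ofReal_iff hε]
    have h4 : C.toReal * (2 * (Fintype.card ι * (ε / M))) = ε * ((M - 1) / M) := by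
      rw [hM]
      ring
    rw [h4]
    refine mul_lt_of_lt_one_right hε ?_
    rw [div_lt_one hM0]
    linarith
  · rintro j t (rfl | rfl)
    · filter_upwards [self_mem_nhdsWithin,
        mem_nhdsWithin_of_mem_nhds (Iio_mem_nhds (hδ j))] with s hs hs'
      rw [Pi.sub_apply, Pi.sub_apply, he j s hs, he j 0 h0, hEδ j s ⟨hs.1, (mem_Iio.1 hs').le⟩,
        hE0, hfG j s hs, hfG j 0 h0]
      ring
    · filter_upwards [self_mem_nhdsWithin, mem_nhdsWithin_of_mem_nhds
        (Ioi_mem_nhds (sub_lt_self 1 (hδ j)))] with s hs hs'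
      rw [Pi.sub_apply, Pi.sub_apply, he j s hs, he j 1 h1, hEδ' j s ⟨(mem_Ioi.1 hs').le, hs.2⟩,
        hE1, hfG j s hs, hfG j 1 h1]
      ring

/-- Near an interior point of an arc, a function which is Lipschitz along the arc is a Lipschitz
function of one real coordinate. -/
theorem exists_local_coordinate [Finite ι] {g : σ → ℂ} (hg : S.IsLip g) {j : ι} {t : ℝ}
    (ht : t ∈ Ioo (0 : ℝ) 1) : ∃ v : ℂ, v ≠ 0 ∧ ∃ (u : ℝ → ℂ) (K : NNReal), LipschitzWith K u ∧
      ∀ᶠ w in 𝓝 (S.c j t), g w = u (inner ℝ v (w : ℂ)) := by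
  obtain ⟨L, hL, hd⟩ := S.deriv j
  obtain ⟨v, hv, m, hm, η, hη, hsub, hmono⟩ := (S.convex j).exists_inner_ge hL hd ht
  obtain ⟨K, hK⟩ := hg j
  set B := Ioo (t - η) (t + η) with hB
  let φ : ℝ → ℝ := fun s => inner ℝ v (S.c j s : ℂ)
  have hdist : ∀ s ∈ B, ∀ s' ∈ B, m * |s - s'| ≤ |φ s - φ s'| := by
    intro s hs s' hs'
    rcases le_total s s' with h | h
    · have := hmono s hs s' hs' h
      rw [abs_sub_comm, abs_of_nonneg (sub_nonneg.2 h), abs_sub_comm]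
      exact this.trans (le_abs_self _)
    · have := hmono s' hs' s hs h
      rw [abs_of_nonneg (sub_nonneg.2 h)]
      exact this.trans (le_abs_self _)
  have hinj : InjOn φ B := by
    intro s hs s' hs' h
    have := hdist s hs s' hs'
    rw [h, sub_self, abs_zero] at this
    have h0 : |s - s'| ≤ 0 := by
      by_contra! hcon
      nlinarith [mul_pos hm hcon]
    exact sub_eq_zero.1 (abs_nonpos_iff.1 h0)
  -- Along the arc, the function of the coordinate is `g ∘ c j` composed with the inverse of `φ`; it
  -- is extended to the real line.
  have hinv := hinj.leftInvOn_invFunOn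
  have hlip : LipschitzOnWith (K / m).toNNReal
      (fun y => g (S.c j (Function.invFunOn φ B y))) (φ '' B) := by
    refine LipschitzOnWith.of_dist_le_mul ?_
    rintro _ ⟨s, hs, rfl⟩ _ ⟨s', hs', rfl⟩
    rw [hinv hs, hinv hs', Real.coe_toNNReal _ (by positivity), Real.dist_eq]
    have h1 := hK.dist_le_mul s (Ioo_subset_Icc_self (hsub hs)) s' (Ioo_subset_Icc_self (hsub hs'))
    rw [Real.dist_eq] at h1
    refine h1.trans ?_
    rw [div_mul_eq_mul_div, le_div_iff₀ hm, mul_assoc, mul_comm _ m]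
    exact mul_le_mul_of_nonneg_left (hdist s hs s' hs') K.2
  obtain ⟨u, hu, hgu⟩ := hlip.extend_finite_dimension
  refine ⟨v, hv, u, _, hu, S.eventually_nhds ?_⟩
  intro k s hs hks
  -- Only the arc itself passes through its interior points.
  have hkj : k = j := by
    by_contra hne
    rcases (S.inter hne hs (Ioo_subset_Icc_self ht) hks).2 with h | h
    · exact ht.1.ne' h
    · exact ht.2.ne h
  subst hkj
  have hst : s = t := S.injOn k hs (Ioo_subset_Icc_self ht) hks
  subst hst
  filter_upwards [mem_nhdsWithin_of_mem_nhds
    (Ioo_mem_nhds (sub_lt_self s hη) (lt_add_of_pos_right s hη))] with s' hs'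
  have := hgu (mem_image_of_mem φ hs')
  simp only [hinv hs'] at this
  exact this

/-- Functions which are Lipschitz along the arcs are absolutely continuous. -/
theorem IsLip.mem_acFunctions [Fintype ι] (hσ : IsCompact σ) {f : σ → ℂ} (hf : S.IsLip f) :
    f ∈ acFunctions σ := by
  refine mem_acFunctions_of_approx fun ε hε => ?_
  obtain ⟨g, hg, hfg, hend⟩ := S.exists_isLip_approx hf hε
  refine ⟨g, mem_acFunctions_of_local hσ fun z => ?_, hfg⟩
  obtain ⟨j, t, ht, rfl⟩ := S.cover z
  by_cases h01 : t = 0 ∨ t = 1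
  · refine ⟨fun _ => g (S.c j t), const_mem_acFunctions _, S.eventually_nhds ?_⟩
    intro k s hs hks
    filter_upwards [hend k s (S.eq_endpoint hs ht hks h01)] with s' hs'
    rw [hs', hks]
  · push Not at h01
    obtain ⟨v, hv, u, K, hu, hloc⟩ := S.exists_local_coordinate hg (j := j)
      (t := t) ⟨lt_of_le_of_ne ht.1 (Ne.symm h01.1), lt_of_le_of_ne ht.2 h01.2⟩
    exact ⟨_, comp_inner_mem_acFunctions hσ.isBounded hu hv, hloc⟩

/-- Polynomials are Lipschitz along the arcs. -/
theorem isLip_of_mem_polyFunctions {f : σ → ℂ} (hf : f ∈ polyFunctions σ) : S.IsLip f := by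
  intro j
  obtain ⟨P, rfl⟩ := hf
  obtain ⟨K, hK⟩ := S.lip j
  have hbdd : ∀ {h : ℝ → ℂ} {K : NNReal}, LipschitzOnWith K h (Icc 0 1) →
      ∃ C : NNReal, ∀ t ∈ Icc (0 : ℝ) 1, ‖h t‖ ≤ C := fun {h K} hh => by
    obtain ⟨C, hC⟩ := isCompact_Icc.exists_bound_of_continuousOn hh.continuousOn
    exact ⟨C.toNNReal, fun t ht => (hC t ht).trans (Real.le_coe_toNNReal C)⟩
  induction P using MvPolynomial.induction_on with
  | C a =>
    refine ⟨0, LipschitzOnWith.of_dist_le_mul fun x _ y _ => ?_⟩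
    simp
  | add p q hp hq =>
    obtain ⟨K₁, h₁⟩ := hp
    obtain ⟨K₂, h₂⟩ := hq
    refine ⟨K₁ + K₂, LipschitzOnWith.of_dist_le_mul fun x hx y hy => ?_⟩
    have e1 := h₁.dist_le_mul x hx y hy
    have e2 := h₂.dist_le_mul x hx y hy
    simp only [Function.comp_apply, RingHom.coe_coe, AlgHom.toRingHom_eq_coe] at e1 e2 ⊢
    rw [map_add, Pi.add_apply, Pi.add_apply]
    refine (dist_add_add_le _ _ _ _).trans ?_
    push_cast
    linarith
  | mul_X p i hp =>
    obtain ⟨K₁, h₁⟩ := hp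
    have hX : LipschitzOnWith K ((MvPolynomial.aeval ![fun z : σ => ((z : ℂ).re : ℂ),
        fun z : σ => ((z : ℂ).im : ℂ)] (MvPolynomial.X i : MvPolynomial (Fin 2) ℂ)) ∘ S.c j)
        (Icc 0 1) := by
      refine LipschitzOnWith.of_dist_le_mul fun x hx y hy => ?_
      refine le_trans ?_ (hK.dist_le_mul x hx y hy)
      rw [MvPolynomial.aeval_X, Complex.dist_eq, Complex.dist_eq]
      fin_cases i
      · simp only [Function.comp_apply, Fin.zero_eta, Matrix.cons_val_zero]
        rw [← Complex.ofReal_sub, Complex.norm_real, ← Complex.sub_re]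
        exact Complex.abs_re_le_norm _
      · simp only [Function.comp_apply, Fin.mk_one, Matrix.cons_val_one,
          Matrix.cons_val_zero]
        rw [← Complex.ofReal_sub, Complex.norm_real, ← Complex.sub_im]
        exact Complex.abs_im_le_norm _
    obtain ⟨C₁, hC₁⟩ := hbdd h₁
    obtain ⟨C₂, hC₂⟩ := hbdd hX
    refine ⟨C₁ * K + C₂ * K₁, LipschitzOnWith.of_dist_le_mul fun x hx y hy => ?_⟩
    have e1 := h₁.dist_le_mul x hx y hy
    have e2 := hX.dist_le_mul x hx y hy
    have b1 := hC₁ x hx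
    have b2 := hC₂ y hy
    simp only [Function.comp_apply, RingHom.coe_coe, AlgHom.toRingHom_eq_coe] at e1 e2 b1 b2 ⊢
    rw [map_mul, Pi.mul_apply, Pi.mul_apply]
    rw [dist_eq_norm] at e1 e2 ⊢
    set p1 := (MvPolynomial.aeval ![fun z : σ => ((z : ℂ).re : ℂ),
      fun z : σ => ((z : ℂ).im : ℂ)]) p (S.c j x)
    set p2 := (MvPolynomial.aeval ![fun z : σ => ((z : ℂ).re : ℂ),
      fun z : σ => ((z : ℂ).im : ℂ)]) p (S.c j y)
    set q1 := (MvPolynomial.aeval ![fun z : σ => ((z : ℂ).re : ℂ), fun z : σ => ((z : ℂ).im : ℂ)])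
      (MvPolynomial.X i : MvPolynomial (Fin 2) ℂ) (S.c j x)
    set q2 := (MvPolynomial.aeval ![fun z : σ => ((z : ℂ).re : ℂ), fun z : σ => ((z : ℂ).im : ℂ)])
      (MvPolynomial.X i : MvPolynomial (Fin 2) ℂ) (S.c j y)
    have e3 : p1 * q1 - p2 * q2 = p1 * (q1 - q2) + q2 * (p1 - p2) := by ring
    rw [e3]
    refine (norm_add_le _ _).trans ?_
    rw [norm_mul, norm_mul]
    push_cast
    have f1 := mul_le_mul b1 e2 (norm_nonneg _) C₁.2
    have f2 := mul_le_mul b2 e1 (norm_nonneg _) C₂.2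
    have f3 : (C₁ : ℝ) * (K * dist x y) + C₂ * (K₁ * dist x y) =
      (C₁ * K + C₂ * K₁) * dist x y := by ring
    rw [← f3]
    exact add_le_add f1 f2

end ArcSystem

end ACSigma

namespace ACSigma

open Filter Topology

/-! ### Characters of `AC(σ)` are point evaluations -/

variable {σ τ : Set ℂ}

theorem continuous_of_mem_polyFunctions {f : σ → ℂ} (hf : f ∈ polyFunctions σ) : Continuous f := by
  obtain ⟨P, rfl⟩ := hf
  induction P using MvPolynomial.induction_on with
  | C a =>
    simp only [AlgHom.toRingHom_eq_coe, RingHom.coe_coe, MvPolynomial.algHom_C]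
    exact continuous_const
  | add p q hp hq =>
    simp only [AlgHom.toRingHom_eq_coe, RingHom.coe_coe, map_add] at hp hq ⊢
    exact hp.add hq
  | mul_X p i hp =>
    simp only [AlgHom.toRingHom_eq_coe, RingHom.coe_coe, map_mul, MvPolynomial.aeval_X] at hp ⊢
    refine hp.mul ?_
    fin_cases i
    · exact Complex.continuous_ofReal.comp (Complex.continuous_re.comp continuous_subtype_val)
    · exact Complex.continuous_ofReal.comp (Complex.continuous_im.comp continuous_subtype_val)

theorem continuous_of_mem_acFunctions {f : σ → ℂ} (hf : f ∈ acFunctions σ) : Continuous f := by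
  refine continuous_of_uniform_approx_of_continuous fun u hu => ?_
  obtain ⟨ε, hε, hεu⟩ := Metric.mem_uniformity_dist.1 hu
  obtain ⟨g, hg, hfg⟩ := exists_poly_of_mem hf hε
  refine ⟨g, continuous_of_mem_polyFunctions hg, fun z => hεu ?_⟩
  have h1 := ((enorm_le_supNorm (f - g) z).trans le_self_add).trans_lt hfg
  rw [Pi.sub_apply, ← ofReal_norm, ENNReal.ofReal_lt_ofReal_iff hε] at h1
  rwa [dist_eq_norm]

theorem norm_apply_le (F : BV σ) (z : σ) : ‖BV.toFun σ F z‖ ≤ ‖F‖ := by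
  rw [BV.norm_def, ← toReal_enorm]
  exact ENNReal.toReal_mono (BV.bvNorm_lt_top F).ne ((enorm_le_supNorm _ z).trans le_self_add)

/-- The powers of a function of supremum norm `q` have variation at most `n q ^ (n - 1)` times that
of the function. -/
theorem var_pow_le (h : σ → ℂ) (n : ℕ) :
    supNorm (h ^ (n + 1)) ≤ supNorm h ^ (n + 1) ∧
      var (h ^ (n + 1)) ≤ (n + 1 : ℕ) * supNorm h ^ n * var h := by
  induction n with
  | zero => simp
  | succ n ih =>
    have e : h ^ (n + 1 + 1) = h ^ (n + 1) * h := pow_succ h (n + 1)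
    constructor
    · rw [e, pow_succ (supNorm h) (n + 1)]
      exact (supNorm_mul _ _).trans (mul_le_mul_left ih.1 _)
    · rw [e]
      refine (var_mul _ _).trans ((add_le_add (mul_le_mul_left ih.1 _)
        (mul_le_mul_right ih.2 _)).trans (le_of_eq ?_))
      push_cast
      ring

/-- If `h` has supremum norm less than one, then its powers tend to zero in the variation norm. -/
theorem tendsto_norm_pow (F : BV σ) {q : ℝ} (hq : q < 1)
    (hF : ∀ z, ‖BV.toFun σ F z‖ ≤ q) : Tendsto (fun n : ℕ => ‖F ^ (n + 1)‖) atTop (𝓝 0) := by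
  rcases isEmpty_or_nonempty σ with hemp | ⟨⟨z₀⟩⟩
  · have : ∀ G : BV σ, G = 0 := fun G => BV.toFun_injective (Subsingleton.elim _ _)
    simp [this F]
  have hq0 : 0 ≤ q := (norm_nonneg _).trans (hF z₀)
  set V := (var (BV.toFun σ F)).toReal
  have hV : var (BV.toFun σ F) ≠ ∞ := (le_add_self.trans_lt (BV.bvNorm_lt_top F)).ne
  have hs : supNorm (BV.toFun σ F) ≤ ENNReal.ofReal q := iSup_le fun z => by
    rw [← ofReal_norm]
    exact ENNReal.ofReal_le_ofReal (hF z)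
  have hbound : ∀ n : ℕ, ‖F ^ (n + 1)‖ ≤ q * q ^ n + (n * q ^ n * V + q ^ n * V) := by
    intro n
    rw [BV.norm_def]
    refine ENNReal.toReal_le_of_le_ofReal (by positivity) ?_
    rw [map_pow]
    obtain ⟨h1, h2⟩ := var_pow_le (BV.toFun σ F) n
    have e1 : supNorm (BV.toFun σ F ^ (n + 1)) ≤ ENNReal.ofReal (q * q ^ n) := by
      rw [← pow_succ', ENNReal.ofReal_pow hq0]
      exact h1.trans (pow_le_pow_left' hs _)
    have e2 : var (BV.toFun σ F ^ (n + 1)) ≤ ENNReal.ofReal (n * q ^ n * V + q ^ n * V) := by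
      refine h2.trans ((mul_le_mul_left (mul_le_mul_right (pow_le_pow_left' hs n) _) _).trans
        (le_of_eq ?_))
      rw [← add_mul, ← add_one_mul, ENNReal.ofReal_mul (by positivity),
        ENNReal.ofReal_mul (by positivity), ENNReal.ofReal_toReal hV, ENNReal.ofReal_pow hq0,
        ← Nat.cast_add_one, ENNReal.ofReal_natCast]
    rw [ENNReal.ofReal_add (by positivity) (by positivity)]
    exact add_le_add e1 e2
  refine squeeze_zero (fun _ => norm_nonneg _) hbound ?_
  have t1 := tendsto_pow_atTop_nhds_zero_of_lt_one hq0 hq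
  have t2 := tendsto_self_mul_const_pow_of_lt_one hq0 hq
  have := (t1.const_mul q).add ((t2.mul_const V).add (t1.mul_const V))
  simpa using this

/-- The element of `AC(σ)` given by an absolutely continuous function. -/
theorem exists_ac_eq {f : σ → ℂ} (hf : f ∈ acFunctions σ) :
    ∃ F : AC σ, BV.toFun σ F = f := by
  obtain ⟨F, hF, rfl⟩ := hf
  exact ⟨⟨F, hF⟩, rfl⟩

theorem toFun_mem_acFunctions (F : AC σ) : BV.toFun σ F ∈ acFunctions σ := ⟨F, F.2, rfl⟩

theorem ac_ext {F G : AC σ} (h : BV.toFun σ F = BV.toFun σ G) : F = G :=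
  Subtype.ext (BV.toFun_injective h)

/-- The evaluation of the functions in `AC(σ)` at a point. -/
noncomputable def evalAC (z : σ) : AC σ →ₐ[ℂ] ℂ :=
  (Pi.evalAlgHom ℂ (fun _ : σ => ℂ) z).comp ((BV.toFun σ).comp (AC σ).val)

theorem evalAC_apply (z : σ) (F : AC σ) : evalAC z F = BV.toFun σ F z := rfl

theorem continuous_evalAC (z : σ) : Continuous (evalAC z) :=
  AddMonoidHomClass.continuous_of_bound (evalAC z) 1 fun F => by
    rw [one_mul]
    exact norm_apply_le _ z

theorem algHom_quadratic {A : Type*} [CommRing A] [Algebra ℂ A] (χ : A →ₐ[ℂ] ℂ) (x y : A)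
    (a a' b b' : ℂ) :
    χ ((x - algebraMap ℂ A a) * (x - algebraMap ℂ A a') +
      (y - algebraMap ℂ A b) * (y - algebraMap ℂ A b')) =
    (χ x - a) * (χ x - a') + (χ y - b) * (χ y - b') := by
  simp

theorem algHom_one_sub {A : Type*} [CommRing A] [Algebra ℂ A] (χ : A →ₐ[ℂ] ℂ) (x : A) (c : ℂ) :
    χ (1 - algebraMap ℂ A c * x) = 1 - c * χ x := by
  simp

/-- A continuous character of `AC(σ)` is a point evaluation. If `a` and `b` are the values of the
character at the two coordinates, then `|x - a|² + |y - b|²` lies in its kernel; if this function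
had no zero on `σ`, then after rescaling the powers of its difference from `1` would tend to zero,
while the character takes the value `1` at each of them. -/
theorem exists_eq_evalAC (hσ : IsCompact σ) (hne : σ.Nonempty) (χ : AC σ →ₐ[ℂ] ℂ)
    (hχ : Continuous χ) : ∃ z : σ, χ = evalAC z := by
  have hpoly := polyFunctions_le_acFunctions hσ.isBounded
  have hcoord : ∀ i : Fin 2, (![fun z : σ => ((z : ℂ).re : ℂ), fun z : σ => ((z : ℂ).im : ℂ)]) i ∈
      polyFunctions σ := fun i => ⟨MvPolynomial.X i, MvPolynomial.aeval_X _ i⟩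
  choose X hX using fun i => exists_ac_eq (hpoly (hcoord i))
  have hX0 : ∀ z : σ, BV.toFun σ (X 0) z = ((z : ℂ).re : ℂ) := fun z => by rw [hX 0]; rfl
  have hX1 : ∀ z : σ, BV.toFun σ (X 1) z = ((z : ℂ).im : ℂ) := fun z => by rw [hX 1]; rfl
  set a := χ (X 0)
  set b := χ (X 1)
  have hzero : ∃ z : σ, Complex.normSq (((z : ℂ).re : ℂ) - a) +
      Complex.normSq (((z : ℂ).im : ℂ) - b) = 0 := by
    by_contra! hcon
    let ev : σ → ℝ := fun z => Complex.normSq (((z : ℂ).re : ℂ) - a) +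
      Complex.normSq (((z : ℂ).im : ℂ) - b)
    have hevc : Continuous ev := by
      have h1 : Continuous fun z : σ => ((z : ℂ).re : ℂ) :=
        Complex.continuous_ofReal.comp (Complex.continuous_re.comp continuous_subtype_val)
      have h2 : Continuous fun z : σ => ((z : ℂ).im : ℂ) :=
        Complex.continuous_ofReal.comp (Complex.continuous_im.comp continuous_subtype_val)
      exact (Complex.continuous_normSq.comp (h1.sub continuous_const)).add
        (Complex.continuous_normSq.comp (h2.sub continuous_const))
    have hpos : ∀ z, 0 < ev z := fun z =>
      lt_of_le_of_ne (add_nonneg (Complex.normSq_nonneg _) (Complex.normSq_nonneg _))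
        (Ne.symm (hcon z))
    have : CompactSpace σ := isCompact_iff_compactSpace.1 hσ
    have : Nonempty σ := hne.to_subtype
    obtain ⟨z₁, -, hmin⟩ := isCompact_univ.exists_isMinOn univ_nonempty hevc.continuousOn
    obtain ⟨z₂, -, hmax⟩ := isCompact_univ.exists_isMaxOn univ_nonempty hevc.continuousOn
    have hmin : ∀ z, ev z₁ ≤ ev z := fun z => hmin (mem_univ z)
    have hmax : ∀ z, ev z ≤ ev z₂ := fun z => hmax (mem_univ z)
    set m := ev z₂
    have hm : 0 < m := hpos z₂
    let G : AC σ := (X 0 - algebraMap ℂ _ a) * (X 0 - algebraMap ℂ _ (starRingEnd ℂ a)) +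
      (X 1 - algebraMap ℂ _ b) * (X 1 - algebraMap ℂ _ (starRingEnd ℂ b))
    have hGχ : χ G = 0 := by
      rw [algHom_quadratic, sub_self, zero_mul, sub_self, zero_mul, add_zero]
    have hGz : ∀ z, evalAC z G = (ev z : ℂ) := fun z => by
      rw [algHom_quadratic, evalAC_apply, evalAC_apply, hX0, hX1]
      simp only [ev, Complex.ofReal_add, ← Complex.mul_conj, map_sub, Complex.conj_ofReal]
    -- The values of `H` lie in `[0, 1 - ev z₁ / m]`.
    let H : AC σ := 1 - algebraMap ℂ _ ((m : ℂ)⁻¹) * G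
    have hHχ : χ H = 1 := by
      rw [algHom_one_sub, hGχ, mul_zero, sub_zero]
    have hHz : ∀ z, evalAC z H = ((1 - ev z / m : ℝ) : ℂ) := fun z => by
      rw [algHom_one_sub, hGz]
      push_cast
      ring
    have hHle : ∀ z, ‖BV.toFun σ (H : BV σ) z‖ ≤ 1 - ev z₁ / m := fun z => by
      rw [← evalAC_apply, hHz, Complex.norm_real, Real.norm_eq_abs, abs_of_nonneg]
      · have := div_le_div_of_nonneg_right (hmin z) hm.le
        linarith
      · have := div_le_one_of_le₀ (hmax z) hm.le
        linarith
    have htend := tendsto_norm_pow (H : BV σ)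
      (by linarith [div_pos (hpos z₁) hm] : 1 - ev z₁ / m < 1) hHle
    have htend' : Tendsto (fun n : ℕ => H ^ (n + 1)) atTop (𝓝 0) :=
      tendsto_zero_iff_norm_tendsto_zero.2 htend
    have h1 := (hχ.tendsto 0).comp htend'
    have h2 : (χ ∘ fun n : ℕ => H ^ (n + 1)) = fun _ => 1 := by
      ext n
      simp [hHχ]
    rw [h2, map_zero] at h1
    exact one_ne_zero (tendsto_nhds_unique tendsto_const_nhds h1)
  obtain ⟨z, hz⟩ := hzero
  obtain ⟨h0, h1⟩ := (add_eq_zero_iff_of_nonneg (Complex.normSq_nonneg _)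
    (Complex.normSq_nonneg _)).1 hz
  rw [Complex.normSq_eq_zero, sub_eq_zero] at h0 h1
  refine ⟨z, ?_⟩
  have hagree : ∀ P : MvPolynomial (Fin 2) ℂ,
      χ (MvPolynomial.aeval X P) = evalAC z (MvPolynomial.aeval X P) := by
    intro P
    have : χ.comp (MvPolynomial.aeval X) = (evalAC z).comp (MvPolynomial.aeval X) := by
      refine MvPolynomial.algHom_ext fun i => ?_
      simp only [AlgHom.comp_apply, MvPolynomial.aeval_X]
      fin_cases i
      · exact h0.symm.trans (hX0 z).symm
      · exact h1.symm.trans (hX1 z).symm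
    exact DFunLike.congr_fun this P
  -- Both characters are continuous and agree on the polynomials, which are dense.
  have hdense : DenseRange (MvPolynomial.aeval X : MvPolynomial (Fin 2) ℂ →ₐ[ℂ] AC σ) := by
    intro F
    rw [Metric.mem_closure_iff]
    intro ε hε
    obtain ⟨_, ⟨P, rfl⟩, hP⟩ := exists_poly_of_mem (toFun_mem_acFunctions F) hε
    refine ⟨_, ⟨P, rfl⟩, ?_⟩
    rw [Subtype.dist_eq, dist_eq_norm, BV.norm_sub_lt_iff]
    have : BV.toFun σ (MvPolynomial.aeval X P : AC σ) =
        MvPolynomial.aeval ![fun z : σ => ((z : ℂ).re : ℂ), fun z : σ => ((z : ℂ).im : ℂ)] P := by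
      have : ((BV.toFun σ).comp (AC σ).val).comp (MvPolynomial.aeval X) =
          MvPolynomial.aeval ![fun z : σ => ((z : ℂ).re : ℂ), fun z : σ => ((z : ℂ).im : ℂ)] := by
        refine MvPolynomial.algHom_ext fun i => ?_
        simp only [AlgHom.comp_apply, MvPolynomial.aeval_X]
        exact hX i
      exact DFunLike.congr_fun this P
    rw [this]
    exact hP
  have := hdense.equalizer hχ (continuous_evalAC z) (funext hagree)
  exact DFunLike.coe_injective this

theorem eq_of_forall_evalAC_eq (hσ : IsCompact σ) {z w : σ}
    (h : ∀ F : AC σ, evalAC z F = evalAC w F) : z = w := by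
  have hpoly := polyFunctions_le_acFunctions hσ.isBounded
  have hv : ∀ v : ℂ, (inner ℝ v (z : ℂ) : ℝ) = inner ℝ v (w : ℂ) := fun v => by
    obtain ⟨F, hF⟩ := exists_ac_eq (hpoly (inner_mem_polyFunctions (σ := σ) v))
    have := h F
    rw [evalAC_apply, evalAC_apply, hF] at this
    exact Complex.ofReal_injective this
  exact Subtype.ext (ext_inner_left ℝ hv)

theorem continuous_of_evalAC (hτ : IsCompact τ) {ψ : σ → τ} {Ψ : AC τ → AC σ}
    (h : ∀ z F, evalAC z (Ψ F) = evalAC (ψ z) F) : Continuous ψ := by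
  have hpoly := polyFunctions_le_acFunctions hτ.isBounded
  have hv : ∀ v : ℂ, Continuous fun z => (inner ℝ v (ψ z : ℂ) : ℝ) := fun v => by
    obtain ⟨F, hF⟩ := exists_ac_eq (hpoly (inner_mem_polyFunctions (σ := τ) v))
    have h1 := Complex.continuous_re.comp (continuous_of_mem_acFunctions
      (toFun_mem_acFunctions (Ψ F)))
    refine h1.congr fun z => ?_
    have := h z F
    rw [evalAC_apply, evalAC_apply, hF] at this
    rw [Function.comp_apply, this, Complex.ofReal_re]
  refine continuous_induced_rng.2 ?_
  have h2 : (Subtype.val ∘ ψ) = fun z => ((inner ℝ (1 : ℂ) (ψ z : ℂ) : ℝ) : ℂ) +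
      ((inner ℝ Complex.I (ψ z : ℂ) : ℝ) : ℂ) * Complex.I := by
    ext z
    simp [Complex.re_add_im]
  rw [h2]
  exact (Complex.continuous_ofReal.comp (hv 1)).add
    ((Complex.continuous_ofReal.comp (hv Complex.I)).mul continuous_const)

/-- Nonempty compact sets with isomorphic algebras of absolutely continuous functions are
homeomorphic. -/
theorem nonempty_homeomorph_of_algEquiv (hσ : IsCompact σ) (hτ : IsCompact τ) (hσ' : σ.Nonempty)
    (hτ' : τ.Nonempty) (Φ : AC σ ≃A[ℂ] AC τ) : Nonempty (σ ≃ₜ τ) := by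
  have h1 : ∀ z : σ, ∃ w : τ, ∀ F, evalAC z (Φ.symm F) = evalAC w F := fun z => by
    obtain ⟨w, hw⟩ := exists_eq_evalAC hτ hτ' ((evalAC z).comp (Φ.symm : AC τ →ₐ[ℂ] AC σ))
      ((continuous_evalAC z).comp Φ.symm.continuous)
    exact ⟨w, fun F => DFunLike.congr_fun hw F⟩
  have h2 : ∀ w : τ, ∃ z : σ, ∀ F, evalAC w (Φ F) = evalAC z F := fun w => by
    obtain ⟨z, hz⟩ := exists_eq_evalAC hσ hσ' ((evalAC w).comp (Φ : AC σ →ₐ[ℂ] AC τ))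
      ((continuous_evalAC w).comp Φ.continuous)
    exact ⟨z, fun F => DFunLike.congr_fun hz F⟩
  choose ψ hψ using h1
  choose ψ' hψ' using h2
  refine ⟨⟨⟨ψ, ψ', fun z => ?_, fun w => ?_⟩, ?_, ?_⟩⟩
  · refine eq_of_forall_evalAC_eq hσ fun F => ?_
    rw [← hψ', ← hψ, Φ.symm_apply_apply]
  · refine eq_of_forall_evalAC_eq hτ fun F => ?_
    rw [← hψ, ← hψ', Φ.apply_symm_apply]
  · exact continuous_of_evalAC hτ hψ
  · exact continuous_of_evalAC hσ hψ'

/-! ### Change of variable -/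

theorem comp_mem_acFunctions {h : σ → τ} {C : ℝ≥0∞} (hC : C ≠ ∞)
    (hbv : ∀ g : τ → ℂ, bvNorm (g ∘ h) ≤ C * bvNorm g)
    (hpoly : ∀ g ∈ polyFunctions τ, g ∘ h ∈ acFunctions σ) {g : τ → ℂ} (hg : g ∈ acFunctions τ) :
    g ∘ h ∈ acFunctions σ := by
  refine mem_acFunctions_of_approx fun ε hε => ?_
  have hpos : 0 < C.toReal + 1 := by positivity
  obtain ⟨p, hp, hgp⟩ := exists_poly_of_mem hg (div_pos hε hpos)
  refine ⟨p ∘ h, hpoly p hp, ?_⟩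
  refine ((hbv (g - p)).trans (mul_le_mul_right hgp.le C)).trans_lt ?_
  have e : C * ENNReal.ofReal (ε / (C.toReal + 1)) =
      ENNReal.ofReal (C.toReal * (ε / (C.toReal + 1))) := by
    rw [ENNReal.ofReal_mul ENNReal.toReal_nonneg, ENNReal.ofReal_toReal hC]
  rw [e, ENNReal.ofReal_lt_ofReal_iff hε, mul_div_assoc', div_lt_iff₀ hpos]
  nlinarith [hε]

/-- A map under which composition preserves `AC` and is bounded induces a continuous homomorphism
of algebras. -/
theorem exists_algHom_comp {h : σ → τ} {C : ℝ≥0∞} (hC : C ≠ ∞)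
    (hbv : ∀ g : τ → ℂ, bvNorm (g ∘ h) ≤ C * bvNorm g)
    (hpoly : ∀ g ∈ polyFunctions τ, g ∘ h ∈ acFunctions σ) :
    ∃ Ψ : AC τ →ₐ[ℂ] AC σ, Continuous Ψ ∧ ∀ F : AC τ, BV.toFun σ (Ψ F) = BV.toFun τ F ∘ h := by
  choose Ψ hΨ using fun F : AC τ =>
    exists_ac_eq (comp_mem_acFunctions hC hbv hpoly (toFun_mem_acFunctions F))
  let Ψ' : AC τ →ₐ[ℂ] AC σ :=
    { toFun := Ψ
      map_one' := ac_ext (by rw [hΨ]; rfl)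
      map_mul' := fun F G => ac_ext (by
        rw [hΨ]
        change _ = BV.toFun σ (Ψ F) * BV.toFun σ (Ψ G)
        rw [hΨ, hΨ]
        rfl)
      map_zero' := ac_ext (by rw [hΨ]; rfl)
      map_add' := fun F G => ac_ext (by
        rw [hΨ]
        change _ = BV.toFun σ (Ψ F) + BV.toFun σ (Ψ G)
        rw [hΨ, hΨ]
        rfl)
      commutes' := fun c => ac_ext (by rw [hΨ]; rfl) }
  refine ⟨Ψ', AddMonoidHomClass.continuous_of_bound Ψ' C.toReal fun F => ?_, hΨ⟩
  change ‖((Ψ F : AC σ) : BV σ)‖ ≤ C.toReal * ‖(F : BV τ)‖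
  rw [BV.norm_def, BV.norm_def, hΨ, ← ENNReal.toReal_mul]
  exact ENNReal.toReal_mono (ENNReal.mul_ne_top hC (BV.bvNorm_lt_top _).ne) (hbv _)

theorem nonempty_algEquiv_of_equiv (h : σ ≃ τ) {C D : ℝ≥0∞} (hC : C ≠ ∞) (hD : D ≠ ∞)
    (hbv : ∀ g : τ → ℂ, bvNorm (g ∘ h) ≤ C * bvNorm g)
    (hbv' : ∀ g : σ → ℂ, bvNorm (g ∘ h.symm) ≤ D * bvNorm g)
    (hpoly : ∀ g ∈ polyFunctions τ, g ∘ h ∈ acFunctions σ)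
    (hpoly' : ∀ g ∈ polyFunctions σ, g ∘ h.symm ∈ acFunctions τ) :
    Nonempty (AC σ ≃A[ℂ] AC τ) := by
  obtain ⟨Ψ, hΨc, hΨ⟩ := exists_algHom_comp hC hbv hpoly
  obtain ⟨Θ, hΘc, hΘ⟩ := exists_algHom_comp hD hbv' hpoly'
  have h1 : ∀ F, Ψ (Θ F) = F := fun F => ac_ext (by
    rw [hΨ, hΘ, Function.comp_assoc, h.symm_comp_self, Function.comp_id])
  have h2 : ∀ F, Θ (Ψ F) = F := fun F => ac_ext (by
    rw [hΘ, hΨ, Function.comp_assoc, h.self_comp_symm, Function.comp_id])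
  exact ⟨⟨AlgEquiv.ofAlgHom Θ Ψ (AlgHom.ext h2) (AlgHom.ext h1), hΘc, hΨc⟩⟩

end ACSigma

namespace ACSigma

open Filter Topology

/-! ### Piecewise affine maps between arc systems -/

variable {σ τ : Set ℂ} {ι κ : Type*}

/-- The map carries the pieces of a finite subdivision of each arc into arcs, affinely in the
parameters. -/
def IsPiecewiseAffine (A : ArcSystem σ ι) (B : ArcSystem τ κ) (h : σ → τ) : Prop :=
  ∀ j, ∃ F : Finset ℝ, 0 ∈ F ∧ 1 ∈ F ∧
    ∀ a ∈ F, ∀ b ∈ F, a < b → (∀ c ∈ F, c ∉ Ioo a b) →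
      ∃ (m : κ) (p q : ℝ), ∀ t ∈ Icc a b, p + q * t ∈ Icc (0 : ℝ) 1 ∧
        h (A.c j t) = B.c m (p + q * t)

theorem eVariationOn_comp_affine_le (f : ℝ → ℂ) {a b p q : ℝ} {s : Set ℝ}
    (h : ∀ t ∈ Icc a b, p + q * t ∈ s) :
    eVariationOn (fun t => f (p + q * t)) (Icc a b) ≤ eVariationOn f s := by
  rcases le_total 0 q with hq | hq
  · exact eVariationOn.comp_le_of_monotoneOn f (fun t => p + q * t)
      (fun x _ y _ hxy => by simpa using mul_le_mul_of_nonneg_left hxy hq) h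
  · exact eVariationOn.comp_le_of_antitoneOn f (fun t => p + q * t)
      (fun x _ y _ hxy => by simpa using mul_le_mul_of_nonpos_left hxy hq) h

theorem lipschitzOnWith_Icc_union {f : ℝ → ℂ} {a b c : ℝ} (hab : a ≤ b) (hbc : b ≤ c)
    {K₁ K₂ : NNReal} (h₁ : LipschitzOnWith K₁ f (Icc a b)) (h₂ : LipschitzOnWith K₂ f (Icc b c)) :
    LipschitzOnWith (max K₁ K₂) f (Icc a c) := by
  have h₁ := h₁.weaken (le_max_left K₁ K₂)
  have h₂ := h₂.weaken (le_max_right K₁ K₂)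
  have key : ∀ x ∈ Icc a c, ∀ y ∈ Icc a c, x ≤ y →
      dist (f x) (f y) ≤ (max K₁ K₂ : NNReal) * dist x y := by
    intro x hx y hy hxy
    rcases le_total y b with hyb | hyb
    · exact h₁.dist_le_mul x ⟨hx.1, hxy.trans hyb⟩ y ⟨hy.1, hyb⟩
    rcases le_total b x with hbx | hbx
    · exact h₂.dist_le_mul x ⟨hbx, hx.2⟩ y ⟨hbx.trans hxy, hy.2⟩
    have e1 := h₁.dist_le_mul x ⟨hx.1, hbx⟩ b ⟨hab, le_rfl⟩
    have e2 := h₂.dist_le_mul b ⟨le_rfl, hbc⟩ y ⟨hyb, hy.2⟩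
    rw [Real.dist_eq, abs_sub_comm, abs_of_nonneg (by linarith)] at e1 e2 ⊢
    have := dist_triangle (f x) (f b) (f y)
    nlinarith
  refine LipschitzOnWith.of_dist_le_mul fun x hx y hy => ?_
  rcases le_total x y with h | h
  · exact key x hx y hy h
  · rw [dist_comm, dist_comm x]
    exact key y hy x hx h

namespace IsPiecewiseAffine

variable {A : ArcSystem σ ι} {B : ArcSystem τ κ} {h : σ → τ}

theorem isLip_comp (hh : IsPiecewiseAffine A B h) {g : τ → ℂ} (hg : B.IsLip g) :
    A.IsLip (g ∘ h) := by
  intro j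
  obtain ⟨F, h0, h1, hF⟩ := hh j
  refine rel_of_finite_partition (R := fun a b => ∃ K, LipschitzOnWith K ((g ∘ h) ∘ A.c j) (Icc a b))
    F ?_ ?_ h0 h1 zero_lt_one
  · rintro a b c hab hbc ⟨K₁, h₁⟩ ⟨K₂, h₂⟩
    exact ⟨_, lipschitzOnWith_Icc_union hab.le hbc.le h₁ h₂⟩
  · intro a ha b hb hab hc
    obtain ⟨m, p, q, hm⟩ := hF a ha b hb hab hc
    obtain ⟨K, hK⟩ := hg m
    refine ⟨K * ‖q‖₊, LipschitzOnWith.of_dist_le_mul fun x hx y hy => ?_⟩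
    have := hK.dist_le_mul _ (hm x hx).1 _ (hm y hy).1
    simp only [Function.comp_apply, (hm x hx).2, (hm y hy).2] at this ⊢
    refine this.trans (le_of_eq ?_)
    rw [dist_add_left, Real.dist_eq, ← mul_sub, abs_mul, NNReal.coe_mul, coe_nnnorm,
      Real.norm_eq_abs, Real.dist_eq, mul_assoc]

theorem exists_arcNorm_comp_le [Fintype ι] [Fintype κ] (hh : IsPiecewiseAffine A B h) :
    ∃ n : ℕ, ∀ g : τ → ℂ, A.arcNorm (g ∘ h) ≤ n * B.arcNorm g := by
  have hj : ∀ j, ∃ n : ℕ, ∀ g : τ → ℂ,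
      eVariationOn ((g ∘ h) ∘ A.c j) (Icc 0 1) ≤ n * B.arcNorm g := by
    intro j
    obtain ⟨F, h0, h1, hF⟩ := hh j
    refine rel_of_finite_partition (R := fun a b => ∃ n : ℕ, ∀ g : τ → ℂ,
      eVariationOn ((g ∘ h) ∘ A.c j) (Icc a b) ≤ n * B.arcNorm g) F ?_ ?_ h0 h1 zero_lt_one
    · rintro a b c hab hbc ⟨n₁, h₁⟩ ⟨n₂, h₂⟩
      refine ⟨n₁ + n₂, fun g => ?_⟩
      have := eVariationOn.Icc_add_Icc ((g ∘ h) ∘ A.c j) (s := univ) hab.le hbc.le (mem_univ _)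
      simp only [univ_inter] at this
      rw [← this]
      push_cast
      rw [add_mul]
      exact add_le_add (h₁ g) (h₂ g)
    · intro a ha b hb hab hc
      obtain ⟨m, p, q, hm⟩ := hF a ha b hb hab hc
      refine ⟨1, fun g => ?_⟩
      rw [Nat.cast_one, one_mul]
      have heq : EqOn ((g ∘ h) ∘ A.c j) (fun t => (g ∘ B.c m) (p + q * t)) (Icc a b) :=
        fun t ht => congrArg g (hm t ht).2
      rw [eVariationOn.congr heq]
      refine (eVariationOn_comp_affine_le (g ∘ B.c m) fun t ht => (hm t ht).1).trans ?_
      exact (Finset.single_le_sum (f := fun m => eVariationOn (g ∘ B.c m) (Icc 0 1))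
        (fun _ _ => zero_le) (Finset.mem_univ m)).trans le_add_self
  choose n hn using hj
  refine ⟨1 + ∑ j, n j, fun g => ?_⟩
  unfold ArcSystem.arcNorm
  push_cast
  rw [add_mul, one_mul, Finset.sum_mul]
  refine add_le_add ?_ (Finset.sum_le_sum fun j _ => hn j g)
  exact le_trans (iSup_le fun z => enorm_le_supNorm g (h z)) le_self_add

theorem exists_bvNorm_comp_le [Fintype ι] [Fintype κ] (hh : IsPiecewiseAffine A B h) :
    ∃ C : ℝ≥0∞, C ≠ ∞ ∧ ∀ g : τ → ℂ, bvNorm (g ∘ h) ≤ C * bvNorm g := by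
  obtain ⟨C, hC, hbv⟩ := A.exists_bvNorm_le
  obtain ⟨n, hn⟩ := hh.exists_arcNorm_comp_le
  refine ⟨C * (n * (1 + 3 * Fintype.card κ)), by finiteness, fun g => ?_⟩
  refine (hbv _).trans ?_
  rw [mul_assoc, mul_assoc]
  refine mul_le_mul_right ((hn g).trans (mul_le_mul_right (B.arcNorm_le g) _)) _

end IsPiecewiseAffine

theorem nonempty_algEquiv_of_piecewiseAffine [Fintype ι] [Fintype κ] (hσ : IsCompact σ)
    (hτ : IsCompact τ) (A : ArcSystem σ ι) (B : ArcSystem τ κ) (h : σ ≃ τ)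
    (h₁ : IsPiecewiseAffine A B h) (h₂ : IsPiecewiseAffine B A h.symm) :
    Nonempty (AC σ ≃A[ℂ] AC τ) := by
  obtain ⟨C, hC, hbv⟩ := h₁.exists_bvNorm_comp_le
  obtain ⟨D, hD, hbv'⟩ := h₂.exists_bvNorm_comp_le
  exact nonempty_algEquiv_of_equiv h hC hD hbv hbv'
    (fun g hg => (h₁.isLip_comp (B.isLip_of_mem_polyFunctions hg)).mem_acFunctions A hσ)
    (fun g hg => (h₂.isLip_comp (A.isLip_of_mem_polyFunctions hg)).mem_acFunctions B hτ)

/-! ### Edges -/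

namespace ArcSystem

variable (S : ArcSystem σ ι)

/-- The piece of the `j`-th arc between the parameters `a` and `b` is an edge with respect to the
set `W` of vertices: its ends are vertices, and there are no vertices inside. -/
structure IsEdge (W : Set σ) (j : ι) (a b : ℝ) : Prop where
  nonneg : 0 ≤ a
  lt : a < b
  le_one : b ≤ 1
  left_mem : S.c j a ∈ W
  right_mem : S.c j b ∈ W
  notMem : ∀ t ∈ Ioo a b, S.c j t ∉ W

/-- The set of the endpoints of all arcs. -/
def ends : Set σ := (range fun j => S.c j 0) ∪ range fun j => S.c j 1

theorem finite_ends [Finite ι] : S.ends.Finite := (finite_range _).union (finite_range _)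

variable {S} {W : Set σ}

theorem zero_mem (hW : S.ends ⊆ W) (j : ι) : S.c j 0 ∈ W := hW (Or.inl ⟨j, rfl⟩)

theorem one_mem (hW : S.ends ⊆ W) (j : ι) : S.c j 1 ∈ W := hW (Or.inr ⟨j, rfl⟩)

/-- The parameters of the vertices on an arc. -/
theorem exists_finset_params (hfin : W.Finite) (j : ι) :
    ∃ F : Finset ℝ, ∀ t, t ∈ F ↔ t ∈ Icc (0 : ℝ) 1 ∧ S.c j t ∈ W := by
  have : (Icc (0 : ℝ) 1 ∩ S.c j ⁻¹' W).Finite := by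
    refine Set.Finite.of_finite_image (hfin.subset ?_) ((S.injOn j).mono inter_subset_left)
    rintro _ ⟨t, ht, rfl⟩
    exact ht.2
  exact ⟨this.toFinset, fun t => by simp⟩

theorem IsEdge.Ioo_subset {j : ι} {a b t : ℝ} (he : S.IsEdge W j a b) (ht : t ∈ Ioo a b) :
    t ∈ Ioo (0 : ℝ) 1 := ⟨he.nonneg.trans_lt ht.1, ht.2.trans_le he.le_one⟩

theorem IsEdge.Icc_subset {j : ι} {a b t : ℝ} (he : S.IsEdge W j a b) (ht : t ∈ Icc a b) :
    t ∈ Icc (0 : ℝ) 1 := ⟨he.nonneg.trans ht.1, ht.2.trans he.le_one⟩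

theorem exists_isEdge (hfin : W.Finite) (hW : S.ends ⊆ W) {z : σ} (hz : z ∉ W) :
    ∃ j a b t, S.IsEdge W j a b ∧ t ∈ Ioo a b ∧ S.c j t = z := by
  classical
  obtain ⟨j, t, ht, rfl⟩ := S.cover z
  obtain ⟨F, hF⟩ := exists_finset_params hfin j
  have h0 : 0 ∈ F.filter (· ≤ t) :=
    Finset.mem_filter.2 ⟨(hF 0).2 ⟨by simp, zero_mem hW j⟩, ht.1⟩
  have h1 : 1 ∈ F.filter (t ≤ ·) :=
    Finset.mem_filter.2 ⟨(hF 1).2 ⟨by simp, one_mem hW j⟩, ht.2⟩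
  obtain ⟨a, ha, hamax⟩ := Finset.exists_max_image _ id ⟨0, h0⟩
  obtain ⟨b, hb, hbmin⟩ := Finset.exists_min_image _ id ⟨1, h1⟩
  obtain ⟨haF, hat⟩ := Finset.mem_filter.1 ha
  obtain ⟨hbF, htb⟩ := Finset.mem_filter.1 hb
  rw [hF] at haF hbF
  have hat' : a < t := lt_of_le_of_ne hat fun h => hz (h ▸ haF.2)
  have htb' : t < b := lt_of_le_of_ne htb fun h => hz (h ▸ hbF.2)
  refine ⟨j, a, b, t, ⟨haF.1.1, hat'.trans htb', hbF.1.2, haF.2, hbF.2, fun s hs hsW => ?_⟩,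
    ⟨hat', htb'⟩, rfl⟩
  have hsF : s ∈ F := (hF s).2 ⟨⟨haF.1.1.trans hs.1.le, hs.2.le.trans hbF.1.2⟩, hsW⟩
  rcases le_total s t with hst | hst
  · exact (hamax s (Finset.mem_filter.2 ⟨hsF, hst⟩)).not_gt hs.1
  · exact (hbmin s (Finset.mem_filter.2 ⟨hsF, hst⟩)).not_gt hs.2

theorem IsEdge.eq_of_eq {j k : ι} {a b a' b' s t : ℝ} (he : S.IsEdge W j a b)
    (he' : S.IsEdge W k a' b') (hs : s ∈ Ioo a b) (ht : t ∈ Ioo a' b') (h : S.c j s = S.c k t) :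
    j = k ∧ a = a' ∧ b = b' ∧ s = t := by
  have hs' := he.Ioo_subset hs
  have hjk : j = k := by
    by_contra hne
    rcases (S.inter hne (Ioo_subset_Icc_self hs') (Ioo_subset_Icc_self (he'.Ioo_subset ht)) h).1
      with h | h
    · exact hs'.1.ne' h
    · exact hs'.2.ne h
  subst hjk
  have hst : s = t := S.injOn j (Ioo_subset_Icc_self hs')
    (Ioo_subset_Icc_self (he'.Ioo_subset ht)) h
  subst hst
  refine ⟨rfl, ?_, ?_, rfl⟩
  · rcases lt_trichotomy a a' with h | h | h
    · exact absurd he'.left_mem (he.notMem a' ⟨h, ht.1.trans hs.2⟩)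
    · exact h
    · exact absurd he.left_mem (he'.notMem a ⟨h, hs.1.trans ht.2⟩)
  · rcases lt_trichotomy b b' with h | h | h
    · exact absurd he.right_mem (he'.notMem b ⟨ht.1.trans hs.2, h⟩)
    · exact h
    · exact absurd he'.right_mem (he.notMem b' ⟨hs.1.trans ht.2, h⟩)

/-- The interior of an edge is open. -/
theorem IsEdge.isOpen_image [Finite ι] {j : ι} {a b : ℝ} (he : S.IsEdge W j a b) :
    IsOpen (S.c j '' Ioo a b) := by
  rw [isOpen_iff_mem_nhds]
  rintro _ ⟨t, ht, rfl⟩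
  refine S.eventually_nhds fun k s hs hks => ?_
  have ht' := he.Ioo_subset ht
  have hkj : k = j := by
    by_contra hne
    rcases (S.inter hne hs (Ioo_subset_Icc_self ht') hks).2 with h | h
    · exact ht'.1.ne' h
    · exact ht'.2.ne h
  subst hkj
  have hst : s = t := S.injOn k hs (Ioo_subset_Icc_self ht') hks
  subst hst
  filter_upwards [mem_nhdsWithin_of_mem_nhds (Ioo_mem_nhds ht.1 ht.2)] with s' hs'
  exact mem_image_of_mem _ hs'

theorem IsEdge.isClosed_image {j : ι} {a b : ℝ} : IsClosed (S.c j '' Icc a b) :=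
  (isCompact_Icc.image (S.continuous j)).isClosed

variable {B : ArcSystem τ κ}

/-- A homeomorphism which respects the vertices maps the interior of each edge, being connected,
into the interior of an edge. -/
theorem IsEdge.image_subset [Finite κ] (h : σ ≃ₜ τ) (hfin : W.Finite) (hB : B.ends ⊆ h '' W)
    {j : ι} {a b : ℝ} (he : S.IsEdge W j a b) :
    ∃ m a' b', B.IsEdge (h '' W) m a' b' ∧ h '' (S.c j '' Ioo a b) ⊆ B.c m '' Ioo a' b' := by
  obtain ⟨t₀, ht₀⟩ := exists_between he.lt
  have hnot : ∀ z, z ∉ W → h z ∉ h '' W := fun z hz hz' => hz (h.injective.mem_set_image.1 hz')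
  obtain ⟨m, a', b', t', he', ht', hmt⟩ := exists_isEdge (hfin.image h) hB
    (hnot _ (he.notMem t₀ ht₀))
  refine ⟨m, a', b', he', ?_⟩
  have hpre : IsPreconnected (h '' (S.c j '' Ioo a b)) :=
    (isPreconnected_Ioo.image _ (S.continuous j).continuousOn).image _ h.continuous.continuousOn
  refine hpre.subset_left_of_subset_union he'.isOpen_image
    (IsEdge.isClosed_image (S := B) (j := m) (a := a') (b := b')).isOpen_compl ?_ ?_ ?_
  · rw [disjoint_compl_right_iff_subset]
    exact image_mono Ioo_subset_Icc_self
  · rintro _ ⟨_, ⟨t, ht, rfl⟩, rfl⟩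
    by_cases hw : h (S.c j t) ∈ B.c m '' Icc a' b'
    · obtain ⟨s, hs, hst⟩ := hw
      have hn := hnot _ (he.notMem t ht)
      rw [← hst] at hn
      refine Or.inl ⟨s, ⟨lt_of_le_of_ne hs.1 fun e => hn (e ▸ he'.left_mem),
        lt_of_le_of_ne hs.2 fun e => hn (e ▸ he'.right_mem)⟩, hst⟩
    · exact Or.inr hw
  · exact ⟨h (S.c j t₀), mem_image_of_mem _ (mem_image_of_mem _ ht₀), t', ht', hmt⟩

theorem affine_mem_iff {a b a' b' : ℝ} (hab : a < b) (hab' : a' < b') (t : ℝ) :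
    ((a' - (b' - a') / (b - a) * a) + (b' - a') / (b - a) * t ∈ Ioo a' b' ↔ t ∈ Ioo a b) ∧
    ((a' - (b' - a') / (b - a) * a) + (b' - a') / (b - a) * t ∈ Icc a' b' ↔ t ∈ Icc a b) ∧
    ((b' + (b' - a') / (b - a) * a) + -((b' - a') / (b - a)) * t ∈ Ioo a' b' ↔ t ∈ Ioo a b) ∧
    ((b' + (b' - a') / (b - a) * a) + -((b' - a') / (b - a)) * t ∈ Icc a' b' ↔ t ∈ Icc a b) := by
  set q := (b' - a') / (b - a) with hq
  have hq0 : 0 < q := div_pos (by linarith) (by linarith)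
  have hqb : q * (b - a) = b' - a' := div_mul_cancel₀ _ (by linarith)
  simp only [mem_Ioo, mem_Icc]
  refine ⟨⟨fun ⟨h1, h2⟩ => ⟨?_, ?_⟩, fun ⟨h1, h2⟩ => ⟨?_, ?_⟩⟩,
    ⟨fun ⟨h1, h2⟩ => ⟨?_, ?_⟩, fun ⟨h1, h2⟩ => ⟨?_, ?_⟩⟩,
    ⟨fun ⟨h1, h2⟩ => ⟨?_, ?_⟩, fun ⟨h1, h2⟩ => ⟨?_, ?_⟩⟩,
    ⟨fun ⟨h1, h2⟩ => ⟨?_, ?_⟩, fun ⟨h1, h2⟩ => ⟨?_, ?_⟩⟩⟩ <;> nlinarith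

/-- A homeomorphism which respects the vertices maps each edge onto an edge; the two edges are
matched, with the same images of the ends, by an affine change of parameter. -/
theorem IsEdge.exists_affine [Finite ι] [Finite κ] (h : σ ≃ₜ τ) (hfin : W.Finite)
    (hS : S.ends ⊆ W) (hB : B.ends ⊆ h '' W) {j : ι} {a b : ℝ} (he : S.IsEdge W j a b) :
    ∃ (m : κ) (a' b' p q : ℝ), B.IsEdge (h '' W) m a' b' ∧
      h '' (S.c j '' Ioo a b) = B.c m '' Ioo a' b' ∧
      h (S.c j a) = B.c m (p + q * a) ∧ h (S.c j b) = B.c m (p + q * b) ∧ q ≠ 0 ∧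
      (∀ t, p + q * t ∈ Ioo a' b' ↔ t ∈ Ioo a b) ∧
      ∀ t, p + q * t ∈ Icc a' b' ↔ t ∈ Icc a b := by
  obtain ⟨m, a', b', he', hsub⟩ := he.image_subset (B := B) h hfin hB
  have himg : h.symm '' (h '' W) = W := by
    rw [← image_comp, h.symm_comp_self, image_id]
  obtain ⟨k, a₁, b₁, he₁, hsub₁⟩ := he'.image_subset (B := S) h.symm (hfin.image h)
    (by rwa [himg])
  rw [himg] at he₁
  have hsurj : B.c m '' Ioo a' b' ⊆ h '' (S.c j '' Ioo a b) := by
    obtain ⟨t₀, ht₀⟩ := exists_between he.lt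
    have h1 : S.c j t₀ ∈ S.c k '' Ioo a₁ b₁ := hsub₁ ⟨h (S.c j t₀),
      hsub (mem_image_of_mem _ (mem_image_of_mem _ ht₀)), h.symm_apply_apply _⟩
    obtain ⟨t₁, ht₁, h1⟩ := h1
    obtain ⟨rfl, rfl, rfl, -⟩ := he₁.eq_of_eq he ht₁ ht₀ h1
    intro w hw
    exact ⟨h.symm w, hsub₁ (mem_image_of_mem _ hw), h.apply_symm_apply w⟩
  have heq := hsub.antisymm hsurj
  -- the images of the ends of the edge are ends of the image edge
  have hends : ∀ t ∈ Icc a b, S.c j t ∈ W → h (S.c j t) = B.c m a' ∨ h (S.c j t) = B.c m b' := by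
    intro t ht htW
    have h1 : h (S.c j t) ∈ closure ((h ∘ S.c j) '' Ioo a b) := by
      refine image_closure_subset_closure_image (h.continuous.comp (S.continuous j)) ?_
      rw [closure_Ioo he.lt.ne]
      exact mem_image_of_mem (h ∘ S.c j) ht
    have h2 : h (S.c j t) ∈ B.c m '' Icc a' b' := by
      refine closure_minimal ?_ IsEdge.isClosed_image h1
      rw [image_comp]
      exact hsub.trans (image_mono Ioo_subset_Icc_self)
    obtain ⟨s, hs, hst⟩ := h2
    have hsW : B.c m s ∈ h '' W := hst ▸ mem_image_of_mem h htW
    rcases hs.1.eq_or_lt with h3 | h3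
    · exact Or.inl (by rw [← hst, h3])
    rcases hs.2.eq_or_lt with h4 | h4
    · exact Or.inr (by rw [← hst, h4])
    exact absurd hsW (he'.notMem s ⟨h3, h4⟩)
  have hne : h (S.c j a) ≠ h (S.c j b) := fun e => he.lt.ne (S.injOn j
    (he.Icc_subset (left_mem_Icc.2 he.lt.le)) (he.Icc_subset (right_mem_Icc.2 he.lt.le))
    (h.injective e))
  have hba : b - a ≠ 0 := (sub_pos.2 he.lt).ne'
  have hba' : b' - a' ≠ 0 := (sub_pos.2 he'.lt).ne'
  rcases hends a (left_mem_Icc.2 he.lt.le) he.left_mem with ha | ha <;>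
    rcases hends b (right_mem_Icc.2 he.lt.le) he.right_mem with hb | hb
  · exact absurd (ha.trans hb.symm) hne
  · refine ⟨m, a', b', _, _, he', heq, ?_, ?_, div_ne_zero hba' hba,
      fun t => (affine_mem_iff he.lt he'.lt t).1, fun t => (affine_mem_iff he.lt he'.lt t).2.1⟩
    · rw [ha, sub_add_cancel]
    · rw [hb]
      congr 1
      field_simp
      ring
  · refine ⟨m, a', b', _, _, he', heq, ?_, ?_, neg_ne_zero.2 (div_ne_zero hba' hba),
      fun t => (affine_mem_iff he.lt he'.lt t).2.2.1,
      fun t => (affine_mem_iff he.lt he'.lt t).2.2.2⟩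
    · rw [ha]
      congr 1
      ring
    · rw [hb]
      congr 1
      field_simp
      ring
  · exact absurd (ha.trans hb.symm) hne

/-- A homeomorphism between sets with arc systems can be replaced by a bijection which is
piecewise affine in both directions. -/
theorem exists_piecewiseAffine_equiv [Finite ι] [Finite κ] (A : ArcSystem σ ι)
    (B : ArcSystem τ κ) (h : σ ≃ₜ τ) :
    ∃ h' : σ ≃ τ, IsPiecewiseAffine A B h' ∧ IsPiecewiseAffine B A h'.symm := by
  classical
  -- The vertices are the endpoints of all arcs of both systems, transported by `h`.
  set W : Set σ := A.ends ∪ h ⁻¹' B.ends with hWdef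
  have hfin : W.Finite := A.finite_ends.union (B.finite_ends.preimage h.injective.injOn)
  have hA : A.ends ⊆ W := subset_union_left
  have hB : B.ends ⊆ h '' W := fun w hw =>
    ⟨h.symm w, Or.inr (by rwa [mem_preimage, h.apply_symm_apply]), h.apply_symm_apply w⟩
  have hnot : ∀ z, z ∉ W → h z ∉ h '' W := fun z hz hz' => hz (h.injective.mem_set_image.1 hz')
  choose m a' b' p q he' himg hleft hright hq hIoo hIcc using
    fun (j : ι) (a b : ℝ) (he : A.IsEdge W j a b) => he.exists_affine (B := B) h hfin hA hB
  choose J a b T hE hT hJT using fun (z : σ) (hz : z ∉ W) => exists_isEdge hfin hA hz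
  let f : σ → τ := fun z => if hz : z ∈ W then h z else
    B.c (m _ _ _ (hE z hz)) (p _ _ _ (hE z hz) + q _ _ _ (hE z hz) * T z hz)
  have hfW : ∀ z ∈ W, f z = h z := fun z hz => dif_pos hz
  have hf' : ∀ z, z ∉ W → ∀ j a b (he : A.IsEdge W j a b) (t : ℝ), t ∈ Ioo a b → A.c j t = z →
      f z = B.c (m j a b he) (p j a b he + q j a b he * t) := by
    intro z hz j a b he t ht hjt
    obtain ⟨rfl, rfl, rfl, rfl⟩ := (hE z hz).eq_of_eq he (hT z hz) ht ((hJT z hz).trans hjt.symm)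
    exact dif_neg hz
  have hf : ∀ j a b (he : A.IsEdge W j a b), ∀ t ∈ Icc a b,
      f (A.c j t) = B.c (m j a b he) (p j a b he + q j a b he * t) := by
    intro j a b he t ht
    rcases ht.1.eq_or_lt with rfl | h1
    · rw [hfW _ he.left_mem, hleft]
    rcases ht.2.eq_or_lt with rfl | h2
    · rw [hfW _ he.right_mem, hright]
    exact hf' _ (he.notMem t ⟨h1, h2⟩) j a b he t ⟨h1, h2⟩ rfl
  -- `f` maps each open edge onto its image under `h`
  have hfmem : ∀ j a b (he : A.IsEdge W j a b), ∀ t ∈ Ioo a b,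
      f (A.c j t) ∈ h '' (A.c j '' Ioo a b) := by
    intro j a b he t ht
    rw [hf j a b he t (Ioo_subset_Icc_self ht), himg j a b he]
    exact mem_image_of_mem _ ((hIoo j a b he t).2 ht)
  have hfnot : ∀ z, z ∉ W → f z ∉ h '' W := by
    intro z hz
    obtain ⟨j, a, b, t, he, ht, rfl⟩ := exists_isEdge hfin hA hz
    obtain ⟨_, ⟨s, hs, rfl⟩, hsf⟩ := hfmem j a b he t ht
    rw [← hsf]
    exact hnot _ (he.notMem s hs)
  have hinj : Function.Injective f := by
    intro z w hzw
    by_cases hz : z ∈ W <;> by_cases hw : w ∈ W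
    · rw [hfW z hz, hfW w hw] at hzw
      exact h.injective hzw
    · rw [hfW z hz] at hzw
      exact absurd (hzw ▸ mem_image_of_mem h hz) (hfnot w hw)
    · rw [hfW w hw] at hzw
      exact absurd (hzw ▸ mem_image_of_mem h hw) (hfnot z hz)
    · obtain ⟨j, a, b, t, he, ht, rfl⟩ := exists_isEdge hfin hA hz
      obtain ⟨k, a₁, b₁, s, he₁, hs, rfl⟩ := exists_isEdge hfin hA hw
      obtain ⟨_, ⟨t', ht', rfl⟩, htf⟩ := hfmem j a b he t ht
      obtain ⟨_, ⟨s', hs', rfl⟩, hsf⟩ := hfmem k a₁ b₁ he₁ s hs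
      obtain ⟨rfl, rfl, rfl, -⟩ := he.eq_of_eq he₁ ht' hs'
        (h.injective (htf.trans (hzw.trans hsf.symm)))
      rw [hf _ _ _ he t (Ioo_subset_Icc_self ht), hf _ _ _ he s (Ioo_subset_Icc_self hs)] at hzw
      have e := B.injOn _
        ((he' _ _ _ he).Icc_subset ((hIcc _ _ _ he t).2 (Ioo_subset_Icc_self ht)))
        ((he' _ _ _ he).Icc_subset ((hIcc _ _ _ he s).2 (Ioo_subset_Icc_self hs))) hzw
      have : t = s := mul_left_cancel₀ (hq _ _ _ he) (add_left_cancel e)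
      rw [this]
  -- each edge of `B` is the image of an edge of `A`
  have hsource : ∀ k c d t', B.IsEdge (h '' W) k c d → t' ∈ Ioo c d → ∃ j a b, ∃ he : A.IsEdge W j a b,
      m j a b he = k ∧ a' j a b he = c ∧ b' j a b he = d := by
    intro k c d t' hcd ht'
    have hw : h.symm (B.c k t') ∉ W := fun hw =>
      hcd.notMem t' ht' ⟨_, hw, h.apply_symm_apply _⟩
    obtain ⟨j, a, b, t, he, ht, hjt⟩ := exists_isEdge hfin hA hw
    have hmem : B.c k t' ∈ h '' (A.c j '' Ioo a b) :=
      ⟨_, ⟨t, ht, hjt⟩, h.apply_symm_apply _⟩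
    rw [himg j a b he] at hmem
    obtain ⟨s, hs, hst⟩ := hmem
    obtain ⟨e1, e2, e3, -⟩ := (he' j a b he).eq_of_eq hcd hs ht' hst
    exact ⟨j, a, b, he, e1, e2, e3⟩
  have hback : ∀ j a b (he : A.IsEdge W j a b), ∀ t ∈ Icc (a' j a b he) (b' j a b he),
      -(p j a b he / q j a b he) + (q j a b he)⁻¹ * t ∈ Icc a b ∧
      f (A.c j (-(p j a b he / q j a b he) + (q j a b he)⁻¹ * t)) = B.c (m j a b he) t := by
    intro j a b he t ht
    have hq0 := hq j a b he
    have hpq : p j a b he + q j a b he * (-(p j a b he / q j a b he) + (q j a b he)⁻¹ * t) = t := by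
      field_simp
      ring
    have hmem : -(p j a b he / q j a b he) + (q j a b he)⁻¹ * t ∈ Icc a b := by
      rw [← hIcc j a b he, hpq]
      exact ht
    exact ⟨hmem, by rw [hf j a b he _ hmem, hpq]⟩
  have hsurj : Function.Surjective f := by
    intro w
    by_cases hw : w ∈ h '' W
    · obtain ⟨z, hz, rfl⟩ := hw
      exact ⟨z, hfW z hz⟩
    · obtain ⟨k, c, d, t, hcd, ht, rfl⟩ := exists_isEdge (hfin.image h) hB hw
      obtain ⟨j, a, b, he, rfl, rfl, rfl⟩ := hsource k c d t hcd ht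
      exact ⟨_, (hback j a b he t (Ioo_subset_Icc_self ht)).2⟩
  refine ⟨Equiv.ofBijective f ⟨hinj, hsurj⟩, fun j => ?_, fun k => ?_⟩
  · obtain ⟨F, hF⟩ := exists_finset_params (S := A) hfin j
    refine ⟨F, (hF 0).2 ⟨by simp, zero_mem hA j⟩, (hF 1).2 ⟨by simp, one_mem hA j⟩,
      fun a ha b hb hab hc => ?_⟩
    rw [hF] at ha hb
    have he : A.IsEdge W j a b := ⟨ha.1.1, hab, hb.1.2, ha.2, hb.2, fun t ht htW =>
      hc t ((hF t).2 ⟨⟨ha.1.1.trans ht.1.le, ht.2.le.trans hb.1.2⟩, htW⟩) ht⟩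
    exact ⟨m j a b he, p j a b he, q j a b he, fun t ht =>
      ⟨(he' j a b he).Icc_subset ((hIcc j a b he t).2 ht), hf j a b he t ht⟩⟩
  · obtain ⟨F, hF⟩ := exists_finset_params (S := B) (hfin.image h) k
    refine ⟨F, (hF 0).2 ⟨by simp, zero_mem hB k⟩, (hF 1).2 ⟨by simp, one_mem hB k⟩,
      fun c hc d hd hcd hcons => ?_⟩
    rw [hF] at hc hd
    have hcd' : B.IsEdge (h '' W) k c d := ⟨hc.1.1, hcd, hd.1.2, hc.2, hd.2, fun t ht htW =>
      hcons t ((hF t).2 ⟨⟨hc.1.1.trans ht.1.le, ht.2.le.trans hd.1.2⟩, htW⟩) ht⟩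
    obtain ⟨t₀, ht₀⟩ := exists_between hcd
    obtain ⟨j, a, b, he, rfl, rfl, rfl⟩ := hsource k c d t₀ hcd' ht₀
    refine ⟨j, -(p j a b he / q j a b he), (q j a b he)⁻¹, fun t ht => ?_⟩
    obtain ⟨h1, h2⟩ := hback j a b he t ht
    refine ⟨he.Icc_subset h1, ?_⟩
    rw [Equiv.symm_apply_eq]
    exact h2.symm

end ArcSystem

end ACSigma

namespace ACSigma

open Filter Topology

/-! ### Polygonally inscribed curves as arc systems -/

/-- A differentiable convex curve, parametrised proportionally to arc length by the unit interval.
The parametrisation is constant on each side of this interval. -/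
theorem IsDiffConvexCurve.exists_param {C : Set ℂ} {p q : ℂ} (h : IsDiffConvexCurve C p q) :
    ∃ c : ℝ → ℂ, IsConvexArc c ∧ (∀ t, c t ∈ C) ∧ c '' Icc 0 1 = C ∧ c 0 = p ∧ c 1 = q ∧
      (∃ K, LipschitzOnWith K c (Icc 0 1)) ∧
      ∃ L > 0, ∀ t ∈ Ioo (0 : ℝ) 1, ∃ d : ℂ, ‖d‖ = L ∧ HasDerivAt c d t := by
  obtain ⟨⟨L, γ, hL, hcont, hinj, himg, h0, h1, hd⟩, hsupp⟩ := h
  have hmem : ∀ t ∈ Icc (0 : ℝ) 1, L * t ∈ Icc 0 L := fun t ht =>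
    ⟨mul_nonneg hL.le ht.1, by nlinarith [ht.2]⟩
  let c : ℝ → ℂ := IccExtend (zero_le_one' ℝ) fun t => γ (L * t)
  have hcI : ∀ t ∈ Icc (0 : ℝ) 1, c t = γ (L * t) := fun t ht => IccExtend_of_mem _ _ ht
  have hc : Continuous c := by
    refine Continuous.Icc_extend' (h := zero_le_one' ℝ) ?_
    refine hcont.comp_continuous (by fun_prop) fun t => hmem _ t.2
  have hC : ∀ t, c t ∈ C := fun t => himg ▸ mem_image_of_mem γ (hmem _ (projIcc _ _ _ t).2)
  have hder : ∀ t ∈ Ioo (0 : ℝ) 1, ∃ d : ℂ, ‖d‖ = L ∧ HasDerivAt c d t := by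
    intro t ht
    obtain ⟨d, hd1, hd2⟩ := hd (L * t) ⟨mul_pos hL ht.1, by nlinarith [ht.2]⟩
    refine ⟨L • d, by rw [norm_smul, hd1, mul_one, Real.norm_of_nonneg hL.le], ?_⟩
    have hlin : HasDerivAt (fun s : ℝ => L * s) L t := by
      simpa using (hasDerivAt_id t).const_mul L
    refine (HasDerivAt.scomp t hd2 hlin).congr_of_eventuallyEq ?_
    filter_upwards [Icc_mem_nhds ht.1 ht.2] with s hs using hcI s hs
  refine ⟨c, ⟨hc, ?_, ?_⟩, hC, ?_, ?_, ?_, ?_, L, hL, hder⟩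
  · intro s hs t ht hst
    rw [hcI s hs, hcI t ht] at hst
    exact mul_left_cancel₀ hL.ne' (hinj (hmem s hs) (hmem t ht) hst)
  · intro t _
    obtain ⟨v, hv, hvC⟩ := hsupp (c t) (hC t)
    exact ⟨v, hv, fun s _ => hvC _ (hC s)⟩
  · refine Subset.antisymm (image_subset_iff.2 fun t _ => hC t) ?_
    rw [← himg]
    rintro _ ⟨s, hs, rfl⟩
    have hsI : s / L ∈ Icc (0 : ℝ) 1 := ⟨div_nonneg hs.1 hL.le, (div_le_one hL).2 hs.2⟩
    exact ⟨s / L, hsI, by rw [hcI _ hsI, mul_div_cancel₀ _ hL.ne']⟩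
  · rw [hcI 0 (by simp), mul_zero, h0]
  · rw [hcI 1 (by simp), mul_one, h1]
  · choose! d hd1 hd2 using hder
    have hlip : LipschitzOnWith ⟨L, hL.le⟩ c (Ioo 0 1) :=
      (convex_Ioo 0 1).lipschitzOnWith_of_nnnorm_hasDerivWithin_le
        (fun t ht => (hd2 t ht).hasDerivWithinAt) fun t ht => (hd1 t ht).le
    have := hlip.closure hc.continuousOn
    rw [closure_Ioo zero_ne_one] at this
    exact ⟨_, this⟩

theorem IsConvexPolygon.convex {P : Set ℂ} (h : IsConvexPolygon P) : Convex ℝ P := by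
  obtain ⟨⟨V, rfl⟩, -⟩ := h
  exact convex_convexHull ℝ _

theorem vertices_subset_frontier (P : Set ℂ) : vertices P ⊆ frontier P := fun _ hv =>
  ⟨subset_closure hv.1, fun hi => (disjoint_interior_extremePoints P).le_bot ⟨hi, hv⟩⟩

theorem IsPolygonalMosaic.inter_subset_frontier {M : Set (Set ℂ)} (hM : IsPolygonalMosaic M)
    {P Q : Set ℂ} (hP : P ∈ M) (hQ : Q ∈ M) (hne : P ≠ Q) : P ∩ Q ⊆ frontier P := by
  intro z hz
  rcases hM.inter P hP Q hQ hne ⟨z, hz⟩ with ⟨v, hv, -, hPQ⟩ | ⟨⟨_, _, _, _, _, _, hs⟩, -⟩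
  · rw [hPQ] at hz
    exact mem_singleton_iff.1 hz ▸ vertices_subset_frontier P hv
  · exact hs hz

/-- Two members of a mosaic are separated by a line which misses the interior of the first one. -/
theorem IsPolygonalMosaic.exists_line_sep {M : Set (Set ℂ)} (hM : IsPolygonalMosaic M)
    {P Q : Set ℂ} (hP : P ∈ M) (hQ : Q ∈ M) (hne : P ≠ Q) :
    ∃ l : Line, ∀ z ∈ interior P, ∀ w ∈ Q, l.Sep z w := by
  have hdisj : Disjoint (interior P) Q := disjoint_left.2 fun z hz hzQ =>
    (hM.inter_subset_frontier hP hQ hne ⟨interior_subset hz, hzQ⟩).2 hz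
  obtain ⟨f, u, hf, hf'⟩ := geometric_hahn_banach_open (hM.polygon P hP).convex.interior
    isOpen_interior (hM.polygon Q hQ).convex hdisj
  obtain ⟨a, ha⟩ := (hM.polygon P hP).2
  obtain ⟨b, hb⟩ := (hM.polygon Q hQ).2
  set v : ℂ := (InnerProductSpace.toDual ℝ ℂ).symm f with hv
  have hfv : ∀ z, (inner ℝ v z : ℝ) = f z := fun z => InnerProductSpace.toDual_symm_apply
  have hv0 : v ≠ 0 := by
    intro h0
    have h1 := hf a ha
    have h2 := hf' b (interior_subset hb)
    rw [← hfv, h0, inner_zero_left] at h1 h2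
    exact absurd h1 h2.not_gt
  refine ⟨⟨v, u, hv0⟩, fun z hz w hw => ?_⟩
  have h1 := hf z hz
  have h2 := hf' w hw
  rw [← hfv] at h1 h2
  exact ⟨mul_nonpos_of_nonpos_of_nonneg (sub_nonpos.2 h1.le) (sub_nonneg.2 h2),
    Or.inl (sub_neg.2 h1).ne⟩

theorem exists_line_sep_of_ne {z w : ℂ} (h : z ≠ w) : ∃ l : Line, l.Sep z w := by
  have hwz : w - z ≠ 0 := sub_ne_zero.2 h.symm
  refine ⟨⟨w - z, inner ℝ (w - z) z, hwz⟩, ?_⟩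
  have h1 : (inner ℝ (w - z) z : ℝ) - inner ℝ (w - z) z = 0 := sub_self _
  have h2 : (inner ℝ (w - z) w : ℝ) - inner ℝ (w - z) z ≠ 0 := by
    rw [← inner_sub_right]
    exact inner_self_ne_zero.2 hwz
  exact ⟨(mul_eq_zero_of_left h1 _).le, Or.inr h2⟩

/-- A polygonally inscribed curve is the union of the convex arcs in the polygons of its mosaic.
Points in different polygons are separated either by a line between these polygons, or, if both
are vertices, by one of finitely many lines through vertices. -/
theorem exists_arcSystem_of_mem_PIC {σ : Set ℂ} (hσ : σ ∈ PIC) :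
    ∃ (ι : Type) (_ : Fintype ι), Nonempty (ArcSystem σ ι) := by
  classical
  obtain ⟨-, -, -, M, hM, hcov, hcurve⟩ := hσ
  have : Finite M := hM.finite.to_subtype
  let _ : Fintype M := Fintype.ofFinite M
  choose! p _ q _ hdcc hfr using hcurve
  choose c hconv hmem himg h0 h1 hlip hder using fun P : M => (hdcc P P.2).exists_param
  -- A point of the curve on the boundary of a polygon is an endpoint of the arc in this polygon.
  have hend : ∀ (P : M) (z : ℂ), z ∈ σ → z ∈ (P : Set ℂ) → z ∈ frontier (P : Set ℂ) →
      z = p P ∨ z = q P := fun P z hzσ hzP hz => by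
    have hzPQ : z ∈ (σ ∩ (P : Set ℂ)) ∩ frontier (P : Set ℂ) := ⟨⟨hzσ, hzP⟩, hz⟩
    rwa [hfr P P.2] at hzPQ
  have hpar : ∀ (P : M) {s : ℝ}, s ∈ Icc (0 : ℝ) 1 → c P s ∈ frontier (P : Set ℂ) →
      s = 0 ∨ s = 1 := fun P s hs hz => by
    rcases hend P _ (hmem P s).1 (hmem P s).2 hz with h | h
    · exact Or.inl ((hconv P).inj hs (by simp) (h.trans (h0 P).symm))
    · exact Or.inr ((hconv P).inj hs (by simp) (h.trans (h1 P).symm))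
  have hsep : ∀ e : M × M, ∃ l : Line, e.1 ≠ e.2 →
      ∀ z ∈ interior (e.1 : Set ℂ), ∀ w ∈ (e.2 : Set ℂ), l.Sep z w := fun e => by
    by_cases h : e.1 = e.2
    · exact ⟨⟨1, 0, one_ne_zero⟩, fun hne => absurd h hne⟩
    · obtain ⟨l, hl⟩ := hM.exists_line_sep e.1.2 e.2.2 fun h' => h (Subtype.ext h')
      exact ⟨l, fun _ => hl⟩
  choose lP hlP using hsep
  have hsep' : ∀ e : ℂ × ℂ, ∃ l : Line, e.1 ≠ e.2 → l.Sep e.1 e.2 := fun e => by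
    by_cases h : e.1 = e.2
    · exact ⟨⟨1, 0, one_ne_zero⟩, fun hne => absurd h hne⟩
    · obtain ⟨l, hl⟩ := exists_line_sep_of_ne h
      exact ⟨l, fun _ => hl⟩
  choose lz hlz using hsep'
  let E : Finset ℂ := Finset.univ.image (fun P : M => p P) ∪ Finset.univ.image (fun P : M => q P)
  have hE : ∀ (P : M) (z : ℂ), z = p P ∨ z = q P → z ∈ E := fun P z hz =>
    Finset.mem_union.2 (hz.imp (fun h => Finset.mem_image.2 ⟨P, Finset.mem_univ _, h.symm⟩)
      fun h => Finset.mem_image.2 ⟨P, Finset.mem_univ _, h.symm⟩)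
  refine ⟨M, inferInstance, ⟨{
    c := fun P t => ⟨c P t, (hmem P t).1⟩
    convex := hconv
    cover := ?_
    inter := ?_
    jump := ⟨Finset.univ.image lP ∪ (E ×ˢ E).image lz, ?_⟩
    lip := hlip
    deriv := hder }⟩⟩
  · rintro ⟨z, hz⟩
    obtain ⟨P, hP, hzP⟩ := hcov hz
    have hzI : z ∈ c ⟨P, hP⟩ '' Icc 0 1 := by
      rw [himg]
      exact ⟨hz, hzP⟩
    obtain ⟨t, ht, htz⟩ := hzI
    exact ⟨⟨P, hP⟩, t, ht, Subtype.ext htz⟩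
  · intro P Q s t hne hs ht hst
    have hst' : c P s = c Q t := congrArg Subtype.val hst
    have hne' : (P : Set ℂ) ≠ Q := fun h => hne (Subtype.ext h)
    refine ⟨hpar P hs (hM.inter_subset_frontier P.2 Q.2 hne' ⟨(hmem P s).2, ?_⟩),
      hpar Q ht (hM.inter_subset_frontier Q.2 P.2 hne'.symm ⟨(hmem Q t).2, ?_⟩)⟩
    · exact hst' ▸ (hmem Q t).2
    · exact hst' ▸ (hmem P s).2
  · rintro ⟨z, hz⟩ ⟨w, hw⟩ hzw
    obtain ⟨P', hP, hzP⟩ := hcov hz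
    obtain ⟨Q', hQ, hwQ⟩ := hcov hw
    obtain ⟨P, rfl⟩ : ∃ P : M, (P : Set ℂ) = P' := ⟨⟨P', hP⟩, rfl⟩
    obtain ⟨Q, rfl⟩ : ∃ Q : M, (Q : Set ℂ) = Q' := ⟨⟨Q', hQ⟩, rfl⟩
    have harc : ∀ (R : M) (y : ℂ) (hy : y ∈ σ), y ∈ (R : Set ℂ) →
        (⟨y, hy⟩ : σ) ∈ (fun t => (⟨c R t, (hmem R t).1⟩ : σ)) '' Icc (0 : ℝ) 1 := by
      intro R y hy hyR
      have hyI : y ∈ c R '' Icc 0 1 := by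
        rw [himg]
        exact ⟨hy, hyR⟩
      obtain ⟨t, ht, hty⟩ := hyI
      exact ⟨t, ht, Subtype.ext hty⟩
    have hPQ : P ≠ Q := by
      rintro rfl
      exact hzw P ⟨harc P z hz hzP, harc P w hw hwQ⟩
    have hne : z ≠ w := by
      rintro rfl
      exact hzw P ⟨harc P z hz hzP, harc P z hz hzP⟩
    by_cases hzi : z ∈ interior (P : Set ℂ)
    · exact ⟨lP (P, Q), Finset.mem_union_left _ (Finset.mem_image_of_mem _ (Finset.mem_univ _)),
        hlP (P, Q) hPQ z hzi w hwQ⟩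
    by_cases hwi : w ∈ interior (Q : Set ℂ)
    · exact ⟨lP (Q, P), Finset.mem_union_left _ (Finset.mem_image_of_mem _ (Finset.mem_univ _)),
        (hlP (Q, P) hPQ.symm w hwi z hzP).symm⟩
    · exact ⟨lz (z, w), Finset.mem_union_right _ (Finset.mem_image_of_mem _ (Finset.mem_product.2
        ⟨hE P z (hend P z hz hzP ⟨subset_closure hzP, hzi⟩),
          hE Q w (hend Q w hw hwQ ⟨subset_closure hwQ, hwi⟩)⟩)), hlz (z, w) hne⟩

end ACSigma

/-- The family of polygonally inscribed curves is a Gelfand–Kolmogorov family. -/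
theorem theorem1p1 : ACSigma.IsGelfandKolmogorovFamily ACSigma.PIC := by
  refine ⟨fun σ hσ => ⟨hσ.1, hσ.2.1⟩, fun σ hσ τ hτ => ⟨?_, ?_⟩⟩
  · rintro ⟨Φ⟩
    exact ACSigma.nonempty_homeomorph_of_algEquiv hσ.2.1 hτ.2.1 hσ.1 hτ.1 Φ
  · rintro ⟨h⟩
    obtain ⟨ι, _, ⟨A⟩⟩ := ACSigma.exists_arcSystem_of_mem_PIC hσ
    obtain ⟨κ, _, ⟨B⟩⟩ := ACSigma.exists_arcSystem_of_mem_PIC hτ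
    obtain ⟨g, hg, hg'⟩ := A.exists_piecewiseAffine_equiv B h
    exact ACSigma.nonempty_algEquiv_of_piecewiseAffine hσ.2.1 hτ.2.1 A B g hg hg'
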